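/- **Setting.** Let $\rho_1,\rho_2,b,\kappa,L>0$ with $\frac{\kappa}{\rho_1}=\frac{b}{\rho_2}$ (equal wave speeds). On $(0,L)\times(0,\infty)$ consider the Timoshenko system with infinite memory $$\rho_1\phi_{tt}-\kappa(\phi_x+\psi)_x+\kappa\int_0^\infty g(s)(\phi_x+\psi)_x(t-s)\,ds=0,$$ $$\rho_2\psi_{tt}-b\psi_{xx}+\kappa(\phi_x+\psi)-\kappa\int_0^\infty g(s)(\phi_x+\psi)(t-s)\,ds=0,$$ with $\phi=\psi_x=0$ at $x=0,L$, histories $\phi(\cdot,-s)=\phi_0(\cdot,s)$, $\psi(\cdot,-s)=\psi_0(\cdot,s)$ for $s\ge0$, and $\phi_t(\cdot,0)=\phi_1$, $\psi_t(\cdot,0)=\psi_1$. Here $\phi_0(\cdot,s)\in H^1_0(0,L)$ and $\psi_0(\cdot,s)\in H^1_*(0,L)$ for all $s\ge 0$, $\phi_1\in L^2(0,L)$, $\psi_1\in L^2_*(0,L)$, where $*$ denotes zero mean; and, with $p_{0x}:=\phi_{0x}+\psi_0$, the map $s\mapsto p_{0x}(\cdot,s)\in L^2(0,L)$ is strongly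 measurable with $\int_0^\infty g(s)\|p_{0x}(s)\|_2^2\,ds<\infty$. Let $(\phi,\psi)$ be a weak solution in $C([0,\infty);H^1_0\times H^1_*)\cap C^1([0,\infty);L^2\times L^2_*)$. Write $p_x=\phi_x+\psi$ and $$E(t)=\tfrac{\rho_1}{2}\|\phi_t\|_2^2+\tfrac{\rho_2}{2}\|\psi_t\|_2^2+\tfrac b2\|\psi_x\|_2^2+\tfrac\kappa2\Big(1-\int_0^\infty g\Big)\|p_x\|_2^2+\tfrac\kappa2\int_0^\infty g(s)\|p_x(t)-p_x(t-s)\|_2^2\,ds .$$ **Hypotheses on the kernel.** (A1) $g:[0,\infty)\to(0,\infty)$ is non-increasing, differentiable and integrable, and $$\max\Big\{\tfrac{31}{32},\tfrac{64\rho_1L^2}{64\rho_1L^2+\rho_2}\Big\}<\int_0^\infty g(s)\,ds<1 .$$ (A2) $\xi:[0,\infty)\to(0,\infty)$ is non-increasing and differentiable, $r>0$, and $H:[0,\infty)\to[0,\infty)$ is $C^1$ and positive on $(0,\infty)$, such that $$g'(t)\le-\xi(t)H(g(t))\quad\text{for all }t\ge0 .$$ Either $H(s)=as$ for some $a>0$;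 or $H(0)=H'(0)=0$, $H$ is $C^2$, strictly increasing and strictly convex on $(0,r]$, $\lim_{s\to\infty}H'(s)=\infty$, and $s\mapsto sH'(s)$ and $s\mapsto s(H')^{-1}(s)$ are convex on $(0,r]$. In the first case put $\bar H=H$. In the second let $\bar H$ be any extension of $H|_{[0,r]}$ to $[0,\infty)$ that is $C^1$ on $[0,\infty)$, $C^2$ on $(0,\infty)$, strictly increasing and strictly convex, with $\lim_{s\to\infty}\bar H'(s)=\infty$. **Notation.** $(H')^{-1}(t)=\inf\{\tau\ge0: t\le H'(\tau)\}$, which is the usual inverse when $H'$ is an increasing bijection of $[0,\infty)$, and likewise for $\bar H'$. For $q_0,c_1>0$ and $t\ge0$ let $$h_0(t)=\int_0^\infty g(t+s)\big(1+\|p_{0x}(s)\|_2^2\big)ds,\qquad q(t)=\frac{q_0}{1+\int_0^th_0(s)\,ds},$$ $$G_1(t)=\int_t^1\frac{ds}{s\bar H'(s)},\quad G_2(t)=t\bar H'(t),\quad G_3(t)=t(\bar H')^{-1}(t),\quad G_4(s)=\sup_t\,\big(st-G_3(t)\big),\quad G_5(t)=G_1^{-1}\Big(c_1\int_0^t\xi(s)\,ds\Big),$$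 where $G_1$ is regarded as a map $(0,1]\to[0,\infty)$, and the supremum is over those $t\ge0$ for which $(\bar H')^{-1}(t)$ is finite. For $q_0,c_1,c_2,c,d>0$, the class $S$ consists of all $\chi\in C^1([0,\infty))$ with $0<\chi\le1$, $\chi'\le0$ and, for all $t\ge0$, $$c_2\,G_4\Big[\frac cd\,q(t)h_0(t)\Big]\le c_1\Big(G_2\Big(\frac{G_5(t)}{\chi(t)}\Big)-\frac{G_2(G_5(t))}{\chi(t)}\Big).$$ **Theorem.** There are constants $q_0\in(0,1)$ and $c_1,c_2,c,d>0$ and a constant $C>0$ such that, for every $\chi\in S$ (the class belonging to these constants) and every $t\ge0$, $$E(t)\le\frac{C\,G_5(t)}{\chi(t)\,q(t)} .$$ -/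

import Mathlib

open MeasureTheory Set Filter Topology
open scoped ContDiff

noncomputable section

namespace Timoshenko

/-! ### Function spaces on `(0, L)` -/

/-- `L²(0, L)`. -/
abbrev L2 (L : ℝ) : Type := Lp ℝ 2 ((volume : Measure ℝ).restrict (Ioo 0 L))

/-- `v ∈ L²(0, L)` is the weak derivative of `u ∈ L²(0, L)` (so `u ∈ H¹(0, L)` and `u_x = v`). -/
def HasWeakDeriv {L : ℝ} (u v : L2 L) : Prop :=
  ∀ η : ℝ → ℝ, ContDiff ℝ ∞ η → HasCompactSupport η → tsupport η ⊆ Ioo 0 L →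
    ∫ x in Ioo 0 L, u x * deriv η x = - ∫ x in Ioo 0 L, v x * η x

/-- `u` has zero mean over `(0, L)`; for `u ∈ L²(0, L)` this is `u ∈ L²_*(0, L)`. -/
def MeanZero {L : ℝ} (u : L2 L) : Prop := ∫ x in Ioo 0 L, u x = 0

/-- `u ∈ H¹₀(0, L)` with `u_x = v`: the continuous representative of `u` vanishes at `0` and `L`. -/
def MemH10 {L : ℝ} (u v : L2 L) : Prop :=
  HasWeakDeriv u v ∧
    ∃ w : ℝ → ℝ, ContinuousOn w (Icc 0 L) ∧ w 0 = 0 ∧ w L = 0 ∧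
      ∀ᵐ x ∂((volume : Measure ℝ).restrict (Ioo 0 L)), u x = w x

/-- `u ∈ H¹_*(0, L)` with `u_x = v`. -/
def MemH1Star {L : ℝ} (u v : L2 L) : Prop := HasWeakDeriv u v ∧ MeanZero u

/-! ### The system -/

/-- The physical constants of the beam. -/
structure Beam where
  ρ₁ : ℝ
  ρ₂ : ℝ
  b : ℝ
  κ : ℝ
  L : ℝ
  ρ₁_pos : 0 < ρ₁
  ρ₂_pos : 0 < ρ₂
  b_pos : 0 < b
  κ_pos : 0 < κ
  L_pos : 0 < L

/-- Initial data: the histories `φ₀(·, s)`, `ψ₀(·, s)` for `s ≥ 0`, with their space derivatives, and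
the initial velocities. -/
structure InitialData (L : ℝ) where
  φ₀ : ℝ → L2 L
  φ₀x : ℝ → L2 L
  φ₁ : L2 L
  ψ₀ : ℝ → L2 L
  ψ₀x : ℝ → L2 L
  ψ₁ : L2 L

/-- The shear `φ₀ₓ(·, s) + ψ₀(·, s)` of the history, at time `-s`. -/
def InitialData.shear {L : ℝ} (D : InitialData L) (s : ℝ) : L2 L := D.φ₀x s + D.ψ₀ s

/-- The data lie in `H¹₀ × L² × H¹_* × L²_*`, and the history of the shear has finite memory energy. -/
structure InitialData.Admissible {L : ℝ} (g : ℝ → ℝ) (D : InitialData L) : Prop where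
  φ₀_mem : ∀ s, 0 ≤ s → MemH10 (D.φ₀ s) (D.φ₀x s)
  ψ₀_mem : ∀ s, 0 ≤ s → MemH1Star (D.ψ₀ s) (D.ψ₀x s)
  ψ₁_mem : MeanZero D.ψ₁
  shear_meas : AEStronglyMeasurable D.shear (volume.restrict (Ioi 0))
  shear_int : IntegrableOn (fun s => g s * ‖D.shear s‖ ^ 2) (Ioi 0)

/-- The unknowns, as functions of time with values in `L²(0, L)`, together with their space and time
derivatives. Times `t < 0` carry the history. -/
structure Trajectory (L : ℝ) where
  φ : ℝ → L2 L
  φx : ℝ → L2 L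
  φt : ℝ → L2 L
  ψ : ℝ → L2 L
  ψx : ℝ → L2 L
  ψt : ℝ → L2 L

/-- The shear `p_x = φ_x + ψ`. -/
def Trajectory.px {L : ℝ} (U : Trajectory L) (t : ℝ) : L2 L := U.φx t + U.ψ t

/-- `p_x(t) - ∫₀^∞ g(s) p_x(t - s) ds`, an `L²(0, L)`-valued integral. -/
def Trajectory.stress {L : ℝ} (g : ℝ → ℝ) (U : Trajectory L) (t : ℝ) : L2 L :=
  U.px t - ∫ s in Ioi (0 : ℝ), g s • U.px (t - s)

/-- `U` is a weak solution, in the class `C([0,∞); H¹₀ × H¹_*) ∩ C¹([0,∞); L² × L²_*)`, of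

`ρ₁ φ_tt - κ (φ_x + ψ)_x + κ ∫₀^∞ g(s) (φ_x + ψ)_x(t - s) ds = 0`,
`ρ₂ ψ_tt - b ψ_xx + κ (φ_x + ψ) - κ ∫₀^∞ g(s) (φ_x + ψ)(t - s) ds = 0`,

with `φ = ψ_x = 0` at `x = 0, L` and initial data `D`. The condition on `ψ_x` is the natural boundary
condition of the second variational equation. -/
structure IsWeakSolution (B : Beam) (g : ℝ → ℝ) (D : InitialData B.L) (U : Trajectory B.L) :
    Prop where
  φ_hist : ∀ s, 0 ≤ s → U.φ (-s) = D.φ₀ s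
  φx_hist : ∀ s, 0 ≤ s → U.φx (-s) = D.φ₀x s
  ψ_hist : ∀ s, 0 ≤ s → U.ψ (-s) = D.ψ₀ s
  ψx_hist : ∀ s, 0 ≤ s → U.ψx (-s) = D.ψ₀x s
  φt_init : U.φt 0 = D.φ₁
  ψt_init : U.ψt 0 = D.ψ₁
  φ_mem : ∀ t, 0 ≤ t → MemH10 (U.φ t) (U.φx t)
  ψ_mem : ∀ t, 0 ≤ t → MemH1Star (U.ψ t) (U.ψx t)
  ψt_mem : ∀ t, 0 ≤ t → MeanZero (U.ψt t)
  φ_cont : ContinuousOn U.φ (Ici 0)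
  φx_cont : ContinuousOn U.φx (Ici 0)
  ψ_cont : ContinuousOn U.ψ (Ici 0)
  ψx_cont : ContinuousOn U.ψx (Ici 0)
  φ_deriv : ∀ t, 0 ≤ t → HasDerivWithinAt U.φ (U.φt t) (Ici 0) t
  ψ_deriv : ∀ t, 0 ≤ t → HasDerivWithinAt U.ψ (U.ψt t) (Ici 0) t
  φt_cont : ContinuousOn U.φt (Ici 0)
  ψt_cont : ContinuousOn U.ψt (Ici 0)
  eq_φ : ∀ v vx : L2 B.L, MemH10 v vx → ∀ t, 0 < t →
    HasDerivAt (fun τ => B.ρ₁ * inner ℝ (U.φt τ) v)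
      (-(B.κ * inner ℝ (U.stress g t) vx)) t
  eq_ψ : ∀ v vx : L2 B.L, MemH1Star v vx → ∀ t, 0 < t →
    HasDerivAt (fun τ => B.ρ₂ * inner ℝ (U.ψt τ) v)
      (-(B.b * inner ℝ (U.ψx t) vx) - B.κ * inner ℝ (U.stress g t) v) t

/-- The energy `E(t)`. -/
def energy (B : Beam) (g : ℝ → ℝ) (U : Trajectory B.L) (t : ℝ) : ℝ :=
  B.ρ₁ / 2 * ‖U.φt t‖ ^ 2 + B.ρ₂ / 2 * ‖U.ψt t‖ ^ 2 + B.b / 2 * ‖U.ψx t‖ ^ 2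
    + B.κ / 2 * (1 - ∫ s in Ioi (0 : ℝ), g s) * ‖U.px t‖ ^ 2
    + B.κ / 2 * ∫ s in Ioi (0 : ℝ), g s * ‖U.px t - U.px (t - s)‖ ^ 2

/-! ### The hypotheses on the kernel

Functions on `[0, ∞)` are functions on `ℝ` of which only the values on `[0, ∞)` matter; derivatives
at `0` are one-sided. -/

/-- Assumption (A1). -/
structure AssumptionA1 (B : Beam) (g : ℝ → ℝ) : Prop where
  pos : ∀ t, 0 ≤ t → 0 < g t
  anti : AntitoneOn g (Ici 0)
  diff : DifferentiableOn ℝ g (Ici 0)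
  int : IntegrableOn g (Ioi 0)
  int_lt : 0 < 1 - ∫ s in Ioi (0 : ℝ), g s
  lt_int : max (31 / 32) (64 * B.ρ₁ * B.L ^ 2 / (64 * B.ρ₁ * B.L ^ 2 + B.ρ₂))
    < ∫ s in Ioi (0 : ℝ), g s

/-- The derivative `H'` on `[0, ∞)`. -/
def dH (H : ℝ → ℝ) (s : ℝ) : ℝ := derivWithin H (Ici 0) s

/-- The (generalized) inverse `(H')⁻¹(t) = inf {τ ≥ 0 : t ≤ H'(τ)}`; the usual inverse when `H'` is an
increasing bijection of `[0, ∞)`. -/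
def dHInv (H : ℝ → ℝ) (t : ℝ) : ℝ := sInf {τ | 0 ≤ τ ∧ t ≤ dH H τ}

/-- `H` is linear (and positive). -/
def IsLinearProfile (H : ℝ → ℝ) : Prop := ∃ a : ℝ, 0 < a ∧ ∀ s, 0 ≤ s → H s = a * s

/-- The nonlinear alternative in (A2). -/
structure IsNonlinearProfile (H : ℝ → ℝ) (r : ℝ) : Prop where
  zero : H 0 = 0
  dzero : dH H 0 = 0
  strictMono : StrictMonoOn H (Ioc 0 r)
  strictConvex : StrictConvexOn ℝ (Ioc 0 r) H
  c2 : ContDiffOn ℝ 2 H (Ioc 0 r)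
  lim : Tendsto (dH H) atTop atTop
  convex_mul : ConvexOn ℝ (Ioc 0 r) fun s => s * dH H s
  convex_mul_inv : ConvexOn ℝ (Ioc 0 r) fun s => s * dHInv H s

/-- Assumption (A2). -/
structure AssumptionA2 (g ξ H : ℝ → ℝ) (r : ℝ) : Prop where
  r_pos : 0 < r
  ξ_pos : ∀ t, 0 ≤ t → 0 < ξ t
  ξ_anti : AntitoneOn ξ (Ici 0)
  ξ_diff : DifferentiableOn ℝ ξ (Ici 0)
  H_pos : ∀ s, 0 < s → 0 < H s
  H_c1 : ContDiffOn ℝ 1 H (Ici 0)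
  shape : IsLinearProfile H ∨ IsNonlinearProfile H r
  decay : ∀ t, 0 ≤ t → derivWithin g (Ici 0) t ≤ -ξ t * H (g t)

/-- `Hbar` is an extension of `H` from `[0, r]` to `[0, ∞)` that is strictly increasing, strictly
convex and `C²` on all of `(0, ∞)`, with unbounded derivative. -/
structure IsConvexExtension (H : ℝ → ℝ) (r : ℝ) (Hbar : ℝ → ℝ) : Prop where
  eqOn : EqOn Hbar H (Icc 0 r)
  strictMono : StrictMonoOn Hbar (Ici 0)
  strictConvex : StrictConvexOn ℝ (Ici 0) Hbar
  c1 : ContDiffOn ℝ 1 Hbar (Ici 0)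
  c2 : ContDiffOn ℝ 2 Hbar (Ioi 0)
  lim : Tendsto (dH Hbar) atTop atTop

/-- The function from which the decay rate is built: `H` itself if `H` is linear, and a convex
extension of `H` from `[0, r]` otherwise. -/
def IsExtendedProfile (H : ℝ → ℝ) (r : ℝ) (Hbar : ℝ → ℝ) : Prop :=
  (IsLinearProfile H → EqOn Hbar H (Ici 0)) ∧
    (IsNonlinearProfile H r → IsConvexExtension H r Hbar)

/-! ### The functions entering the decay estimate -/

/-- `h₀(t) = ∫₀^∞ g(t + s) (1 + ‖φ₀ₓ(s) + ψ₀(s)‖²) ds`. -/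
def h₀ {L : ℝ} (g : ℝ → ℝ) (D : InitialData L) (t : ℝ) : ℝ :=
  ∫ s in Ioi (0 : ℝ), g (t + s) * (1 + ‖D.shear s‖ ^ 2)

/-- `q(t) = q₀ / (1 + ∫₀ᵗ h₀)`. -/
def q {L : ℝ} (g : ℝ → ℝ) (D : InitialData L) (q₀ t : ℝ) : ℝ :=
  q₀ / (1 + ∫ s in (0 : ℝ)..t, h₀ g D s)

/-- `G₁(t) = ∫ₜ¹ ds / (s H'(s))`. -/
def G₁ (H : ℝ → ℝ) (t : ℝ) : ℝ := ∫ s in t..1, 1 / (s * dH H s)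

/-- `G₂(t) = t H'(t)`. -/
def G₂ (H : ℝ → ℝ) (t : ℝ) : ℝ := t * dH H t

/-- `G₃(t) = t (H')⁻¹(t)`. -/
def G₃ (H : ℝ → ℝ) (t : ℝ) : ℝ := t * dHInv H t

/-- `G₄ = G₃*`, the convex conjugate of `G₃`; the supremum is over all `t ≥ 0` at which `(H')⁻¹` is
finite. -/
def G₄ (H : ℝ → ℝ) (s : ℝ) : ℝ :=
  sSup ((fun t => s * t - G₃ H t) '' {t | 0 ≤ t ∧ ∃ τ, 0 ≤ τ ∧ t ≤ dH H τ})

/-- `G₅(t) = G₁⁻¹(c₁ ∫₀ᵗ ξ)`, with `G₁ : (0, 1] → [0, ∞)`. -/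
def G₅ (H ξ : ℝ → ℝ) (c₁ t : ℝ) : ℝ :=
  Function.invFunOn (G₁ H) (Ioc 0 1) (c₁ * ∫ s in (0 : ℝ)..t, ξ s)

/-- The class `S` of admissible functions `χ`, for given constants `q₀, c₁, c₂, c, d`. -/
structure ClassS {L : ℝ} (g ξ H : ℝ → ℝ) (D : InitialData L) (q₀ c₁ c₂ c d : ℝ) (χ : ℝ → ℝ) :
    Prop where
  c1 : ContDiffOn ℝ 1 χ (Ici 0)
  pos : ∀ t, 0 ≤ t → 0 < χ t
  le_one : ∀ t, 0 ≤ t → χ t ≤ 1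
  deriv_nonpos : ∀ t, 0 ≤ t → derivWithin χ (Ici 0) t ≤ 0
  dif : ∀ t, 0 ≤ t →
    c₂ * G₄ H (c / d * (q g D q₀ t * h₀ g D t))
      ≤ c₁ * (G₂ H (G₅ H ξ c₁ t / χ t) - G₂ H (G₅ H ξ c₁ t) / χ t)

end Timoshenko

end

open Timoshenko

set_option linter.unusedSectionVars false

noncomputable section

/-! Write P = φ_x + ψ, let J f = ∫₀ˣ f, and let V be the mean-zero functions. Then H¹₀ is J(V), and
u ∈ V has weak derivative w exactly when ⟨u, f⟩ = -⟨w, J f⟩ for all f ∈ V. The beam becomes a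
problem in a Hilbert space X for P, φ_t, ψ, ψ_x, ψ_t (`AbstractSolution`).

Energy. Formally E' = (κ/2) ∫ g'(s) ‖P(t) - P(t-s)‖² ds. Four multipliers bound minus the elastic
and kinetic energy up to ‖g₀ P - g∗P‖², with g₀ = ∫ g, and ‖(g∗P)'‖², which the dissipation pays
for. Equal wave speeds serve only in the shear multiplier, where they cancel ⟨ψ_x, φ_tt⟩. A weak
solution has neither φ_tt nor P_t in X, so these computations are made for forward Steklov averages
and pass to the limit in integrated form. P_t is never estimated: it occurs as J P_t = φ_t + J ψ_t,
and difference quotients of g∗P are moved onto g. The kernel k = c ξ H̄(g), dominated by -g',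
measures the dissipation.

Lyapunov functional (`AbstractSolution.exists_lyapunov`). With D(t) = ∫₀ᵗ g(s) ‖P(t) - P(t-s)‖² ds
there is Λ equivalent to E with Λ' ≤ -mE + K(D + h₀) in integrated form, and ∫₀ᵗ E ≤ K(1 + ∫₀ᵗ h₀).
The second bound makes q(t) ∫₀ᵗ ‖P(t) - P(t-s)‖² ds ≤ 1 once q₀ is small.

Convexity. The tangent inequality g(s) H̄'(x) ≤ H̄(g(s)) + x H̄'(x), integrated against ξ(s) ‖P(t) -
P(t-s)‖² with the monotonicity of ξ, bounds ξ H̄'(x) q D by a multiple of q times the dissipation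
plus ξ x H̄'(x) (`HasSqMemory.headDeviation_control`). It takes the place of Jensen's inequality.

Comparison (`DecayEstimates.exists_decay`). Take x = ε q E and the functional ξ H̄'(εqE) q Λ + γ q
E. Its coefficients are non-increasing, so forward slopes may be computed with frozen coefficients
and H̄'' never occurs. Young's inequality for G₃ and its conjugate G₄ bounds the slope by μ ξ (G₄(c
q h₀) - G₂(εqE)). On the other side G₅' = -c₁ ξ G₂(G₅), and the inequality defining S is what
prevents χ times a small multiple of the functional from crossing G₅. -/

namespace Timoshenko

/-! ### Primitives and Sobolev spaces on the interval -/

/-- Lebesgue measure on `(0, L)`. -/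
abbrev beamMeasure (L : ℝ) : Measure ℝ := (volume : Measure ℝ).restrict (Ioo 0 L)

instance (L : ℝ) : IsFiniteMeasure (beamMeasure L) := ⟨by simp [beamMeasure]⟩

theorem L2.integrable {L : ℝ} (f : L2 L) : Integrable f (beamMeasure L) :=
  (Lp.memLp f).integrable one_le_two

/-- The primitive `x ↦ ∫₀ˣ f`. -/
def primFun {L : ℝ} (f : L2 L) (x : ℝ) : ℝ := ∫ y in (0 : ℝ)..x, f y ∂(beamMeasure L)

theorem continuous_primFun {L : ℝ} (f : L2 L) : Continuous (primFun f) :=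
  intervalIntegral.continuous_primitive (fun _ _ => f.integrable.intervalIntegrable) 0

theorem primFun_of_nonneg {L : ℝ} (f : L2 L) {x : ℝ} (hx : 0 ≤ x) :
    primFun f x = ∫ y in Ioc 0 x, f y ∂(beamMeasure L) :=
  intervalIntegral.integral_of_le hx

theorem abs_primFun_le {L : ℝ} (f : L2 L) {x : ℝ} (hx : 0 ≤ x) :
    |primFun f x| ≤ (beamMeasure L).real univ ^ (1 / 2 : ℝ) * ‖f‖ := by
  rw [primFun_of_nonneg f hx, ← L2.inner_indicatorConstLp_one (𝕜 := ℝ) measurableSet_Ioc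
    (measure_ne_top _ _) f]
  refine (abs_real_inner_le_norm _ _).trans ?_
  gcongr
  refine norm_indicatorConstLp_le.trans ?_
  simp only [norm_one, one_mul, ENNReal.toReal_ofNat]
  gcongr
  · exact measure_ne_top _ _
  · exact subset_univ _

theorem memLp_primFun {L : ℝ} (f : L2 L) : MemLp (primFun f) 2 (beamMeasure L) := by
  refine MemLp.of_bound (continuous_primFun f).aestronglyMeasurable
    ((beamMeasure L).real univ ^ (1 / 2 : ℝ) * ‖f‖) ?_
  filter_upwards [ae_restrict_mem measurableSet_Ioo] with x hx
  exact abs_primFun_le f hx.1.le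

/-- The operator `f ↦ ∫₀ˣ f` on `L²(0, L)`. -/
def primitive (L : ℝ) : L2 L →L[ℝ] L2 L :=
  LinearMap.mkContinuous
    { toFun := fun f => (memLp_primFun f).toLp _
      map_add' := fun f h => by
        rw [← MemLp.toLp_add]
        refine MemLp.toLp_congr _ _ (Eventually.of_forall fun x => ?_)
        simp only [primFun, Pi.add_apply]
        rw [← intervalIntegral.integral_add f.integrable.intervalIntegrable
          h.integrable.intervalIntegrable]
        refine intervalIntegral.integral_congr_ae ?_
        filter_upwards [Lp.coeFn_add f h] with y hy _
        exact hy
      map_smul' := fun c f => by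
        rw [RingHom.id_apply, ← MemLp.toLp_const_smul]
        refine MemLp.toLp_congr _ _ (Eventually.of_forall fun x => ?_)
        simp only [primFun, Pi.smul_apply, smul_eq_mul]
        rw [← intervalIntegral.integral_const_mul]
        refine intervalIntegral.integral_congr_ae ?_
        filter_upwards [Lp.coeFn_smul c f] with y hy _
        rw [hy, Pi.smul_apply, smul_eq_mul] }
    (measureUnivNNReal (beamMeasure L) ^ (ENNReal.toReal 2)⁻¹ *
      (beamMeasure L).real univ ^ (1 / 2 : ℝ))
    fun f => by
      rw [mul_assoc]
      refine Lp.norm_le_of_ae_bound (by positivity) ?_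
      filter_upwards [MemLp.coeFn_toLp (memLp_primFun f), ae_restrict_mem measurableSet_Ioo]
        with x hx hxL
      simp only [LinearMap.coe_mk, AddHom.coe_mk]
      rw [hx]
      exact abs_primFun_le f hxL.1.le

theorem primitive_ae {L : ℝ} (f : L2 L) : primitive L f =ᵐ[beamMeasure L] primFun f :=
  MemLp.coeFn_toLp (memLp_primFun f)

theorem L2.inner_eq {L : ℝ} (f h : L2 L) : inner ℝ f h = ∫ x in Ioo 0 L, f x * h x := by
  rw [L2.inner_def]
  exact integral_congr_ae (Eventually.of_forall fun x => by simp [mul_comm])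

/-- Integration by parts for primitives. -/
theorem inner_primitive_add {L : ℝ} (f h : L2 L) :
    inner ℝ (primitive L f) h + inner ℝ f (primitive L h)
      = (∫ x in Ioo 0 L, f x) * ∫ x in Ioo 0 L, h x := by
  -- Each pairing is the integral of a product over the triangle y ≤ x. After Fubini the second one
  -- lives on the opposite triangle, and the two fill the square up to the diagonal, which is null.
  have key : ∀ f h : L2 L, inner ℝ (primitive L f) h
      = ∫ x, ∫ y, ({p : ℝ × ℝ | p.2 ≤ p.1}.indicator (fun p => h p.1 * f p.2)) (x, y)
        ∂(beamMeasure L) ∂(beamMeasure L) := by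
    intro f h
    rw [L2.inner_eq]
    refine integral_congr_ae ?_
    filter_upwards [primitive_ae f, ae_restrict_mem measurableSet_Ioo] with x hx hxL
    rw [hx, primFun_of_nonneg f hxL.1.le, mul_comm, ← integral_const_mul,
      ← integral_indicator measurableSet_Ioc]
    refine integral_congr_ae ?_
    filter_upwards [ae_restrict_mem measurableSet_Ioo] with y hy
    by_cases hyx : y ≤ x
    · simp [indicator, hyx, hy.1]
    · simp [indicator, hyx]
  have hint : Integrable (fun p : ℝ × ℝ => h p.1 * f p.2)
      ((beamMeasure L).prod (beamMeasure L)) := h.integrable.mul_prod f.integrable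
  have hs : MeasurableSet {p : ℝ × ℝ | p.2 ≤ p.1} := measurableSet_le measurable_snd measurable_fst
  have hs' : MeasurableSet {p : ℝ × ℝ | p.1 ≤ p.2} := measurableSet_le measurable_fst measurable_snd
  rw [real_inner_comm (primitive L h) f, key f h, key h f, integral_integral_swap (f := fun x y =>
    ({p : ℝ × ℝ | p.2 ≤ p.1}.indicator (fun p => f p.1 * h p.2)) (x, y))]
  swap
  · exact (f.integrable.mul_prod h.integrable).indicator hs
  have e1 : (fun y => ∫ x, ({p : ℝ × ℝ | p.2 ≤ p.1}.indicator (fun p => f p.1 * h p.2)) (x, y)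
      ∂(beamMeasure L)) = fun x => ∫ y, ({p : ℝ × ℝ | p.1 ≤ p.2}.indicator
        (fun p => h p.1 * f p.2)) (x, y) ∂(beamMeasure L) := by
    ext y
    refine integral_congr_ae (Eventually.of_forall fun x => ?_)
    simp only [indicator, mem_ofPred_eq, mul_comm]
  rw [e1, ← integral_add (hint.indicator hs).integral_prod_left
    (hint.indicator hs').integral_prod_left]
  have e2 : (∫ x in Ioo 0 L, f x) * ∫ x in Ioo 0 L, h x
      = ∫ x, ∫ y, h x * f y ∂(beamMeasure L) ∂(beamMeasure L) := by
    simp_rw [integral_const_mul, integral_mul_const]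
    rw [mul_comm]
  rw [e2]
  refine integral_congr_ae ?_
  filter_upwards [(hint.indicator hs).prod_right_ae, (hint.indicator hs').prod_right_ae]
    with x h1 h2
  rw [← integral_add h1 h2]
  refine integral_congr_ae ?_
  have hx : ∀ᵐ y ∂(beamMeasure L), y ≠ x := by
    rw [ae_iff]; simp
  filter_upwards [hx] with y hy
  rcases lt_or_gt_of_ne hy with hlt | hlt
  · simp [indicator, hlt.le, not_le.2 hlt]
  · simp [indicator, hlt.le, not_le.2 hlt]

/-- A test function on `(0, L)` is the primitive of its derivative. -/
theorem exists_primitive_eq_test {L : ℝ} {η : ℝ → ℝ} (h1 : ContDiff ℝ ∞ η)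
    (h2 : HasCompactSupport η) (h3 : tsupport η ⊆ Ioo 0 L) :
    ∃ e : L2 L, MeanZero e ∧ e =ᵐ[beamMeasure L] deriv η ∧
      primitive L e =ᵐ[beamMeasure L] η := by
  have hcd : Continuous (deriv η) := h1.continuous_deriv (by simp)
  have hm : MemLp (deriv η) 2 (beamMeasure L) :=
    (hcd.memLp_of_hasCompactSupport h2.deriv (μ := volume)).restrict _
  have h0 : η 0 = 0 := by
    by_contra h
    exact lt_irrefl _ (h3 (subset_tsupport _ h)).1
  have hL : η L = 0 := by
    by_contra h
    exact lt_irrefl _ (h3 (subset_tsupport _ h)).2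
  have hint : ∀ x ∈ Icc 0 L, ∫ y in (0 : ℝ)..x, deriv η y = η x := by
    intro x _
    rw [intervalIntegral.integral_deriv_eq_sub (fun y _ => (h1.differentiable (by simp)) y)
      (hcd.intervalIntegrable _ _), h0, sub_zero]
  refine ⟨hm.toLp _, ?_, hm.coeFn_toLp, ?_⟩
  · unfold MeanZero
    rw [integral_congr_ae hm.coeFn_toLp]
    change ∫ x in Ioo 0 L, deriv η x = 0
    rcases le_or_gt L 0 with hL0 | hL0
    · rw [Ioo_eq_empty (not_lt.2 hL0)]; simp
    · rw [← integral_Ioc_eq_integral_Ioo, ← intervalIntegral.integral_of_le hL0.le,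
        hint L ⟨hL0.le, le_rfl⟩, hL]
  · filter_upwards [primitive_ae (hm.toLp _), ae_restrict_mem measurableSet_Ioo] with x hx hxL
    have hsub : Ioc 0 x ⊆ Ioo 0 L := fun y hy => ⟨hy.1, hy.2.trans_lt hxL.2⟩
    rw [hx, primFun_of_nonneg _ hxL.1.le, ← hint x ⟨hxL.1.le, hxL.2.le⟩,
      intervalIntegral.integral_of_le hxL.1.le, Measure.restrict_restrict measurableSet_Ioc,
      inter_eq_left.2 hsub]
    have : hm.toLp (deriv η) =ᵐ[volume.restrict (Ioc 0 x)] deriv η :=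
      ae_mono (Measure.restrict_mono_set _ hsub) hm.coeFn_toLp
    exact integral_congr_ae this

theorem hasWeakDeriv_iff_test {L : ℝ} {u v : L2 L} {η : ℝ → ℝ} {e : L2 L}
    (he : e =ᵐ[beamMeasure L] deriv η) (he' : primitive L e =ᵐ[beamMeasure L] η) :
    (∫ x in Ioo 0 L, u x * deriv η x = - ∫ x in Ioo 0 L, v x * η x) ↔
      inner ℝ u e = - inner ℝ v (primitive L e) := by
  rw [L2.inner_eq, L2.inner_eq]
  have a1 : ∫ x in Ioo 0 L, u x * e x = ∫ x in Ioo 0 L, u x * deriv η x :=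
    integral_congr_ae (by filter_upwards [he] with x hx; rw [hx])
  have a2 : ∫ x in Ioo 0 L, v x * primitive L e x = ∫ x in Ioo 0 L, v x * η x :=
    integral_congr_ae (by filter_upwards [he'] with x hx; rw [hx])
  rw [a1, a2]

/-- Every test function is the primitive of its own derivative, which has zero mean, so primitives
of mean-zero functions form a large enough class of tests. -/
theorem hasWeakDeriv_of_inner {L : ℝ} {u v : L2 L}
    (h : ∀ f : L2 L, MeanZero f → inner ℝ u f = - inner ℝ v (primitive L f)) :
    HasWeakDeriv u v := by
  intro η h1 h2 h3
  obtain ⟨e, he0, he, he'⟩ := exists_primitive_eq_test h1 h2 h3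
  exact (hasWeakDeriv_iff_test he he').2 (h e he0)

theorem inner_primitive_left {L : ℝ} (f : L2 L) {h : L2 L} (hh : MeanZero h) :
    inner ℝ (primitive L f) h = - inner ℝ f (primitive L h) := by
  have := inner_primitive_add f h
  rw [hh, mul_zero] at this
  linarith

theorem hasWeakDeriv_primitive {L : ℝ} (f : L2 L) : HasWeakDeriv (primitive L f) f :=
  hasWeakDeriv_of_inner fun _ hh => inner_primitive_left f hh

theorem memH10_primitive {L : ℝ} {f : L2 L} (hL : 0 ≤ L) (hf : MeanZero f) :
    MemH10 (primitive L f) f := by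
  refine ⟨hasWeakDeriv_primitive f, primFun f, (continuous_primFun f).continuousOn, ?_, ?_,
    primitive_ae f⟩
  · simp [primFun]
  · rw [primFun_of_nonneg f hL, Measure.restrict_restrict measurableSet_Ioc,
      inter_eq_right.2 Ioo_subset_Ioc_self]
    exact hf

/-- du Bois-Reymond: a function with zero weak derivative is constant. -/
theorem ae_const_of_hasWeakDeriv_zero {L : ℝ} (hL : 0 < L) {w : L2 L} (hw : HasWeakDeriv w 0) :
    ∃ c : ℝ, ∀ᵐ x ∂(beamMeasure L), w x = c := by
  have hzero : ∀ η : ℝ → ℝ, ∫ x in Ioo 0 L, (0 : L2 L) x * η x = 0 := by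
    intro η
    rw [integral_congr_ae (g := fun _ => (0 : ℝ))]
    · simp
    · filter_upwards [Lp.coeFn_zero ℝ 2 (beamMeasure L)] with x hx
      rw [hx, Pi.zero_apply, zero_mul]
  -- A fixed bump of unit mass in the middle of the interval. Subtracting (∫ η) η₀ from a test
  -- function η leaves zero mean, so the primitive is again a test function.
  let β : ContDiffBump (L / 2) := ⟨L / 8, L / 4, by positivity, by linarith⟩
  set η₀ : ℝ → ℝ := β.normed volume with hη₀
  have hη₀s : ContDiff ℝ ∞ η₀ := β.contDiff_normed
  have hη₀c : HasCompactSupport η₀ := β.hasCompactSupport_normed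
  have hη₀t : tsupport η₀ ⊆ Icc (L / 4) (3 * L / 4) := by
    rw [hη₀, β.tsupport_normed_eq, Real.closedBall_eq_Icc]
    refine Icc_subset_Icc ?_ ?_ <;> simp only [β] <;> linarith
  have hη₀i : ∫ x, η₀ x = 1 := β.integral_normed
  set c := ∫ x in Ioo 0 L, w x * η₀ x with hc
  refine ⟨c, ?_⟩
  have hloc : LocallyIntegrableOn (fun x => w x - c) (Ioo 0 L) volume := by
    have : IntegrableOn (fun x => w x - c) (Ioo 0 L) volume :=
      Integrable.sub w.integrable (integrable_const c)
    exact this.locallyIntegrableOn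
  have main := isOpen_Ioo.ae_eq_zero_of_integral_contDiff_smul_eq_zero hloc (fun η h1 h2 h3 => ?_)
  · refine (ae_restrict_iff' measurableSet_Ioo).2 ?_
    filter_upwards [main] with x hx hxL
    linarith [hx hxL]
  have hres : ∀ u : ℝ → ℝ, (∫ x, η x • u x) = ∫ x in Ioo 0 L, η x * u x := by
    intro u
    rw [setIntegral_eq_integral_of_forall_compl_eq_zero]
    · rfl
    · intro x hx
      rw [image_eq_zero_of_notMem_tsupport (fun h => hx (h3 h)), zero_mul]
  rw [hres]
  set a := ∫ x, η x with ha
  set ζ : ℝ → ℝ := fun x => η x - a * η₀ x with hζ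
  have hζs : ContDiff ℝ ∞ ζ := h1.sub (contDiff_const.mul hη₀s)
  have hηint : Integrable η volume := h1.continuous.integrable_of_hasCompactSupport h2
  have hη₀int : Integrable η₀ volume := hη₀s.continuous.integrable_of_hasCompactSupport hη₀c
  have hζi : ∫ x, ζ x = 0 := by
    rw [hζ, integral_sub hηint (hη₀int.const_mul a), integral_const_mul, hη₀i, mul_one, sub_self]
  have hζint : Integrable ζ volume := hηint.sub (hη₀int.const_mul a)
  -- One interval [p, r] inside (0, L) carries ζ. As ζ has zero integral, its primitive from p
  -- vanishes beyond r as well as before p.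
  obtain ⟨p, r, hp, hr, hpr, hsub⟩ : ∃ p r, 0 < p ∧ r < L ∧ p ≤ r ∧
      ∀ x, x ∉ Icc p r → ζ x = 0 := by
    have hK : IsCompact (tsupport η ∪ Icc (L / 4) (3 * L / 4)) := h2.isCompact.union isCompact_Icc
    have hne : (tsupport η ∪ Icc (L / 4) (3 * L / 4)).Nonempty :=
      ⟨L / 2, Or.inr ⟨by linarith, by linarith⟩⟩
    have hsubK : tsupport η ∪ Icc (L / 4) (3 * L / 4) ⊆ Ioo 0 L :=
      union_subset h3 (fun x hx => ⟨by linarith [hx.1], by linarith [hx.2]⟩)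
    refine ⟨sInf _, sSup _, (hsubK (hK.sInf_mem hne)).1, (hsubK (hK.sSup_mem hne)).2,
      csInf_le hK.bddBelow (hK.sSup_mem hne), fun x hx => ?_⟩
    have hxK : x ∉ tsupport η ∪ Icc (L / 4) (3 * L / 4) :=
      fun h => hx ⟨csInf_le hK.bddBelow h, le_csSup hK.bddAbove h⟩
    rw [mem_union, not_or] at hxK
    simp only [hζ]
    rw [image_eq_zero_of_notMem_tsupport hxK.1,
      image_eq_zero_of_notMem_tsupport (fun h => hxK.2 (hη₀t h))]
    simp
  set θ : ℝ → ℝ := fun x => ∫ y in p..x, ζ y with hθ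
  have hθd : ∀ x, HasDerivAt θ (ζ x) x := fun x =>
    intervalIntegral.integral_hasDerivAt_right (hζs.continuous.intervalIntegrable _ _)
      (hζs.continuous.stronglyMeasurableAtFilter _ _) hζs.continuous.continuousAt
  have hθderiv : deriv θ = ζ := funext fun x => (hθd x).deriv
  have hθs : ContDiff ℝ ∞ θ := by
    rw [contDiff_infty_iff_deriv, hθderiv]
    exact ⟨fun x => (hθd x).differentiableAt, hζs⟩
  have hθ0 : ∀ x, x ∉ Icc p r → θ x = 0 := by
    intro x hx
    rcases lt_or_ge x p with hxp | hxp
    · simp only [hθ]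
      rw [intervalIntegral.integral_symm, intervalIntegral.integral_of_le hxp.le,
        integral_Ioc_eq_integral_Ioo, setIntegral_congr_fun (g := fun _ => 0) measurableSet_Ioo]
      · simp
      · intro y hy
        exact hsub y (fun h => absurd h.1 (not_le.2 hy.2))
    · have hxr : r < x := by
        by_contra h
        exact hx ⟨hxp, not_lt.1 h⟩
      simp only [hθ]
      rw [intervalIntegral.integral_of_le hxp, ← integral_Icc_eq_integral_Ioc, ← hζi]
      refine setIntegral_eq_integral_of_forall_compl_eq_zero (fun y hy => hsub y (fun h => hy ?_))
      exact ⟨h.1, h.2.trans hxr.le⟩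
  have hθt : tsupport θ ⊆ Icc p r := by
    refine closure_minimal (fun x hx => ?_) isClosed_Icc
    by_contra h
    exact hx (hθ0 x h)
  have hθc : HasCompactSupport θ := isCompact_Icc.of_isClosed_subset (isClosed_tsupport _) hθt
  have htest := hw θ hθs hθc
    (hθt.trans (fun x hx => ⟨hp.trans_le hx.1, hx.2.trans_lt hr⟩))
  rw [hzero, neg_zero, hθderiv] at htest
  have hwη : ∀ u : ℝ → ℝ, ContDiff ℝ ∞ u → HasCompactSupport u →
      Integrable (fun x => w x * u x) (beamMeasure L) := by
    intro u hu huc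
    obtain ⟨B, hB⟩ := hu.continuous.bounded_above_of_compact_support huc
    exact w.integrable.mul_bdd (c := B) hu.continuous.aestronglyMeasurable
      (Eventually.of_forall hB)
  have e1 : ∫ x in Ioo 0 L, w x * ζ x = (∫ x in Ioo 0 L, w x * η x) - a * c := by
    rw [hc, ← integral_const_mul, ← integral_sub (hwη η h1 h2) ((hwη η₀ hη₀s hη₀c).const_mul a)]
    refine integral_congr_ae (Eventually.of_forall fun x => ?_)
    simp only [hζ]; ring
  have e2 : ∫ x in Ioo 0 L, η x = a := by
    rw [ha]
    refine setIntegral_eq_integral_of_forall_compl_eq_zero (fun x hx => ?_)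
    exact image_eq_zero_of_notMem_tsupport (fun h => hx (h3 h))
  have e3 : ∫ x in Ioo 0 L, η x * (w x - c) = (∫ x in Ioo 0 L, w x * η x) - a * c := by
    rw [← e2, ← integral_mul_const, ← integral_sub (hwη η h1 h2)
      (hηint.restrict.mul_const c)]
    refine integral_congr_ae (Eventually.of_forall fun x => ?_)
    ring
  rw [e3, ← e1, htest]

theorem HasWeakDeriv.sub {L : ℝ} {u v u' v' : L2 L} (h : HasWeakDeriv u v)
    (h' : HasWeakDeriv u' v') : HasWeakDeriv (u - u') (v - v') := by
  intro η h1 h2 h3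
  obtain ⟨e, he0, he, he'⟩ := exists_primitive_eq_test h1 h2 h3
  rw [hasWeakDeriv_iff_test he he', inner_sub_left, inner_sub_left,
    (hasWeakDeriv_iff_test he he').1 (h η h1 h2 h3),
    (hasWeakDeriv_iff_test he he').1 (h' η h1 h2 h3)]
  ring

/-- The difference of u and the primitive of v has zero weak derivative, so du Bois-Reymond applies.
-/
theorem HasWeakDeriv.ae_eq_add_const {L : ℝ} (hL : 0 < L) {u v : L2 L} (h : HasWeakDeriv u v) :
    ∃ c : ℝ, ∀ᵐ x ∂(beamMeasure L), u x = primFun v x + c := by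
  have hd := h.sub (hasWeakDeriv_primitive v)
  rw [sub_self] at hd
  obtain ⟨c, hc⟩ := ae_const_of_hasWeakDeriv_zero hL hd
  refine ⟨c, ?_⟩
  filter_upwards [hc, Lp.coeFn_sub u (primitive L v), primitive_ae v] with x h1 h2 h3
  rw [h2, Pi.sub_apply, h3] at h1
  linarith

/-- Converse of `hasWeakDeriv_of_inner`: the constant by which u differs from the primitive of v is
invisible to mean-zero f. Together they express H¹_* through the primitive operator alone. -/
theorem HasWeakDeriv.inner_eq {L : ℝ} (hL : 0 < L) {u v : L2 L} (h : HasWeakDeriv u v)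
    {f : L2 L} (hf : MeanZero f) : inner ℝ u f = - inner ℝ v (primitive L f) := by
  obtain ⟨c, hc⟩ := h.ae_eq_add_const hL
  rw [← inner_primitive_left v hf, L2.inner_eq, L2.inner_eq]
  have hi : Integrable (fun x => primitive L v x * f x) (beamMeasure L) := by
    have := L2.integrable_inner (𝕜 := ℝ) f (primitive L v)
    simpa using this
  have e : ∫ x in Ioo 0 L, u x * f x
      = ∫ x in Ioo 0 L, (primitive L v x * f x + c * f x) := by
    refine integral_congr_ae ?_
    filter_upwards [hc, primitive_ae v] with x h1 h2
    rw [h1, h2]; ring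
  rw [e, integral_add hi (f.integrable.const_mul c), integral_const_mul, hf, mul_zero, add_zero]

/-- The boundary value at 0 kills the integration constant; the one at L says that v has zero mean.
With `memH10_primitive` this identifies H¹₀ with the primitives of L²_*. -/
theorem MemH10.spec {L : ℝ} (hL : 0 < L) {u v : L2 L} (h : MemH10 u v) :
    MeanZero v ∧ u = primitive L v := by
  obtain ⟨hd, w, hwc, hw0, hwL, hw⟩ := h
  obtain ⟨c, hc⟩ := hd.ae_eq_add_const hL
  -- Almost everywhere equality of continuous functions is equality on the open interval, hence on
  -- its closure; the endpoints are what is needed.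
  have heq : EqOn w (fun x => primFun v x + c) (Icc 0 L) := by
    have hae : w =ᵐ[volume.restrict (Ioo 0 L)] fun x => primFun v x + c := by
      filter_upwards [hw, hc] with x h1 h2
      rw [← h1, h2]
    have h1 : EqOn w (fun x => primFun v x + c) (Ioo 0 L) :=
      Measure.eqOn_open_of_ae_eq hae isOpen_Ioo (hwc.mono Ioo_subset_Icc_self)
        ((continuous_primFun v).add continuous_const).continuousOn
    have h2 := h1.of_subset_closure hwc
      ((continuous_primFun v).add continuous_const).continuousOn Ioo_subset_Icc_self
      (by rw [closure_Ioo hL.ne])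
    exact h2
  have h0 := heq ⟨le_rfl, hL.le⟩
  have hLL := heq ⟨hL.le, le_rfl⟩
  simp only [hw0, hwL] at h0 hLL
  have hc0 : c = 0 := by
    have : primFun v 0 = 0 := by simp [primFun]
    linarith
  constructor
  · rw [hc0, add_zero, primFun_of_nonneg v hL.le, Measure.restrict_restrict measurableSet_Ioc,
      inter_eq_right.2 Ioo_subset_Ioc_self] at hLL
    exact hLL.symm
  · refine Lp.ext ?_
    filter_upwards [hc, primitive_ae v] with x h1 h2
    rw [h1, h2, hc0, add_zero]

/-- The space `L²_*(0, L)`. -/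
def meanZeroSubmodule (L : ℝ) : Submodule ℝ (L2 L) where
  carrier := {f | MeanZero f}
  zero_mem' := by
    change ∫ x in Ioo 0 L, (0 : L2 L) x = 0
    rw [integral_congr_ae (Lp.coeFn_zero ℝ 2 (beamMeasure L))]
    simp
  add_mem' := fun {f h} hf hh => by
    change ∫ x in Ioo 0 L, (f + h : L2 L) x = 0
    rw [integral_congr_ae (Lp.coeFn_add f h)]
    change ∫ x in Ioo 0 L, (f x + h x) = 0
    rw [integral_add f.integrable h.integrable, hf, hh, add_zero]
  smul_mem' := fun c f hf => by
    change ∫ x in Ioo 0 L, (c • f : L2 L) x = 0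
    rw [integral_congr_ae (Lp.coeFn_smul c f)]
    change ∫ x in Ioo 0 L, c * f x = 0
    rw [integral_const_mul, hf, mul_zero]

theorem mem_meanZeroSubmodule {L : ℝ} {f : L2 L} : f ∈ meanZeroSubmodule L ↔ MeanZero f := Iff.rfl

theorem isClosed_meanZeroSubmodule (L : ℝ) : IsClosed (meanZeroSubmodule L : Set (L2 L)) := by
  have : (meanZeroSubmodule L : Set (L2 L)) = {f | inner ℝ
      (indicatorConstLp 2 (MeasurableSet.univ) (measure_ne_top (beamMeasure L) _) (1 : ℝ)) f
        = 0} := by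
    ext f
    simp only [SetLike.mem_coe, mem_meanZeroSubmodule, mem_ofPred_eq,
      L2.inner_indicatorConstLp_one (𝕜 := ℝ), Measure.restrict_univ, MeanZero]
  rw [this]
  exact isClosed_eq (by fun_prop) continuous_const

/-! ### Convolution with a memory kernel -/

/-- A positive, non-increasing, continuous and integrable kernel on `[0, ∞)`. -/
structure IsKernel (g : ℝ → ℝ) : Prop where
  pos : ∀ t, 0 ≤ t → 0 < g t
  anti : AntitoneOn g (Ici 0)
  cont : ContinuousOn g (Ici 0)
  int : IntegrableOn g (Ioi 0)

/-- `k` is continuous on `[0, ∞)` and bounded by a multiple of `g`. -/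
structure SubKernel (g k : ℝ → ℝ) (C : ℝ) : Prop where
  cont : ContinuousOn k (Ici 0)
  bound : ∀ s, 0 ≤ s → |k s| ≤ C * g s

/-- `f` is continuous on `[0, ∞)`, and its history is integrable against `g`. -/
structure HasMemory {X : Type*} [NormedAddCommGroup X] (g : ℝ → ℝ) (f : ℝ → X) : Prop where
  cont : ContinuousOn f (Ici 0)
  meas : AEStronglyMeasurable (fun s => f (-s)) (volume.restrict (Ioi 0))
  int : IntegrableOn (fun s => g s * ‖f (-s)‖) (Ioi 0)

/-- `∫₀^∞ k(s) f(t - s) ds`. -/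
def memory {X : Type*} [NormedAddCommGroup X] [NormedSpace ℝ X] (k : ℝ → ℝ) (f : ℝ → X) (t : ℝ) :
    X := ∫ s in Ioi (0 : ℝ), k s • f (t - s)

theorem IsKernel.subKernel {g : ℝ → ℝ} (hg : IsKernel g) : SubKernel g g 1 :=
  ⟨hg.cont, fun s hs => by rw [abs_of_pos (hg.pos s hs), one_mul]⟩

theorem IsKernel.le_zero {g : ℝ → ℝ} (hg : IsKernel g) {s : ℝ} (hs : 0 ≤ s) : g s ≤ g 0 :=
  hg.anti (mem_Ici.2 le_rfl) (mem_Ici.2 hs) hs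

theorem SubKernel.const_nonneg {g k : ℝ → ℝ} {C : ℝ} (hg : IsKernel g) (hk : SubKernel g k C) :
    0 ≤ C := by
  have h1 := hk.bound 0 le_rfl
  have h2 := hg.pos 0 le_rfl
  by_contra h
  have := mul_neg_of_neg_of_pos (not_le.1 h) h2
  linarith [abs_nonneg (k 0)]

theorem SubKernel.shift {g k : ℝ → ℝ} {C h : ℝ} (hg : IsKernel g) (hk : SubKernel g k C)
    (hh : 0 ≤ h) : SubKernel g (fun s => k (s + h)) C := by
  refine ⟨hk.cont.comp (by fun_prop) (fun s hs => add_nonneg hs hh), fun s hs => ?_⟩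
  refine (hk.bound _ (add_nonneg hs hh)).trans ?_
  exact mul_le_mul_of_nonneg_left (hg.anti hs (mem_Ici.2 (add_nonneg hs hh)) (by linarith))
    (hk.const_nonneg hg)

theorem SubKernel.sub {g k k' : ℝ → ℝ} {C C' : ℝ} (hk : SubKernel g k C) (hk' : SubKernel g k' C') :
    SubKernel g (fun s => k s - k' s) (C + C') := by
  refine ⟨hk.cont.sub hk'.cont, fun s hs => ?_⟩
  refine (abs_sub _ _).trans ?_
  rw [add_mul]
  exact add_le_add (hk.bound s hs) (hk'.bound s hs)

theorem SubKernel.const_mul {g k : ℝ → ℝ} {C : ℝ} (hk : SubKernel g k C) (a : ℝ) :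
    SubKernel g (fun s => a * k s) (|a| * C) := by
  refine ⟨continuousOn_const.mul hk.cont, fun s hs => ?_⟩
  rw [abs_mul, mul_assoc]
  exact mul_le_mul_of_nonneg_left (hk.bound s hs) (abs_nonneg a)

theorem SubKernel.integrableOn {g k : ℝ → ℝ} {C : ℝ} (hg : IsKernel g) (hk : SubKernel g k C) :
    IntegrableOn k (Ioi 0) := by
  refine Integrable.mono' (hg.int.const_mul C)
    ((hk.cont.mono Ioi_subset_Ici_self).aestronglyMeasurable measurableSet_Ioi) ?_
  filter_upwards [ae_restrict_mem measurableSet_Ioi] with s hs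
  exact hk.bound s (le_of_lt hs)

theorem integrableOn_Ioi_add_iff {X : Type*} [NormedAddCommGroup X] {F : ℝ → X} {h : ℝ} :
    IntegrableOn (fun s => F (s + h)) (Ioi 0) ↔ IntegrableOn F (Ioi h) := by
  have := (measurePreserving_add_right (volume : Measure ℝ) h).integrableOn_comp_preimage
    (measurableEmbedding_addRight h) (f := F) (s := Ioi h)
  simpa [Function.comp_def] using this

theorem setIntegral_Ioi_add {X : Type*} [NormedAddCommGroup X] [NormedSpace ℝ X] (F : ℝ → X)
    (h : ℝ) : ∫ s in Ioi (0 : ℝ), F (s + h) = ∫ s in Ioi h, F s := by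
  have := (measurePreserving_add_right (volume : Measure ℝ) h).setIntegral_preimage_emb
    (measurableEmbedding_addRight h) F (Ioi h)
  simpa using this

theorem setIntegral_Ioi_shift {X : Type*} [NormedAddCommGroup X] [NormedSpace ℝ X] {F : ℝ → X}
    (hF : IntegrableOn F (Ioi 0)) {h : ℝ} (hh : 0 ≤ h) :
    ∫ s in Ioi (0 : ℝ), F s = (∫ s in (0 : ℝ)..h, F s) + ∫ s in Ioi (0 : ℝ), F (s + h) := by
  rw [setIntegral_Ioi_add,
    intervalIntegral.integral_interval_add_Ioi hF (hF.mono_set (Ioi_subset_Ioi hh))]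

section Memory

variable {X : Type*} [NormedAddCommGroup X] [NormedSpace ℝ X] {g k : ℝ → ℝ} {f : ℝ → X} {C : ℝ}

theorem HasMemory.intervalIntegrable (hk : SubKernel g k C) (hf : HasMemory g f)
    {a b t : ℝ} (ha : 0 ≤ a) (hab : a ≤ b) (hbt : b ≤ t) :
    IntervalIntegrable (fun s => k s • f (t - s)) volume a b := by
  refine ContinuousOn.intervalIntegrable ?_
  rw [uIcc_of_le hab]
  refine (hk.cont.mono (fun s hs => ha.trans hs.1)).smul (hf.cont.comp (by fun_prop) ?_)
  intro s hs
  simp only [mem_Ici, sub_nonneg]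
  exact hs.2.trans hbt

theorem HasMemory.integrableOn_tail (hg : IsKernel g) (hk : SubKernel g k C) (hf : HasMemory g f)
    {t : ℝ} (ht : 0 ≤ t) : IntegrableOn (fun s => k (s + t) • f (-s)) (Ioi 0) := by
  refine Integrable.mono' (hf.int.const_mul C) ?_ ?_
  · refine AEStronglyMeasurable.smul ?_ hf.meas
    exact ((hk.shift hg ht).cont.mono Ioi_subset_Ici_self).aestronglyMeasurable measurableSet_Ioi
  · filter_upwards [ae_restrict_mem measurableSet_Ioi] with s hs
    rw [norm_smul, ← mul_assoc]
    exact mul_le_mul_of_nonneg_right ((hk.shift hg ht).bound s (le_of_lt hs)) (norm_nonneg _)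

theorem HasMemory.integrableOn (hg : IsKernel g) (hk : SubKernel g k C) (hf : HasMemory g f)
    {t : ℝ} (ht : 0 ≤ t) : IntegrableOn (fun s => k s • f (t - s)) (Ioi 0) := by
  rw [← Ioc_union_Ioi_eq_Ioi ht]
  refine IntegrableOn.union ?_ ?_
  · exact (intervalIntegrable_iff_integrableOn_Ioc_of_le ht).1
      (hf.intervalIntegrable hk le_rfl ht le_rfl)
  · rw [← integrableOn_Ioi_add_iff]
    simpa using hf.integrableOn_tail hg hk ht

/-- Splitting at s = t separates positive times, where f is continuous, from the history, which is
merely integrable against g. In the second integral t enters only through the kernel. -/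
theorem HasMemory.memory_eq (hg : IsKernel g) (hk : SubKernel g k C) (hf : HasMemory g f)
    {t : ℝ} (ht : 0 ≤ t) :
    memory k f t = (∫ s in (0 : ℝ)..t, k s • f (t - s)) + ∫ s in Ioi (0 : ℝ), k (s + t) • f (-s) := by
  rw [memory, setIntegral_Ioi_shift (hf.integrableOn hg hk ht) ht]
  simp

theorem continuousOn_tail (hg : IsKernel g) (hk : SubKernel g k C) (hf : HasMemory g f) :
    ContinuousOn (fun t => ∫ s in Ioi (0 : ℝ), k (s + t) • f (-s)) (Ici 0) := by
  refine continuousOn_of_dominated (bound := fun s => C * (g s * ‖f (-s)‖))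
    (fun t ht => (hf.integrableOn_tail hg hk ht).aestronglyMeasurable) (fun t ht => ?_)
    (hf.int.const_mul C) ?_
  · filter_upwards [ae_restrict_mem measurableSet_Ioi] with s hs
    rw [norm_smul, ← mul_assoc]
    exact mul_le_mul_of_nonneg_right ((hk.shift hg ht).bound s (le_of_lt hs)) (norm_nonneg _)
  · filter_upwards [ae_restrict_mem measurableSet_Ioi] with s hs
    refine ContinuousOn.smul (hk.cont.comp (by fun_prop) ?_) continuousOn_const
    intro t ht
    exact add_nonneg (le_of_lt hs) (mem_Ici.1 ht)

theorem continuousOn_head [CompleteSpace X] (hk : ContinuousOn k (Ici 0))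
    (hf : ContinuousOn f (Ici 0)) :
    ContinuousOn (fun t => ∫ s in (0 : ℝ)..t, k s • f (t - s)) (Ici 0) := by
  have hk' : Continuous fun s => k (max s 0) :=
    hk.comp_continuous (by fun_prop) (fun s => mem_Ici.2 (le_max_right _ _))
  have hf' : Continuous fun s => f (max s 0) :=
    hf.comp_continuous (by fun_prop) (fun s => mem_Ici.2 (le_max_right _ _))
  have : Continuous fun t => ∫ s in (0 : ℝ)..t, k (max s 0) • f (max (t - s) 0) := by
    refine intervalIntegral.continuous_parametric_intervalIntegral_of_continuous ?_ continuous_id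
    exact (hk'.comp continuous_snd).smul (hf'.comp (continuous_fst.sub continuous_snd))
  refine this.continuousOn.congr (fun t ht => ?_)
  refine intervalIntegral.integral_congr (fun s hs => ?_)
  rw [uIcc_of_le (mem_Ici.1 ht)] at hs
  simp only [max_eq_left hs.1, max_eq_left (sub_nonneg.2 hs.2)]

theorem HasMemory.continuousOn_memory [CompleteSpace X] (hg : IsKernel g) (hk : SubKernel g k C)
    (hf : HasMemory g f) : ContinuousOn (memory k f) (Ici 0) :=
  ((continuousOn_head hk.cont hf.cont).add (continuousOn_tail hg hk hf)).congr
    fun _ ht => hf.memory_eq hg hk ht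

/-- The increments of a memory integral. -/
theorem HasMemory.memory_add_sub (hg : IsKernel g) (hf : HasMemory g f) {t h : ℝ} (ht : 0 ≤ t)
    (hh : 0 ≤ h) :
    memory g f (t + h) - memory g f t
      = (∫ s in (0 : ℝ)..h, g s • f (t + h - s)) - memory (fun s => g s - g (s + h)) f t := by
  have h1 : memory g f (t + h) = (∫ s in (0 : ℝ)..h, g s • f (t + h - s))
      + memory (fun s => g (s + h)) f t := by
    rw [memory, setIntegral_Ioi_shift (hf.integrableOn hg hg.subKernel (add_nonneg ht hh)) hh]
    simp only [memory]
    congr 2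
    ext s
    congr 2
    ring
  have h2 : memory (fun s => g s - g (s + h)) f t
      = memory g f t - memory (fun s => g (s + h)) f t := by
    simp only [memory]
    rw [← integral_sub (hf.integrableOn hg hg.subKernel ht)
      (hf.integrableOn hg (hg.subKernel.shift hg hh) ht)]
    simp only [sub_smul]
  rw [h1, h2]
  abel

theorem IsKernel.integral_sub_shift (hg : IsKernel g) {h : ℝ} (hh : 0 ≤ h) :
    ∫ s in Ioi (0 : ℝ), (g s - g (s + h)) = ∫ s in (0 : ℝ)..h, g s := by
  rw [integral_sub hg.int ((hg.subKernel.shift hg hh).integrableOn hg),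
    setIntegral_Ioi_shift hg.int hh]
  ring

end Memory

/-! ### Quadratic memory -/

/-- `P` is continuous on `[0, ∞)` and its history is square integrable against `g`. -/
structure HasSqMemory {X : Type*} [NormedAddCommGroup X] (g : ℝ → ℝ) (P : ℝ → X) : Prop where
  cont : ContinuousOn P (Ici 0)
  meas : AEStronglyMeasurable (fun s => P (-s)) (volume.restrict (Ioi 0))
  int : IntegrableOn (fun s => g s * ‖P (-s)‖ ^ 2) (Ioi 0)

/-- `∫₀^∞ k(s) ‖P(t) - P(t - s)‖² ds`. -/
def deviation {X : Type*} [NormedAddCommGroup X] (k : ℝ → ℝ) (P : ℝ → X) (t : ℝ) : ℝ :=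
  ∫ s in Ioi (0 : ℝ), k s * ‖P t - P (t - s)‖ ^ 2

section SqMemoryNorm

variable {X : Type*} [NormedAddCommGroup X] {g : ℝ → ℝ} {P : ℝ → X}

theorem HasSqMemory.hasMemory (hg : IsKernel g) (hP : HasSqMemory g P) : HasMemory g P := by
  refine ⟨hP.cont, hP.meas, Integrable.mono' (hg.int.add hP.int) ?_ ?_⟩
  · exact hg.int.aestronglyMeasurable.mul hP.meas.norm
  · filter_upwards [ae_restrict_mem measurableSet_Ioi] with s hs
    have := hg.pos s (le_of_lt hs)
    rw [Real.norm_eq_abs, abs_of_nonneg (by positivity), Pi.add_apply]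
    nlinarith [sq_nonneg (‖P (-s)‖ - 1), norm_nonneg (P (-s)), sq_nonneg (‖P (-s)‖)]

theorem HasSqMemory.hasMemory_sq (hP : HasSqMemory g P) : HasMemory g (fun t => ‖P t‖ ^ 2) := by
  refine ⟨hP.cont.norm.pow 2, hP.meas.norm.pow 2, ?_⟩
  simpa using hP.int

end SqMemoryNorm

section SqMemory

variable {X : Type*} [NormedAddCommGroup X] [InnerProductSpace ℝ X] {g k : ℝ → ℝ} {P : ℝ → X}
  {C : ℝ}

theorem deviation_integrand_eq (k : ℝ → ℝ) (P : ℝ → X) (t s : ℝ) :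
    k s * ‖P t - P (t - s)‖ ^ 2
      = k s * ‖P t‖ ^ 2 - 2 * inner ℝ (P t) (k s • P (t - s)) + k s • ‖P (t - s)‖ ^ 2 := by
  rw [norm_sub_sq_real, inner_smul_right, smul_eq_mul]
  ring

theorem HasSqMemory.integrableOn_deviation (hg : IsKernel g) (hk : SubKernel g k C)
    (hP : HasSqMemory g P) {t : ℝ} (ht : 0 ≤ t) :
    IntegrableOn (fun s => k s * ‖P t - P (t - s)‖ ^ 2) (Ioi 0) := by
  simp_rw [deviation_integrand_eq]
  exact (((hk.integrableOn hg).mul_const _).sub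
    ((((hP.hasMemory hg).integrableOn hg hk ht).const_inner (P t)).const_mul 2)).add
    (hP.hasMemory_sq.integrableOn hg hk ht)

/-- Expanding the square separates P(t) from P(t-s), so that continuity in t, and later
differentiation in t, reduces to the convolutions of k with P and with ‖P‖². -/
theorem HasSqMemory.deviation_eq [CompleteSpace X] (hg : IsKernel g) (hk : SubKernel g k C)
    (hP : HasSqMemory g P) {t : ℝ} (ht : 0 ≤ t) :
    deviation k P t = (∫ s in Ioi (0 : ℝ), k s) * ‖P t‖ ^ 2 - 2 * inner ℝ (P t) (memory k P t)
      + memory k (fun t => ‖P t‖ ^ 2) t := by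
  have i1 := (hP.hasMemory hg).integrableOn hg hk ht
  have i2 := hP.hasMemory_sq.integrableOn hg hk ht
  have i3 := (hk.integrableOn hg).mul_const (‖P t‖ ^ 2)
  simp only [deviation, deviation_integrand_eq, memory]
  have e1 := integral_add (i3.sub ((i1.const_inner (P t)).const_mul 2)) i2
  have e2 := integral_sub i3 ((i1.const_inner (P t)).const_mul 2)
  simp only [Pi.sub_apply] at e1
  rw [e1, e2, integral_mul_const, integral_const_mul, integral_inner i1]

theorem HasSqMemory.continuousOn_deviation [CompleteSpace X] (hg : IsKernel g)
    (hk : SubKernel g k C) (hP : HasSqMemory g P) : ContinuousOn (deviation k P) (Ici 0) := by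
  refine ContinuousOn.congr (f := fun t => (∫ s in Ioi (0 : ℝ), k s) * ‖P t‖ ^ 2
    - 2 * inner ℝ (P t) (memory k P t) + memory k (fun t => ‖P t‖ ^ 2) t) ?_
    (fun t ht => hP.deviation_eq hg hk ht)
  exact ((continuousOn_const.mul (hP.cont.norm.pow 2)).sub (continuousOn_const.mul
    (hP.cont.inner ((hP.hasMemory hg).continuousOn_memory hg hk)))).add
    (hP.hasMemory_sq.continuousOn_memory hg hk)

/-- Cauchy-Schwarz for a weighted vector integral. -/
theorem norm_sq_setIntegral_smul_le {s : Set ℝ} (hs : MeasurableSet s) {k : ℝ → ℝ} {F : ℝ → X}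
    (hk : ∀ x ∈ s, 0 ≤ k x) (hki : IntegrableOn k s)
    (hF2 : IntegrableOn (fun x => k x * ‖F x‖ ^ 2) s) :
    ‖∫ x in s, k x • F x‖ ^ 2 ≤ (∫ x in s, k x) * ∫ x in s, k x * ‖F x‖ ^ 2 := by
  set K := ∫ x in s, k x with hK
  set Z := ∫ x in s, k x * ‖F x‖ ^ 2 with hZ
  have hK0 : 0 ≤ K := setIntegral_nonneg hs hk
  have hZ0 : 0 ≤ Z := setIntegral_nonneg hs fun x hx => mul_nonneg (hk x hx) (by positivity)
  have hle : ∀ r : ℝ, 0 < r → 2 * ‖∫ x in s, k x • F x‖ ≤ r * K + r⁻¹ * Z := by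
    intro r hr
    have h1 : ‖∫ x in s, k x • F x‖ ≤ ∫ x in s, (r * k x + r⁻¹ * (k x * ‖F x‖ ^ 2)) / 2 := by
      refine norm_integral_le_of_norm_le
        (((hki.const_mul r).add (hF2.const_mul r⁻¹)).div_const 2) ?_
      filter_upwards [ae_restrict_mem hs] with x hx
      rw [norm_smul, Real.norm_eq_abs, abs_of_nonneg (hk x hx)]
      have h3 : r + r⁻¹ * ‖F x‖ ^ 2 - 2 * ‖F x‖ = r⁻¹ * (r - ‖F x‖) ^ 2 := by
        field_simp; ring
      have h4 : 0 ≤ r⁻¹ * (r - ‖F x‖) ^ 2 := by positivity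
      rw [← h3] at h4
      nlinarith [mul_nonneg (hk x hx) h4]
    rw [integral_div, integral_add (hki.const_mul r) (hF2.const_mul r⁻¹), integral_const_mul,
      integral_const_mul] at h1
    linarith
  set N := ‖∫ x in s, k x • F x‖ with hN
  have hN0 : 0 ≤ N := norm_nonneg _
  by_contra hcon
  push Not at hcon
  have hNpos : 0 < N := by
    rcases hN0.eq_or_lt with h | h
    · rw [← h] at hcon; nlinarith [mul_nonneg hK0 hZ0]
    · exact h
  -- The optimal weight r = N / K gives 2N ≤ N + KZ/N. If K = 0, the weight (Z+1)/N already gives 2N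
  -- < N.
  rcases hK0.eq_or_lt with h | h
  · have := hle ((Z + 1) / N) (by positivity)
    rw [← h, inv_div, mul_zero, zero_add, div_mul_eq_mul_div, le_div_iff₀ (by positivity)] at this
    nlinarith
  · have := hle (N / K) (by positivity)
    rw [inv_div, div_mul_cancel₀ _ h.ne', div_mul_eq_mul_div] at this
    have h2 : N ≤ K * Z / N := by linarith
    rw [le_div_iff₀ hNpos] at h2
    nlinarith

end SqMemory

/-! ### Steklov averages -/

/-- The forward average `h⁻¹ ∫ₜ^{t+h} f`. -/
def steklov {X : Type*} [NormedAddCommGroup X] [NormedSpace ℝ X] (h : ℝ) (f : ℝ → X) (t : ℝ) : X :=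
  h⁻¹ • ∫ s in t..t + h, f s

/-- The forward difference quotient. -/
def diffQuot {X : Type*} [NormedAddCommGroup X] [NormedSpace ℝ X] (h : ℝ) (f : ℝ → X) (t : ℝ) : X :=
  h⁻¹ • (f (t + h) - f t)

section Steklov

variable {X : Type*} [NormedAddCommGroup X] [NormedSpace ℝ X] {f f' : ℝ → X} {h t : ℝ}

theorem _root_.ContinuousOn.intervalIntegrable_Ici (hf : ContinuousOn f (Ici 0)) {a b : ℝ} (ha : 0 ≤ a)
    (hb : 0 ≤ b) : IntervalIntegrable f volume a b :=
  (hf.mono (fun _ hx => (le_min ha hb).trans hx.1)).intervalIntegrable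

theorem hasDerivAt_steklov [CompleteSpace X] (hf : ContinuousOn f (Ici 0)) (hh : 0 ≤ h)
    (ht : 0 < t) : HasDerivAt (steklov h f) (diffQuot h f t) t := by
  have key : ∀ x, 0 < x → HasDerivAt (fun y => ∫ s in (0 : ℝ)..y, f s) (f x) x := by
    intro x hx
    refine intervalIntegral.integral_hasDerivAt_right
      (hf.intervalIntegrable_Ici le_rfl hx.le) ?_ (hf.continuousAt (Ici_mem_nhds hx))
    exact (hf.mono Ioi_subset_Ici_self).stronglyMeasurableAtFilter isOpen_Ioi x hx
  have h2 : HasDerivAt (fun y => ∫ s in (0 : ℝ)..y + h, f s) (f (t + h)) t :=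
    (key (t + h) (by linarith)).comp_add_const t h
  have h3 := (h2.sub (key t ht)).const_smul h⁻¹
  refine h3.congr_of_eventuallyEq ?_
  filter_upwards [Ioi_mem_nhds ht] with y hy
  have hy' : 0 ≤ y := le_of_lt hy
  simp only [steklov, Pi.smul_apply, Pi.sub_apply]
  rw [intervalIntegral.integral_interval_sub_left (hf.intervalIntegrable_Ici le_rfl (by linarith))
    (hf.intervalIntegrable_Ici le_rfl hy')]

theorem continuousOn_steklov [CompleteSpace X] (hf : ContinuousOn f (Ici 0)) (hh : 0 ≤ h) :
    ContinuousOn (steklov h f) (Ici 0) := by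
  have hf' : Continuous fun s => f (max s 0) :=
    hf.comp_continuous (by fun_prop) (fun s => mem_Ici.2 (le_max_right _ _))
  have hc : Continuous fun t => h⁻¹ • ((∫ s in (0 : ℝ)..t + h, f (max s 0))
      - ∫ s in (0 : ℝ)..t, f (max s 0)) := by
    have := intervalIntegral.continuous_primitive (μ := volume)
      (fun a b => hf'.intervalIntegrable a b) 0
    exact ((this.comp (continuous_id.add continuous_const)).sub this).const_smul _
  refine hc.continuousOn.congr (fun t ht => ?_)
  have ht' : 0 ≤ t := ht
  beta_reduce
  rw [intervalIntegral.integral_interval_sub_left (hf'.intervalIntegrable _ _)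
    (hf'.intervalIntegrable _ _), steklov]
  congr 1
  refine intervalIntegral.integral_congr (fun s hs => ?_)
  rw [uIcc_of_le (by linarith)] at hs
  simp only [max_eq_left (ht'.trans hs.1)]

theorem steklov_eq_diffQuot [CompleteSpace X]
    (hf : ∀ t, 0 ≤ t → HasDerivWithinAt f (f' t) (Ici 0) t)
    (hf' : ContinuousOn f' (Ici 0)) (hh : 0 ≤ h) (ht : 0 ≤ t) :
    diffQuot h f t = steklov h f' t := by
  rw [diffQuot, steklov, intervalIntegral.integral_eq_sub_of_hasDeriv_right_of_le (f' := f')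
    (by linarith) (f := f)]
  · exact fun x hx => ((hf x (ht.trans hx.1)).continuousWithinAt.mono
      (fun y hy => ht.trans hy.1))
  · intro x hx
    exact (hf x (ht.trans hx.1.le)).mono (fun y hy => (ht.trans hx.1.le).trans (le_of_lt hy))
  · exact hf'.intervalIntegrable_Ici ht (by linarith)

theorem tendsto_steklov [CompleteSpace X] (hf : ContinuousOn f (Ici 0)) (ht : 0 ≤ t) :
    Tendsto (fun h => steklov h f t) (𝓝[>] 0) (𝓝 (f t)) := by
  have hf' : Continuous fun s => f (max s 0) :=
    hf.comp_continuous (by fun_prop) (fun s => mem_Ici.2 (le_max_right _ _))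
  have hd : HasDerivAt (fun y => ∫ s in t..y, f (max s 0)) (f (max t 0)) t :=
    intervalIntegral.integral_hasDerivAt_right (hf'.intervalIntegrable _ _)
      (hf'.stronglyMeasurableAtFilter _ _) hf'.continuousAt
  have h2 := hd.tendsto_slope_zero_right
  rw [max_eq_left ht] at h2
  refine h2.congr' ?_
  filter_upwards [self_mem_nhdsWithin] with h hh
  have hh' : 0 < h := hh
  rw [intervalIntegral.integral_same, sub_zero, steklov]
  congr 1
  refine intervalIntegral.integral_congr (fun s hs => ?_)
  rw [uIcc_of_le (by linarith)] at hs
  simp only [max_eq_left (ht.trans hs.1)]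

theorem norm_steklov_le {T B : ℝ} (hB : ∀ s ∈ Icc 0 (T + 1), ‖f s‖ ≤ B) (hh : 0 < h)
    (hh1 : h ≤ 1) (ht : t ∈ Icc 0 T) : ‖steklov h f t‖ ≤ B := by
  have h1 : ‖∫ s in t..t + h, f s‖ ≤ B * |t + h - t| := by
    refine intervalIntegral.norm_integral_le_of_norm_le_const (fun s hs => ?_)
    rw [uIoc_of_le (by linarith)] at hs
    exact hB s ⟨by linarith [ht.1, hs.1], by linarith [ht.2, hs.2]⟩
  rw [add_sub_cancel_left, abs_of_pos hh] at h1
  rw [steklov, norm_smul, norm_inv, Real.norm_of_nonneg hh.le, inv_mul_le_iff₀ hh]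
  linarith

theorem steklov_sub (h1 : ContinuousOn f (Ici 0)) (h2 : ContinuousOn f' (Ici 0)) (hh : 0 ≤ h)
    (ht : 0 ≤ t) : steklov h (fun s => f s - f' s) t = steklov h f t - steklov h f' t := by
  rw [steklov, steklov, steklov, intervalIntegral.integral_sub
    (h1.intervalIntegrable_Ici ht (by linarith)) (h2.intervalIntegrable_Ici ht (by linarith)),
    smul_sub]

end Steklov

/-! ### The abstract problem -/

/-- A solution of the Timoshenko system, written in terms of the shear `P`, with the spaces
`H¹₀` and `H¹_*` described through the primitive operator `J`. -/
structure AbstractSolution {X : Type*} [NormedAddCommGroup X] [InnerProductSpace ℝ X]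
    (J : X →L[ℝ] X) (V : Submodule ℝ X) (g : ℝ → ℝ) (ρ₁ ρ₂ b κ : ℝ) (P φt ψ ψx ψt : ℝ → X) :
    Prop where
  ρ₁_pos : 0 < ρ₁
  ρ₂_pos : 0 < ρ₂
  b_pos : 0 < b
  κ_pos : 0 < κ
  speed : b * ρ₁ = κ * ρ₂
  kernel : IsKernel g
  int_lt : ∫ s in Ioi (0 : ℝ), g s < 1
  closed : IsClosed (V : Set X)
  sq : HasSqMemory g P
  P_mem : ∀ t, P t ∈ V
  ψ_mem : ∀ t, 0 ≤ t → ψ t ∈ V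
  ψt_mem : ∀ t, 0 ≤ t → ψt t ∈ V
  weak : ∀ t, 0 ≤ t → ∀ f ∈ V, inner ℝ (ψ t) f = - inner ℝ (ψx t) (J f)
  φt_cont : ContinuousOn φt (Ici 0)
  ψ_cont : ContinuousOn ψ (Ici 0)
  ψx_cont : ContinuousOn ψx (Ici 0)
  ψt_cont : ContinuousOn ψt (Ici 0)
  φ_deriv : ∀ t, 0 ≤ t → HasDerivWithinAt (fun τ => J (P τ - ψ τ)) (φt t) (Ici 0) t
  ψ_deriv : ∀ t, 0 ≤ t → HasDerivWithinAt ψ (ψt t) (Ici 0) t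
  eq_φ : ∀ f ∈ V, ∀ t, 0 < t → HasDerivAt (fun τ => ρ₁ * inner ℝ (φt τ) (J f))
    (-(κ * inner ℝ (P t - memory g P t) f)) t
  eq_ψ : ∀ v ∈ V, ∀ w, (∀ f ∈ V, inner ℝ v f = - inner ℝ w (J f)) → ∀ t, 0 < t →
    HasDerivAt (fun τ => ρ₂ * inner ℝ (ψt τ) v)
      (-(b * inner ℝ (ψx t) w) - κ * inner ℝ (P t - memory g P t) v) t

/-- The system satisfied, at a given time, by the values and time derivatives of a solution that is
smooth in time. -/
structure SmoothState {X : Type*} [NormedAddCommGroup X] [InnerProductSpace ℝ X]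
    (J : X →L[ℝ] X) (V : Submodule ℝ X) (ρ₁ ρ₂ b κ : ℝ) (A A' B B' W Wx Wx' P P' G : X) :
    Prop where
  B_mem : B ∈ V
  B'_mem : B' ∈ V
  W_mem : W ∈ V
  P_mem : P ∈ V
  P'_mem : P' ∈ V
  G_mem : G ∈ V
  weak : ∀ f ∈ V, inner ℝ W f = - inner ℝ Wx (J f)
  weak' : ∀ f ∈ V, inner ℝ B f = - inner ℝ Wx' (J f)
  disp : J (P' - B) = A
  eq_φ : ∀ f ∈ V, ρ₁ * inner ℝ A' (J f) = -(κ * inner ℝ (P - G) f)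
  eq_ψ : ∀ v ∈ V, ∀ w, (∀ f ∈ V, inner ℝ v f = - inner ℝ w (J f)) →
    ρ₂ * inner ℝ B' v = -(b * inner ℝ Wx w) - κ * inner ℝ (P - G) v

section Smooth

variable {X : Type*} [NormedAddCommGroup X] [InnerProductSpace ℝ X] [CompleteSpace X]
  {J : X →L[ℝ] X} {V : Submodule ℝ X} {g : ℝ → ℝ} {ρ₁ ρ₂ b κ : ℝ}

/-- The weak equation integrated over [t, t+h]. This is how an averaged solution acquires a second
time derivative in X. -/
theorem inner_diffQuot_eq {u : ℝ → X} {v : X} {ρ : ℝ} {s : ℝ → ℝ} {h t : ℝ} (hh : 0 < h)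
    (ht : 0 < t) (hs : ContinuousOn s (Ici 0))
    (hd : ∀ t, 0 < t → HasDerivAt (fun τ => ρ * inner ℝ (u τ) v) (s t) t) :
    ρ * inner ℝ (diffQuot h u t) v = steklov h s t := by
  have := intervalIntegral.integral_eq_sub_of_hasDerivAt (a := t) (b := t + h)
    (f := fun τ => ρ * inner ℝ (u τ) v) (f' := s) (fun x hx => by
      rw [uIcc_of_le (by linarith)] at hx
      exact hd x (ht.trans_le hx.1)) (hs.intervalIntegrable_Ici ht.le (by linarith))
  rw [steklov, this, diffQuot, inner_smul_left, inner_sub_left]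
  simp only [conj_trivial, smul_eq_mul]
  ring

theorem inner_steklov {u : ℝ → X} {v : X} {h t : ℝ} (hu : ContinuousOn u (Ici 0)) (hh : 0 ≤ h)
    (ht : 0 ≤ t) : inner ℝ (steklov h u t) v = steklov h (fun s => inner ℝ (u s) v) t := by
  have hi := hu.intervalIntegrable_Ici ht (show 0 ≤ t + h by linarith)
  rw [steklov, steklov, inner_smul_left, intervalIntegral.integral_of_le (by linarith),
    intervalIntegral.integral_of_le (by linarith), real_inner_comm, ← integral_inner hi.1]
  simp only [conj_trivial, smul_eq_mul, real_inner_comm]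

theorem map_steklov {u : ℝ → X} {h t : ℝ} (hu : ContinuousOn u (Ici 0)) (hh : 0 ≤ h)
    (ht : 0 ≤ t) : J (steklov h u t) = steklov h (fun s => J (u s)) t := by
  have hi := hu.intervalIntegrable_Ici ht (show 0 ≤ t + h by linarith)
  rw [steklov, steklov, map_smul, J.intervalIntegral_comp_comm hi]

theorem steklov_mem {f : ℝ → X} {h t : ℝ} (hV : IsClosed (V : Set X))
    (hf : ContinuousOn f (Ici 0)) (hm : ∀ t, 0 ≤ t → f t ∈ V) (hh : 0 < h) (ht : 0 ≤ t) :
    steklov h f t ∈ V := by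
  have : CompleteSpace V := hV.completeSpace_coe
  -- Membership in the closed subspace means being fixed by the orthogonal projection, and a bounded
  -- operator commutes with averaging.
  rw [← V.starProjection_eq_self_iff, map_steklov hf hh.le ht, steklov, steklov]
  congr 1
  refine intervalIntegral.integral_congr (fun s hs => ?_)
  rw [uIcc_of_le (by linarith)] at hs
  exact (V.starProjection_eq_self_iff).2 (hm s (ht.trans hs.1))

variable {P φt ψ ψx ψt : ℝ → X}

theorem AbstractSolution.memory_mem (U : AbstractSolution J V g ρ₁ ρ₂ b κ P φt ψ ψx ψt) {t : ℝ}
    (ht : 0 ≤ t) : memory g P t ∈ V := by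
  have : CompleteSpace V := U.closed.completeSpace_coe
  have hi := (U.sq.hasMemory U.kernel).integrableOn U.kernel U.kernel.subKernel ht
  rw [← V.starProjection_eq_self_iff, memory, ← V.starProjection.integral_comp_comm hi]
  refine integral_congr_ae (Eventually.of_forall fun s => ?_)
  exact (V.starProjection_eq_self_iff).2 (V.smul_mem _ (U.P_mem _))

theorem AbstractSolution.continuousOn_memory (U : AbstractSolution J V g ρ₁ ρ₂ b κ P φt ψ ψx ψt) :
    ContinuousOn (memory g P) (Ici 0) :=
  (U.sq.hasMemory U.kernel).continuousOn_memory U.kernel U.kernel.subKernel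

theorem diffQuot_mem {u : ℝ → X} {h t : ℝ} (h1 : u (t + h) ∈ V) (h2 : u t ∈ V) :
    diffQuot h u t ∈ V := V.smul_mem _ (V.sub_mem h1 h2)

/-- The system is linear with coefficients constant in time, so it survives averaging over [t, t+h],
with the average of g∗P in the role of G. Difference quotients take the place of time derivatives.
-/
theorem AbstractSolution.smoothState (U : AbstractSolution J V g ρ₁ ρ₂ b κ P φt ψ ψx ψt) {h t : ℝ}
    (hh : 0 < h) (ht : 0 < t) :
    SmoothState J V ρ₁ ρ₂ b κ (steklov h φt t) (diffQuot h φt t) (steklov h ψt t)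
      (diffQuot h ψt t) (steklov h ψ t) (steklov h ψx t) (diffQuot h ψx t) (steklov h P t)
      (diffQuot h P t) (steklov h (memory g P) t) := by
  have hth : 0 ≤ t + h := by linarith
  have hG := U.continuousOn_memory
  have hS : ContinuousOn (fun s => P s - memory g P s) (Ici 0) := U.sq.cont.sub hG
  have hSt : ∀ v : X, inner ℝ (steklov h P t - steklov h (memory g P) t) v
      = steklov h (fun s => inner ℝ (P s - memory g P s) v) t := fun v => by
    rw [← steklov_sub U.sq.cont hG hh.le ht.le, inner_steklov hS hh.le ht.le]
  have hBψ : diffQuot h ψ t = steklov h ψt t :=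
    steklov_eq_diffQuot U.ψ_deriv U.ψt_cont hh.le ht.le
  have hlin : ∀ (a : ℝ) (s : ℝ → ℝ), steklov h (fun x => a * s x) t = a * steklov h s t := by
    intro a s
    simp only [steklov, intervalIntegral.integral_const_mul, smul_eq_mul]
    ring
  refine ⟨steklov_mem U.closed U.ψt_cont U.ψt_mem hh ht.le,
    diffQuot_mem (U.ψt_mem _ hth) (U.ψt_mem _ ht.le),
    steklov_mem U.closed U.ψ_cont U.ψ_mem hh ht.le,
    steklov_mem U.closed U.sq.cont (fun t _ => U.P_mem t) hh ht.le,
    diffQuot_mem (U.P_mem _) (U.P_mem _),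
    steklov_mem U.closed hG (fun t ht => U.memory_mem ht) hh ht.le, ?_, ?_, ?_, ?_, ?_⟩
  · intro f hf
    rw [inner_steklov U.ψ_cont hh.le ht.le, inner_steklov U.ψx_cont hh.le ht.le]
    simp only [steklov, ← smul_neg, ← intervalIntegral.integral_neg]
    congr 1
    refine intervalIntegral.integral_congr (fun s hs => ?_)
    rw [uIcc_of_le (by linarith)] at hs
    exact U.weak s (ht.le.trans hs.1) f hf
  · intro f hf
    rw [← hBψ, diffQuot, diffQuot, inner_smul_left, inner_smul_left, inner_sub_left, inner_sub_left,
      U.weak _ hth f hf, U.weak _ ht.le f hf]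
    ring
  · rw [← hBψ, ← steklov_eq_diffQuot U.φ_deriv U.φt_cont hh.le ht.le]
    simp only [diffQuot, ← smul_sub, map_smul, map_sub]
    congr 1
    abel
  · intro f hf
    have hc : ContinuousOn (fun t => -(κ * inner ℝ (P t - memory g P t) f)) (Ici 0) :=
      (continuousOn_const.mul (hS.inner continuousOn_const)).neg
    rw [inner_diffQuot_eq hh ht hc (U.eq_φ f hf), hSt]
    simp only [← neg_mul, hlin]
  · intro v hv w hw
    have c1 : ContinuousOn (fun t => inner ℝ (ψx t) w) (Ici 0) := U.ψx_cont.inner continuousOn_const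
    have c2 : ContinuousOn (fun t => inner ℝ (P t - memory g P t) v) (Ici 0) :=
      hS.inner continuousOn_const
    have hc : ContinuousOn (fun t => -(b * inner ℝ (ψx t) w)
        - κ * inner ℝ (P t - memory g P t) v) (Ici 0) :=
      (continuousOn_const.mul c1).neg.sub (continuousOn_const.mul c2)
    rw [inner_diffQuot_eq hh ht hc (U.eq_ψ v hv w hw), hSt, inner_steklov U.ψx_cont hh.le ht.le,
      ← hlin, ← hlin]
    rw [steklov_sub (f := fun t => -(b * inner ℝ (ψx t) w))
      (f' := fun t => κ * inner ℝ (P t - memory g P t) v) (continuousOn_const.mul c1).neg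
      (continuousOn_const.mul c2) hh.le ht.le]
    congr 1
    simp only [steklov, intervalIntegral.integral_neg, smul_neg]

/-! ### Multipliers -/

/-- The energy of the beam without the potential energy of the history. -/
def elasticEnergy (ρ₁ ρ₂ b κ : ℝ) (A B Wx P G : X) : ℝ :=
  1 / 2 * (ρ₁ * ‖A‖ ^ 2 + ρ₂ * ‖B‖ ^ 2 + b * ‖Wx‖ ^ 2 + κ * ‖P‖ ^ 2) - κ * inner ℝ G P

/-- The combination of the multipliers. -/
def multiplier (J : X →L[ℝ] X) (ρ₁ ρ₂ g₀ n₁ n₃ : ℝ) (A B W Wx P G : X) : ℝ :=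
  n₁ * (ρ₁ * inner ℝ A (J G)) - ρ₁ * inner ℝ A (J (g₀ • P - G))
    - n₃ * (ρ₂ * inner ℝ B (P - G) + ρ₂ * inner ℝ Wx A) + ρ₂ * inner ℝ B W

variable {A A' B B' W Wx Wx' P₀ P₀' G₀ : X}

/-- Test the φ equation with φ_t, which is the primitive of P' - ψ_t, and the ψ equation with ψ_t.
In the derivative of `elasticEnergy` only the term containing G' is then left. -/
theorem SmoothState.elastic_deriv (S : SmoothState J V ρ₁ ρ₂ b κ A A' B B' W Wx Wx' P₀ P₀' G₀) :
    ρ₁ * inner ℝ A A' + ρ₂ * inner ℝ B B' + b * inner ℝ Wx Wx' + κ * inner ℝ P₀ P₀'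
      - κ * inner ℝ G₀ P₀' = 0 := by
  have h1 := S.eq_φ (P₀' - B) (V.sub_mem S.P'_mem S.B_mem)
  rw [S.disp, real_inner_comm A A'] at h1
  have h2 := S.eq_ψ B S.B_mem Wx' S.weak'
  rw [real_inner_comm B B'] at h2
  simp only [inner_sub_left, inner_sub_right] at h1 h2
  linarith

/-- The φ equation says that the stress P₀ - G₀ has weak derivative (ρ₁/κ) A', so it may be used as
a test function in the ψ equation. The resulting b (ρ₁/κ) ⟨Wx, A'⟩ cancels ρ₂ ⟨Wx, A'⟩ because the
wave speeds are equal, while the pairing of B with P₀' - B cancels ⟨Wx', A⟩ and leaves the damping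
-ρ₂ ‖B‖². -/
theorem SmoothState.shear_deriv (S : SmoothState J V ρ₁ ρ₂ b κ A A' B B' W Wx Wx' P₀ P₀' G₀)
    (hV : IsClosed (V : Set X)) (hκ : 0 < κ) (hsp : b * ρ₁ = κ * ρ₂) (Q : X) :
    -(ρ₂ * inner ℝ B' (P₀ - G₀) + ρ₂ * inner ℝ B (P₀' - Q) + ρ₂ * inner ℝ Wx' A
      + ρ₂ * inner ℝ Wx A') ≤ κ * ‖P₀ - G₀‖ ^ 2 - ρ₂ * ‖B‖ ^ 2 + ρ₂ * inner ℝ B Q := by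
  have : CompleteSpace V := hV.completeSpace_coe
  -- Only pairings with elements of V matter, so the projection of the stress onto V can stand in
  -- for the stress.
  set v := V.starProjection (P₀ - G₀) with hv
  have hvV : v ∈ V := V.starProjection_apply_mem _
  have hvf : ∀ f ∈ V, inner ℝ v f = inner ℝ (P₀ - G₀) f := by
    intro f hf
    rw [hv, V.inner_starProjection_left_eq_right, (V.starProjection_eq_self_iff).2 hf]
  have hw : ∀ f ∈ V, inner ℝ v f = - inner ℝ ((ρ₁ / κ) • A') (J f) := by
    intro f hf
    have := S.eq_φ f hf
    rw [hvf f hf, inner_smul_left, conj_trivial]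
    field_simp
    linarith
  have h1 := S.eq_ψ v hvV _ hw
  have h2 : inner ℝ B' v = inner ℝ B' (P₀ - G₀) := by
    rw [real_inner_comm, hvf _ S.B'_mem, real_inner_comm]
  have h3 : inner ℝ (P₀ - G₀) v ≤ ‖P₀ - G₀‖ ^ 2 := by
    refine (real_inner_le_norm _ _).trans ?_
    rw [sq]
    exact mul_le_mul_of_nonneg_left (V.norm_starProjection_apply_le _) (norm_nonneg _)
  have h4 := S.weak' (P₀' - B) (V.sub_mem S.P'_mem S.B_mem)
  rw [S.disp] at h4
  rw [h2, inner_smul_right] at h1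
  -- The one place where the equality of the wave speeds is used.
  have h5 : b * (ρ₁ / κ * inner ℝ Wx A') = ρ₂ * inner ℝ Wx A' := by
    rw [← mul_assoc, ← mul_div_assoc, hsp, mul_div_cancel_left₀ _ hκ.ne']
  rw [h5] at h1
  have h6 : inner ℝ B B = ‖B‖ ^ 2 := real_inner_self_eq_norm_sq B
  simp only [inner_sub_right] at h4 ⊢ h1
  have h3' := mul_le_mul_of_nonneg_left h3 hκ.le
  linear_combination h3' - h1 - ρ₂ * h4 - ρ₂ * h6

end Smooth

section Multiplier

variable {X : Type*} [NormedAddCommGroup X] [InnerProductSpace ℝ X] [CompleteSpace X]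
  {J : X →L[ℝ] X} {V : Submodule ℝ X} {g : ℝ → ℝ} {ρ₁ ρ₂ b κ : ℝ}
  {A A' B B' W Wx Wx' P₀ P₀' G₀ : X}

/-- Poincaré's inequality. -/
theorem norm_le_of_weak (hW : W ∈ V) (hw : ∀ f ∈ V, inner ℝ W f = - inner ℝ Wx (J f)) :
    ‖W‖ ≤ ‖J‖ * ‖Wx‖ := by
  have h := hw W hW
  rw [real_inner_self_eq_norm_sq] at h
  have h2 : -inner ℝ Wx (J W) ≤ ‖Wx‖ * (‖J‖ * ‖W‖) := by
    rw [← inner_neg_left]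
    refine (real_inner_le_norm _ _).trans ?_
    rw [norm_neg]
    exact mul_le_mul_of_nonneg_left (J.le_opNorm W) (norm_nonneg _)
  rcases (norm_nonneg W).eq_or_lt with h0 | h0
  · rw [← h0]; positivity
  · have : ‖W‖ * ‖W‖ ≤ ‖J‖ * ‖Wx‖ * ‖W‖ := by nlinarith
    exact le_of_mul_le_mul_right this h0

/-- The total of the multiplier estimates, as an inequality between real numbers. -/
theorem exists_multiplier_constants {ρ₁ ρ₂ b κ g₀ j : ℝ} (hρ₁ : 0 < ρ₁) (hρ₂ : 0 < ρ₂)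
    (hb : 0 < b) (hκ : 0 < κ) (hg₀ : 0 < g₀) (hg₁ : g₀ < 1) :
    ∃ n₁ n₃ m C : ℝ, 0 < n₁ ∧ 0 < n₃ ∧ 0 < m ∧ 0 < C ∧ ∀ a β x p μ θ : ℝ,
      n₁ * (-(κ * (1 - g₀) * g₀ * p ^ 2) + κ * (p * μ) + κ * μ ^ 2 + ρ₁ * j * (a * θ))
      + (κ * (p * μ) + κ * μ ^ 2 - ρ₁ * g₀ * a ^ 2 + ρ₁ * j * (a * β) + ρ₁ * j * (a * θ))
      + n₃ * (κ * (p + μ) ^ 2 - ρ₂ * β ^ 2 + ρ₂ * (β * θ))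
      + (-(b * x ^ 2) + κ * ((p + μ) * (j * x)) + ρ₂ * β ^ 2)
      ≤ -(m * (a ^ 2 + β ^ 2 + x ^ 2 + p ^ 2)) + C * (μ ^ 2 + θ ^ 2) := by
  have hl : 0 < 1 - g₀ := by linarith
  -- Young's inequality leaves n₃ρ₂/2 of damping in β². It has to cover ρ₂ from the last multiplier
  -- and ρ₁j²/g₀ from the second, with ρ₂ to spare.
  obtain ⟨n₃, hn₃p, hn₃⟩ : ∃ n₃ : ℝ, 0 < n₃ ∧ n₃ = 4 + 2 * ρ₁ * j ^ 2 / (g₀ * ρ₂) :=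
    ⟨_, by positivity, rfl⟩
  -- The p² terms produced by the second, third and fourth multipliers. The constant n₁ is then
  -- fixed so that half of the damping in p² of the first one equals k₁ + 1.
  obtain ⟨k₁, hk₁p, hk₁⟩ : ∃ k₁ : ℝ, 0 < k₁ ∧ k₁ = κ + 2 * n₃ * κ + κ ^ 2 * j ^ 2 / b :=
    ⟨_, by positivity, rfl⟩
  obtain ⟨n₁, hn₁p, hn₁⟩ : ∃ n₁ : ℝ, 0 < n₁ ∧ n₁ = 2 * (k₁ + 1) / (κ * (1 - g₀) * g₀) :=
    ⟨_, by positivity, rfl⟩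
  -- The damping left over in each variable: for a², three cross terms each use a quarter of ρ₁g₀.
  obtain ⟨m, hmp, ma, mβ, mx, mp⟩ : ∃ m : ℝ, 0 < m ∧ m ≤ ρ₁ * g₀ / 4 ∧ m ≤ ρ₂ ∧ m ≤ b / 2 ∧
      m ≤ 1 :=
    ⟨min (min (ρ₁ * g₀ / 4) ρ₂) (min (b / 2) 1), by positivity,
      (min_le_left _ _).trans (min_le_left _ _), (min_le_left _ _).trans (min_le_right _ _),
      (min_le_right _ _).trans (min_le_left _ _), (min_le_right _ _).trans (min_le_right _ _)⟩
  obtain ⟨c₁, hc₁p, hc₁⟩ : ∃ c₁ : ℝ, 0 < c₁ ∧ c₁ = n₁ * (κ / (2 * (1 - g₀) * g₀) + κ) + 2 * κ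
      + 2 * n₃ * κ + κ ^ 2 * j ^ 2 / b := ⟨_, by positivity, rfl⟩
  obtain ⟨c₂, hc₂p, hc₂⟩ : ∃ c₂ : ℝ, 0 < c₂ ∧ c₂ = n₁ ^ 2 * ρ₁ * j ^ 2 / g₀ + ρ₁ * j ^ 2 / g₀
      + n₃ * ρ₂ / 2 := ⟨_, by positivity, rfl⟩
  refine ⟨n₁, n₃, m, c₁ + c₂, hn₁p, hn₃p, hmp, by positivity, fun a β x p μ θ => ?_⟩
  have t1 : κ * (p * μ) ≤ κ * (1 - g₀) * g₀ / 2 * p ^ 2 + κ / (2 * (1 - g₀) * g₀) * μ ^ 2 := by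
    have : κ * (1 - g₀) * g₀ / 2 * p ^ 2 + κ / (2 * (1 - g₀) * g₀) * μ ^ 2 - κ * (p * μ)
        = κ / (2 * (1 - g₀) * g₀) * ((1 - g₀) * g₀ * p - μ) ^ 2 := by
      field_simp
      ring
    have h2 : 0 ≤ κ / (2 * (1 - g₀) * g₀) * ((1 - g₀) * g₀ * p - μ) ^ 2 := by positivity
    linarith
  have t1' := mul_le_mul_of_nonneg_left t1 hn₁p.le
  have e1 : n₁ * (κ * (1 - g₀) * g₀ / 2 * p ^ 2) = (k₁ + 1) * p ^ 2 := by
    rw [hn₁]; field_simp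
  have t2 : n₁ * (ρ₁ * j * (a * θ)) ≤ ρ₁ * g₀ / 4 * a ^ 2 + n₁ ^ 2 * ρ₁ * j ^ 2 / g₀ * θ ^ 2 := by
    have : ρ₁ * g₀ / 4 * a ^ 2 + n₁ ^ 2 * ρ₁ * j ^ 2 / g₀ * θ ^ 2 - n₁ * (ρ₁ * j * (a * θ))
        = ρ₁ / g₀ * (g₀ * a / 2 - n₁ * j * θ) ^ 2 := by
      field_simp
      ring
    have h2 : 0 ≤ ρ₁ / g₀ * (g₀ * a / 2 - n₁ * j * θ) ^ 2 := by positivity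
    linarith
  have t3 : κ * (p * μ) ≤ κ * p ^ 2 + κ * μ ^ 2 := by
    have : p * μ ≤ p ^ 2 + μ ^ 2 := by
      linarith [sq_nonneg (p - μ), sub_sq p μ, sq_nonneg p, sq_nonneg μ]
    linarith [mul_le_mul_of_nonneg_left this hκ.le]
  have t4 : ∀ z : ℝ, ρ₁ * j * (a * z) ≤ ρ₁ * g₀ / 4 * a ^ 2 + ρ₁ * j ^ 2 / g₀ * z ^ 2 := by
    intro z
    have : ρ₁ * g₀ / 4 * a ^ 2 + ρ₁ * j ^ 2 / g₀ * z ^ 2 - ρ₁ * j * (a * z)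
        = ρ₁ / g₀ * (g₀ * a / 2 - j * z) ^ 2 := by
      field_simp
      ring
    have h2 : 0 ≤ ρ₁ / g₀ * (g₀ * a / 2 - j * z) ^ 2 := by positivity
    linarith
  have t5 : (p + μ) ^ 2 ≤ 2 * p ^ 2 + 2 * μ ^ 2 := by
    linarith [sq_nonneg (p - μ), sub_sq p μ, add_sq p μ]
  have t6 : β * θ ≤ β ^ 2 / 2 + θ ^ 2 / 2 := by
    linarith [sq_nonneg (β - θ), sub_sq β θ]
  have t7 : κ * ((p + μ) * (j * x)) ≤ b / 2 * x ^ 2 + κ ^ 2 * j ^ 2 / b / 2 * (p + μ) ^ 2 := by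
    have : b / 2 * x ^ 2 + κ ^ 2 * j ^ 2 / b / 2 * (p + μ) ^ 2 - κ * ((p + μ) * (j * x))
        = 1 / (2 * b) * (b * x - κ * j * (p + μ)) ^ 2 := by
      field_simp
      ring
    have h2 : 0 ≤ 1 / (2 * b) * (b * x - κ * j * (p + μ)) ^ 2 := by positivity
    linarith
  have t8 := mul_le_mul_of_nonneg_left t5 (show 0 ≤ κ ^ 2 * j ^ 2 / b / 2 by positivity)
  have t5' := mul_le_mul_of_nonneg_left t5 (show 0 ≤ n₃ * κ by positivity)
  have t6' := mul_le_mul_of_nonneg_left t6 (show 0 ≤ n₃ * ρ₂ by positivity)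
  have e2 : n₃ * ρ₂ / 2 * β ^ 2 = 2 * ρ₂ * β ^ 2 + ρ₁ * j ^ 2 / g₀ * β ^ 2 := by
    rw [hn₃]; field_simp; ring
  have m1 := mul_le_mul_of_nonneg_right ma (sq_nonneg a)
  have m2 := mul_le_mul_of_nonneg_right mβ (sq_nonneg β)
  have m3 := mul_le_mul_of_nonneg_right mx (sq_nonneg x)
  have m4 := mul_le_mul_of_nonneg_right mp (sq_nonneg p)
  have q1 : 0 ≤ c₁ * θ ^ 2 := by positivity
  have q2 : 0 ≤ c₂ * μ ^ 2 := by positivity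
  have t4β := t4 β
  have t4θ := t4 θ
  have e3 : c₁ * μ ^ 2 = n₁ * (κ / (2 * (1 - g₀) * g₀) * μ ^ 2) + n₁ * (κ * μ ^ 2) + 2 * κ * μ ^ 2
      + 2 * n₃ * κ * μ ^ 2 + κ ^ 2 * j ^ 2 / b * μ ^ 2 := by rw [hc₁]; ring
  have e4 : c₂ * θ ^ 2 = n₁ ^ 2 * ρ₁ * j ^ 2 / g₀ * θ ^ 2 + ρ₁ * j ^ 2 / g₀ * θ ^ 2
      + n₃ * ρ₂ / 2 * θ ^ 2 := by rw [hc₂]; ring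
  have e5 : k₁ * p ^ 2 = κ * p ^ 2 + 2 * n₃ * κ * p ^ 2 + κ ^ 2 * j ^ 2 / b * p ^ 2 := by
    rw [hk₁]; ring
  -- With the remaining quotients opaque, the claim is a linear combination of the inequalities
  -- above.
  clear hn₃ hk₁ hn₁ hc₁ hc₂
  generalize κ ^ 2 * j ^ 2 / b = r₁ at *
  generalize ρ₁ * j ^ 2 / g₀ = r₂ at *
  generalize n₁ ^ 2 * ρ₁ * j ^ 2 / g₀ = r₃ at *
  generalize κ / (2 * (1 - g₀) * g₀) = r₄ at *
  linarith

/-- The multiplier estimate for a state that is smooth in time. -/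
theorem exists_multiplier_bound (J : X →L[ℝ] X) {V : Submodule ℝ X} (hV : IsClosed (V : Set X))
    {g₀ : ℝ} (hρ₁ : 0 < ρ₁) (hρ₂ : 0 < ρ₂) (hb : 0 < b) (hκ : 0 < κ) (hsp : b * ρ₁ = κ * ρ₂)
    (hg₀ : 0 < g₀) (hg₁ : g₀ < 1) :
    ∃ n₁ n₃ m C : ℝ, 0 < n₁ ∧ 0 < n₃ ∧ 0 < m ∧ 0 < C ∧
      ∀ A A' B B' W Wx Wx' P₀ P₀' G₀ Q : X,
        SmoothState J V ρ₁ ρ₂ b κ A A' B B' W Wx Wx' P₀ P₀' G₀ →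
      n₁ * (ρ₁ * (inner ℝ A (J Q) + inner ℝ A' (J G₀)))
      - ρ₁ * (inner ℝ A (J (g₀ • P₀' - Q)) + inner ℝ A' (J (g₀ • P₀ - G₀)))
      - n₃ * (ρ₂ * (inner ℝ B (P₀' - Q) + inner ℝ B' (P₀ - G₀))
          + ρ₂ * (inner ℝ Wx A' + inner ℝ Wx' A))
      + ρ₂ * (inner ℝ B B + inner ℝ B' W)
      ≤ -(m * (‖A‖ ^ 2 + ‖B‖ ^ 2 + ‖Wx‖ ^ 2 + ‖P₀‖ ^ 2))
        + C * (‖g₀ • P₀ - G₀‖ ^ 2 + ‖Q‖ ^ 2) := by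
  obtain ⟨n₁, n₃, m, C, hn₁, hn₃, hm, hC, key⟩ :=
    exists_multiplier_constants (j := ‖J‖) hρ₁ hρ₂ hb hκ hg₀ hg₁
  refine ⟨n₁, n₃, m, C, hn₁, hn₃, hm, hC, fun A A' B B' W Wx Wx' P₀ P₀' G₀ Q S => ?_⟩
  refine le_trans ?_ (key ‖A‖ ‖B‖ ‖Wx‖ ‖P₀‖ ‖g₀ • P₀ - G₀‖ ‖Q‖)
  obtain ⟨M, hM⟩ : ∃ M, M = g₀ • P₀ - G₀ := ⟨_, rfl⟩
  rw [← hM]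
  have hG : G₀ = g₀ • P₀ - M := by rw [hM]; abel
  have hS : P₀ - G₀ = (1 - g₀) • P₀ + M := by rw [hM, sub_smul, one_smul]; abel
  have hMV : M ∈ V := hM ▸ V.sub_mem (V.smul_mem _ S.P_mem) S.G_mem
  have hSn : ‖P₀ - G₀‖ ≤ ‖P₀‖ + ‖M‖ := by
    rw [hS]
    refine (norm_add_le _ _).trans ?_
    rw [norm_smul, Real.norm_of_nonneg (by linarith)]
    linarith [mul_le_of_le_one_left (norm_nonneg P₀) (show 1 - g₀ ≤ 1 by linarith)]
  have hJ : ∀ u v : X, |inner ℝ u (J v)| ≤ ‖J‖ * (‖u‖ * ‖v‖) := by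
    intro u v
    refine (abs_real_inner_le_norm _ _).trans ?_
    calc ‖u‖ * ‖J v‖ ≤ ‖u‖ * (‖J‖ * ‖v‖) := by gcongr; exact J.le_opNorm v
      _ = _ := by ring
  have hPM := abs_real_inner_le_norm P₀ M
  have hPM' : |(1 - 2 * g₀) * inner ℝ P₀ M| ≤ ‖P₀‖ * ‖M‖ := by
    rw [abs_mul]
    have : |1 - 2 * g₀| ≤ 1 := by rw [abs_le]; constructor <;> linarith
    exact (mul_le_mul this hPM (abs_nonneg _) zero_le_one).trans_eq (one_mul _)
  -- Damping of P₀: the stress is (1 - g₀)P₀ + M and G₀ = g₀P₀ - M, so their product contains (1 -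
  -- g₀)g₀ ‖P₀‖².
  have b1 : ρ₁ * (inner ℝ A (J Q) + inner ℝ A' (J G₀))
      ≤ -(κ * (1 - g₀) * g₀ * ‖P₀‖ ^ 2) + κ * (‖P₀‖ * ‖M‖) + κ * ‖M‖ ^ 2
        + ρ₁ * ‖J‖ * (‖A‖ * ‖Q‖) := by
    have h1 := S.eq_φ G₀ S.G_mem
    have h2 : inner ℝ (P₀ - G₀) G₀ = (1 - g₀) * g₀ * ‖P₀‖ ^ 2 - (1 - 2 * g₀) * inner ℝ P₀ M
        - ‖M‖ ^ 2 := by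
      rw [hS, hG]
      simp only [inner_add_left, inner_sub_right, inner_smul_left, inner_smul_right, conj_trivial,
        real_inner_self_eq_norm_sq, real_inner_comm P₀ M]
      ring
    have h3 := le_trans (le_abs_self _) (hJ A Q)
    have h4 := le_trans (le_abs_self _) hPM'
    rw [mul_add, h1, h2]
    linarith [mul_le_mul_of_nonneg_left h3 hρ₁.le, mul_le_mul_of_nonneg_left h4 hκ.le]
  have b2 : -(ρ₁ * (inner ℝ A (J (g₀ • P₀' - Q)) + inner ℝ A' (J M)))
      ≤ κ * (‖P₀‖ * ‖M‖) + κ * ‖M‖ ^ 2 - ρ₁ * g₀ * ‖A‖ ^ 2 + ρ₁ * ‖J‖ * (‖A‖ * ‖B‖)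
        + ρ₁ * ‖J‖ * (‖A‖ * ‖Q‖) := by
    have h1 := S.eq_φ M hMV
    have h2 : inner ℝ (P₀ - G₀) M = (1 - g₀) * inner ℝ P₀ M + ‖M‖ ^ 2 := by
      rw [hS, inner_add_left, inner_smul_left, real_inner_self_eq_norm_sq, conj_trivial]
    -- P₀' itself admits no bound, but its primitive is A + J B; this turns the pairing with A into
    -- the damping -ρ₁g₀ ‖A‖².
    have hJP : J P₀' = A + J B := by rw [← S.disp, map_sub]; abel
    have h3 : inner ℝ A (J (g₀ • P₀' - Q))
        = g₀ * ‖A‖ ^ 2 + g₀ * inner ℝ A (J B) - inner ℝ A (J Q) := by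
      rw [map_sub, map_smul, hJP, inner_sub_right, inner_smul_right, inner_add_right,
        real_inner_self_eq_norm_sq]
      ring
    have h4 := le_trans (le_abs_self _) (hJ A Q)
    have h5 : -(g₀ * inner ℝ A (J B)) ≤ ‖J‖ * (‖A‖ * ‖B‖) := by
      have h0 : 0 ≤ ‖J‖ * (‖A‖ * ‖B‖) := by positivity
      have := mul_le_mul_of_nonneg_left (abs_le.1 (hJ A B)).1 hg₀.le
      linarith [mul_le_of_le_one_left h0 hg₁.le]
    have h6 : (1 - g₀) * inner ℝ P₀ M ≤ ‖P₀‖ * ‖M‖ := by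
      have h0 : 0 ≤ ‖P₀‖ * ‖M‖ := by positivity
      have := mul_le_mul_of_nonneg_left (abs_le.1 hPM).2 (show 0 ≤ 1 - g₀ by linarith)
      linarith [mul_le_of_le_one_left h0 (show 1 - g₀ ≤ 1 by linarith)]
    have h7 : ρ₁ * inner ℝ A' (J M) = -(κ * ((1 - g₀) * inner ℝ P₀ M + ‖M‖ ^ 2)) := by
      rw [h1, h2]
    rw [mul_add, h7, h3]
    linarith [mul_le_mul_of_nonneg_left h4 hρ₁.le, mul_le_mul_of_nonneg_left h5 hρ₁.le,
      mul_le_mul_of_nonneg_left h6 hκ.le]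
  have b3 : -(ρ₂ * (inner ℝ B (P₀' - Q) + inner ℝ B' (P₀ - G₀))
          + ρ₂ * (inner ℝ Wx A' + inner ℝ Wx' A))
      ≤ κ * (‖P₀‖ + ‖M‖) ^ 2 - ρ₂ * ‖B‖ ^ 2 + ρ₂ * (‖B‖ * ‖Q‖) := by
    have h1 := S.shear_deriv hV hκ hsp Q
    have h2 : ‖P₀ - G₀‖ ^ 2 ≤ (‖P₀‖ + ‖M‖) ^ 2 := by gcongr
    have h3 := real_inner_le_norm B Q
    linarith [mul_le_mul_of_nonneg_left h2 hκ.le, mul_le_mul_of_nonneg_left h3 hρ₂.le]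
  -- Testing the ψ equation with ψ itself damps Wx. The price ρ₂ ‖B‖² is covered by a large multiple
  -- of the shear estimate.
  have b4 : ρ₂ * (inner ℝ B B + inner ℝ B' W)
      ≤ -(b * ‖Wx‖ ^ 2) + κ * ((‖P₀‖ + ‖M‖) * (‖J‖ * ‖Wx‖)) + ρ₂ * ‖B‖ ^ 2 := by
    have h1 := S.eq_ψ W S.W_mem Wx S.weak
    have h2 : -inner ℝ (P₀ - G₀) W ≤ (‖P₀‖ + ‖M‖) * (‖J‖ * ‖Wx‖) := by
      rw [← inner_neg_left]
      refine (real_inner_le_norm _ _).trans ?_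
      rw [norm_neg]
      exact mul_le_mul hSn (norm_le_of_weak S.W_mem S.weak) (norm_nonneg _) (by positivity)
    rw [mul_add, h1, real_inner_self_eq_norm_sq, real_inner_self_eq_norm_sq]
    linarith [mul_le_mul_of_nonneg_left h2 hκ.le]
  have b1' := mul_le_mul_of_nonneg_left b1 hn₁.le
  have b3' := mul_le_mul_of_nonneg_left b3 hn₃.le
  linarith

end Multiplier

/-! ### Time derivatives of the averaged functionals -/

section Derivatives

variable {X : Type*} [NormedAddCommGroup X] [InnerProductSpace ℝ X] [CompleteSpace X]
  {J : X →L[ℝ] X} {V : Submodule ℝ X} {g : ℝ → ℝ} {ρ₁ ρ₂ b κ : ℝ} {P φt ψ ψx ψt : ℝ → X}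

theorem AbstractSolution.hasDerivAt_elasticEnergy
    (U : AbstractSolution J V g ρ₁ ρ₂ b κ P φt ψ ψx ψt) {h t : ℝ} (hh : 0 < h) (ht : 0 < t) :
    HasDerivAt (fun t => elasticEnergy ρ₁ ρ₂ b κ (steklov h φt t) (steklov h ψt t)
        (steklov h ψx t) (steklov h P t) (steklov h (memory g P) t))
      (-(κ * inner ℝ (diffQuot h (memory g P) t) (steklov h P t))) t := by
  have dA := hasDerivAt_steklov U.φt_cont hh.le ht
  have dB := hasDerivAt_steklov U.ψt_cont hh.le ht
  have dX := hasDerivAt_steklov U.ψx_cont hh.le ht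
  have dP := hasDerivAt_steklov U.sq.cont hh.le ht
  have dG := hasDerivAt_steklov U.continuousOn_memory hh.le ht
  have key := (U.smoothState hh ht).elastic_deriv
  have := (((((dA.norm_sq.const_mul ρ₁).add (dB.norm_sq.const_mul ρ₂)).add
    (dX.norm_sq.const_mul b)).add (dP.norm_sq.const_mul κ)).const_mul (1 / 2)).sub
    ((dG.inner ℝ dP).const_mul κ)
  refine this.congr_deriv ?_
  linarith

theorem AbstractSolution.hasDerivAt_multiplier
    (U : AbstractSolution J V g ρ₁ ρ₂ b κ P φt ψ ψx ψt) {h t : ℝ} (hh : 0 < h) (ht : 0 < t)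
    (g₀ n₁ n₃ : ℝ) :
    HasDerivAt (fun t => multiplier J ρ₁ ρ₂ g₀ n₁ n₃ (steklov h φt t) (steklov h ψt t)
        (steklov h ψ t) (steklov h ψx t) (steklov h P t) (steklov h (memory g P) t))
      (n₁ * (ρ₁ * (inner ℝ (steklov h φt t) (J (diffQuot h (memory g P) t))
          + inner ℝ (diffQuot h φt t) (J (steklov h (memory g P) t))))
      - ρ₁ * (inner ℝ (steklov h φt t) (J (g₀ • diffQuot h P t - diffQuot h (memory g P) t))
          + inner ℝ (diffQuot h φt t) (J (g₀ • steklov h P t - steklov h (memory g P) t)))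
      - n₃ * (ρ₂ * (inner ℝ (steklov h ψt t) (diffQuot h P t - diffQuot h (memory g P) t)
            + inner ℝ (diffQuot h ψt t) (steklov h P t - steklov h (memory g P) t))
          + ρ₂ * (inner ℝ (steklov h ψx t) (diffQuot h φt t)
            + inner ℝ (diffQuot h ψx t) (steklov h φt t)))
      + ρ₂ * (inner ℝ (steklov h ψt t) (steklov h ψt t)
          + inner ℝ (diffQuot h ψt t) (steklov h ψ t))) t := by
  have dA := hasDerivAt_steklov U.φt_cont hh.le ht
  have dB := hasDerivAt_steklov U.ψt_cont hh.le ht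
  have dW := hasDerivAt_steklov U.ψ_cont hh.le ht
  rw [steklov_eq_diffQuot U.ψ_deriv U.ψt_cont hh.le ht.le] at dW
  have dX := hasDerivAt_steklov U.ψx_cont hh.le ht
  have dP := hasDerivAt_steklov U.sq.cont hh.le ht
  have dG := hasDerivAt_steklov U.continuousOn_memory hh.le ht
  have dJ : ∀ {u : ℝ → X} {u' : X}, HasDerivAt u u' t → HasDerivAt (fun t => J (u t)) (J u') t :=
    fun h => J.hasFDerivAt.comp_hasDerivAt t h
  exact ((((dA.inner ℝ (dJ dG)).const_mul ρ₁).const_mul n₁).sub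
    ((dA.inner ℝ (dJ ((dP.const_smul g₀).sub dG))).const_mul ρ₁)).sub
    ((((dB.inner ℝ (dP.sub dG)).const_mul ρ₂).add ((dX.inner ℝ dA).const_mul ρ₂)).const_mul n₃)
    |>.add ((dB.inner ℝ dW).const_mul ρ₂)

end Derivatives

/-! ### Averaging errors, uniform on bounded time intervals -/

section Increment

variable {X : Type*} [NormedAddCommGroup X] [NormedSpace ℝ X] {f : ℝ → X} {g : ℝ → ℝ} {h t ε : ℝ}

theorem exists_uniform_increment (hf : ContinuousOn f (Ici 0)) (T : ℝ) (hε : 0 < ε) :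
    ∃ δ, 0 < δ ∧ ∀ h, h ≤ δ → ∀ t ∈ Icc 0 T, ∀ s ∈ Icc 0 h, ‖f (t + s) - f t‖ ≤ ε := by
  have hu : UniformContinuousOn f (Icc 0 (T + 1)) :=
    isCompact_Icc.uniformContinuousOn_of_continuous (hf.mono fun x hx => hx.1)
  obtain ⟨δ, hδ, H⟩ := Metric.uniformContinuousOn_iff_le.1 hu ε hε
  refine ⟨min δ 1, by positivity, fun h hh t ht s hs => ?_⟩
  have h1 : s ≤ δ := hs.2.trans (hh.trans (min_le_left _ _))
  have h2 : s ≤ 1 := hs.2.trans (hh.trans (min_le_right _ _))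
  have := H (t + s) ⟨by linarith [ht.1, hs.1], by linarith [ht.2]⟩ t ⟨ht.1, by linarith [ht.2]⟩
    (by rw [Real.dist_eq, add_sub_cancel_left, abs_of_nonneg hs.1]; exact h1)
  rwa [dist_eq_norm] at this

theorem norm_steklov_sub_le [CompleteSpace X] (hf : ContinuousOn f (Ici 0)) (hh : 0 < h)
    (ht : 0 ≤ t) (hinc : ∀ s ∈ Icc 0 h, ‖f (t + s) - f t‖ ≤ ε) :
    ‖steklov h f t - f t‖ ≤ ε := by
  have h1 : steklov h f t - f t = h⁻¹ • ∫ s in t..t + h, (f s - f t) := by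
    rw [intervalIntegral.integral_sub (hf.intervalIntegrable_Ici ht (by linarith))
      intervalIntegrable_const, intervalIntegral.integral_const, add_sub_cancel_left, smul_sub,
      smul_smul, inv_mul_cancel₀ hh.ne', one_smul, steklov]
  have h2 : ‖∫ s in t..t + h, (f s - f t)‖ ≤ ε * |t + h - t| := by
    refine intervalIntegral.norm_integral_le_of_norm_le_const (fun s hs => ?_)
    rw [uIoc_of_le (by linarith)] at hs
    have := hinc (s - t) ⟨by linarith [hs.1], by linarith [hs.2]⟩
    rwa [add_sub_cancel] at this
  rw [add_sub_cancel_left, abs_of_pos hh] at h2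
  rw [h1, norm_smul, norm_inv, Real.norm_of_nonneg hh.le, inv_mul_le_iff₀ hh]
  linarith

theorem norm_weighted_increment_le [CompleteSpace X] (hg : IsKernel g)
    (hf : ContinuousOn f (Ici 0)) (hh : 0 < h) (ht : 0 ≤ t)
    (hinc : ∀ s ∈ Icc 0 h, ‖f (t + s) - f t‖ ≤ ε) :
    ‖h⁻¹ • (∫ s in (0 : ℝ)..h, g s • f (t + h - s)) - (h⁻¹ * ∫ s in (0 : ℝ)..h, g s) • f t‖
      ≤ g 0 * ε := by
  have hgi := hg.cont.intervalIntegrable_Ici le_rfl hh.le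
  have hfi : IntervalIntegrable (fun s => g s • f (t + h - s)) volume 0 h := by
    refine ContinuousOn.intervalIntegrable ?_
    rw [uIcc_of_le hh.le]
    refine (hg.cont.mono (fun s hs => hs.1)).smul (hf.comp (by fun_prop) ?_)
    intro s hs
    rw [mem_Ici]
    linarith [hs.2]
  have h1 : h⁻¹ • (∫ s in (0 : ℝ)..h, g s • f (t + h - s)) - (h⁻¹ * ∫ s in (0 : ℝ)..h, g s) • f t
      = h⁻¹ • ∫ s in (0 : ℝ)..h, g s • (f (t + h - s) - f t) := by
    simp only [smul_sub]
    rw [intervalIntegral.integral_sub hfi, intervalIntegral.integral_smul_const, smul_sub,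
      smul_smul]
    exact ⟨hgi.1.smul_const _, hgi.2.smul_const _⟩
  have h2 : ‖∫ s in (0 : ℝ)..h, g s • (f (t + h - s) - f t)‖ ≤ g 0 * ε * |h - 0| := by
    refine intervalIntegral.norm_integral_le_of_norm_le_const (fun s hs => ?_)
    rw [uIoc_of_le hh.le] at hs
    have := hinc (h - s) ⟨by linarith [hs.2], by linarith [hs.1]⟩
    rw [norm_smul, Real.norm_of_nonneg (hg.pos s hs.1.le).le, add_sub_assoc]
    exact mul_le_mul (hg.le_zero hs.1.le) this (norm_nonneg _) (hg.pos 0 le_rfl).le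
  rw [sub_zero, abs_of_pos hh] at h2
  rw [h1, norm_smul, norm_inv, Real.norm_of_nonneg hh.le, inv_mul_le_iff₀ hh]
  linarith

end Increment

/-- A kernel `k` that is dominated by `-g'`, in terms of the increments of `g`. -/
structure DissipationKernel (g k : ℝ → ℝ) (C : ℝ) : Prop where
  sub : SubKernel g k C
  pos : ∀ s, 0 ≤ s → 0 < k s
  anti : AntitoneOn k (Ici 0)
  le : ∀ s h, 0 ≤ s → 0 < h → h * k (s + h) ≤ g s - g (s + h)

/-- The difference quotient of `-g`. -/
def kernelQuot (g : ℝ → ℝ) (h s : ℝ) : ℝ := h⁻¹ * (g s - g (s + h))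

/-! ### Dissipation in terms of difference quotients of the kernel -/

section Quot

variable {X : Type*} [NormedAddCommGroup X] [InnerProductSpace ℝ X] [CompleteSpace X]
  {g k : ℝ → ℝ} {h t ε : ℝ} {P : ℝ → X} {C : ℝ}

theorem IsKernel.exists_subKernel_quot (hg : IsKernel g) (hh : 0 < h) :
    ∃ C, SubKernel g (kernelQuot g h) C :=
  ⟨_, (hg.subKernel.sub (hg.subKernel.shift hg hh.le)).const_mul h⁻¹⟩

theorem IsKernel.kernelQuot_nonneg (hg : IsKernel g) (hh : 0 < h) {s : ℝ} (hs : 0 ≤ s) :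
    0 ≤ kernelQuot g h s :=
  mul_nonneg (inv_nonneg.2 hh.le) (sub_nonneg.2 (hg.anti hs (mem_Ici.2 (by linarith)) (by linarith)))

theorem IsKernel.integral_kernelQuot (hg : IsKernel g) (hh : 0 < h) :
    ∫ s in Ioi (0 : ℝ), kernelQuot g h s = h⁻¹ * ∫ s in (0 : ℝ)..h, g s := by
  simp only [kernelQuot]
  rw [integral_const_mul, hg.integral_sub_shift hh.le]

theorem IsKernel.integral_kernelQuot_le (hg : IsKernel g) (hh : 0 < h) :
    ∫ s in Ioi (0 : ℝ), kernelQuot g h s ≤ g 0 := by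
  rw [hg.integral_kernelQuot hh, inv_mul_le_iff₀ hh]
  have := intervalIntegral.integral_mono_on hh.le (hg.cont.intervalIntegrable_Ici le_rfl hh.le)
    (intervalIntegrable_const (c := g 0)) (fun s hs => hg.le_zero hs.1)
  simpa using this

/-- The difference quotient falls on the kernel, so f need not be differentiable. Formally this is
g(0) f(t) + ∫ g'(s) f(t-s) ds. -/
theorem HasMemory.diffQuot_memory {Y : Type*} [NormedAddCommGroup Y] [NormedSpace ℝ Y] {f : ℝ → Y}
    (hg : IsKernel g) (hf : HasMemory g f) (hh : 0 < h) (ht : 0 ≤ t) :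
    diffQuot h (memory g f) t = h⁻¹ • (∫ s in (0 : ℝ)..h, g s • f (t + h - s))
      - memory (kernelQuot g h) f t := by
  rw [diffQuot, hf.memory_add_sub hg ht hh.le, smul_sub]
  congr 1
  simp only [memory, kernelQuot, mul_smul]
  rw [integral_smul]

/-- The deviation integral `∫ k(s) (P(t) - P(t - s)) ds` in terms of `k * P`. -/
theorem HasSqMemory.norm_sq_sub_memory_le (hg : IsKernel g) (hk : SubKernel g k C)
    (hk0 : ∀ s, 0 ≤ s → 0 ≤ k s) (hP : HasSqMemory g P) (ht : 0 ≤ t) :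
    ‖(∫ s in Ioi (0 : ℝ), k s) • P t - memory k P t‖ ^ 2
      ≤ (∫ s in Ioi (0 : ℝ), k s) * deviation k P t := by
  have h1 : (∫ s in Ioi (0 : ℝ), k s) • P t - memory k P t
      = ∫ s in Ioi (0 : ℝ), k s • (P t - P (t - s)) := by
    simp only [smul_sub]
    rw [integral_sub ((hk.integrableOn hg).smul_const _) ((hP.hasMemory hg).integrableOn hg hk ht),
      integral_smul_const, memory]
  rw [h1]
  exact norm_sq_setIntegral_smul_le measurableSet_Ioi (fun s hs => hk0 s (le_of_lt hs))
    (hk.integrableOn hg) (hP.integrableOn_deviation hg hk ht)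

theorem HasSqMemory.deviation_mono {k' : ℝ → ℝ} {C' : ℝ} (hg : IsKernel g) (hk : SubKernel g k C)
    (hk' : SubKernel g k' C') (hle : ∀ s, 0 ≤ s → k s ≤ k' s) (hP : HasSqMemory g P)
    (ht : 0 ≤ t) : deviation k P t ≤ deviation k' P t := by
  refine setIntegral_mono_on (hP.integrableOn_deviation hg hk ht)
    (hP.integrableOn_deviation hg hk' ht) measurableSet_Ioi (fun s hs => ?_)
  exact mul_le_mul_of_nonneg_right (hle s (le_of_lt hs)) (by positivity)

theorem deviation_nonneg (hk0 : ∀ s, 0 ≤ s → 0 ≤ k s) : 0 ≤ deviation k P t :=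
  setIntegral_nonneg measurableSet_Ioi fun s hs =>
    mul_nonneg (hk0 s (le_of_lt hs)) (by positivity)

/-- The increments of the memory term, up to the dissipation. -/
theorem HasSqMemory.norm_sq_diffQuot_memory_le (hg : IsKernel g) (hP : HasSqMemory g P)
    (hh : 0 < h) (ht : 0 ≤ t) (hinc : ∀ s ∈ Icc 0 h, ‖P (t + s) - P t‖ ≤ ε) :
    ‖diffQuot h (memory g P) t‖ ^ 2
      ≤ 2 * (g 0 * ε) ^ 2 + 2 * (g 0 * deviation (kernelQuot g h) P t) := by
  obtain ⟨C, hk⟩ := hg.exists_subKernel_quot hh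
  have hk0 := fun s (hs : 0 ≤ s) => hg.kernelQuot_nonneg hh hs
  have h1 := norm_weighted_increment_le hg hP.cont hh ht hinc
  have h2 := hP.norm_sq_sub_memory_le hg hk hk0 ht
  rw [hg.integral_kernelQuot hh] at h2
  have h3 : (h⁻¹ * ∫ s in (0 : ℝ)..h, g s) * deviation (kernelQuot g h) P t
      ≤ g 0 * deviation (kernelQuot g h) P t := by
    rw [← hg.integral_kernelQuot hh]
    exact mul_le_mul_of_nonneg_right (hg.integral_kernelQuot_le hh) (deviation_nonneg hk0)
  rw [(hP.hasMemory hg).diffQuot_memory hg hh ht]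
  set R := h⁻¹ • (∫ s in (0 : ℝ)..h, g s • P (t + h - s)) with hR
  set Γ := (h⁻¹ * ∫ s in (0 : ℝ)..h, g s) • P t with hΓ
  have h4 : ‖R - memory (kernelQuot g h) P t‖ ≤ ‖R - Γ‖ + ‖Γ - memory (kernelQuot g h) P t‖ := by
    refine le_trans (le_of_eq ?_) (norm_add_le _ _)
    congr 1; abel
  have h5 : ‖R - Γ‖ ^ 2 ≤ (g 0 * ε) ^ 2 := by gcongr
  have h6 : ‖R - memory (kernelQuot g h) P t‖ ^ 2
      ≤ (‖R - Γ‖ + ‖Γ - memory (kernelQuot g h) P t‖) ^ 2 := by gcongr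
  linarith [sq_nonneg (‖R - Γ‖ - ‖Γ - memory (kernelQuot g h) P t‖),
    sub_sq ‖R - Γ‖ ‖Γ - memory (kernelQuot g h) P t‖,
    add_sq ‖R - Γ‖ ‖Γ - memory (kernelQuot g h) P t‖]

/-- The power of the memory term. -/
theorem HasSqMemory.memory_power_le (hg : IsKernel g) (hP : HasSqMemory g P) {B : ℝ} {P' : X}
    (hh : 0 < h) (ht : 0 ≤ t) (hinc : ∀ s ∈ Icc 0 h, ‖P (t + s) - P t‖ ≤ ε)
    (hinc' : ∀ s ∈ Icc 0 h, ‖‖P (t + s)‖ ^ 2 - ‖P t‖ ^ 2‖ ≤ ε) (hP' : ‖P' - P t‖ ≤ ε)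
    (hB : ‖P'‖ ≤ B) :
    -inner ℝ (diffQuot h (memory g P) t) P' + diffQuot h (memory g (fun t => ‖P t‖ ^ 2)) t / 2
      ≤ -(deviation (kernelQuot g h) P t / 4) + g 0 * (ε ^ 2 + ε * B + ε / 2) := by
  obtain ⟨C, hk⟩ := hg.exists_subKernel_quot hh
  have hk0 := fun s (hs : 0 ≤ s) => hg.kernelQuot_nonneg hh hs
  have hg0 := hg.pos 0 le_rfl
  have h1 := norm_weighted_increment_le hg hP.cont hh ht hinc
  have h1' := norm_weighted_increment_le (f := fun t => ‖P t‖ ^ 2) hg (hP.cont.norm.pow 2) hh ht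
    hinc'
  have h2 := hP.norm_sq_sub_memory_le hg hk hk0 ht
  have h7 := hP.deviation_eq hg hk ht
  have hz : 0 ≤ deviation (kernelQuot g h) P t := deviation_nonneg hk0
  have h3 := mul_le_mul_of_nonneg_right (hg.integral_kernelQuot_le hh) hz
  rw [hg.integral_kernelQuot hh] at h2 h3 h7
  rw [(hP.hasMemory hg).diffQuot_memory hg hh ht, hP.hasMemory_sq.diffQuot_memory hg hh ht]
  obtain ⟨R, hR⟩ : ∃ R, R = h⁻¹ • (∫ s in (0 : ℝ)..h, g s • P (t + h - s)) := ⟨_, rfl⟩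
  obtain ⟨a, ha⟩ : ∃ a, a = h⁻¹ • (∫ s in (0 : ℝ)..h, g s • ‖P (t + h - s)‖ ^ 2) := ⟨_, rfl⟩
  obtain ⟨γ, hγ⟩ : ∃ γ, γ = h⁻¹ * ∫ s in (0 : ℝ)..h, g s := ⟨_, rfl⟩
  obtain ⟨M, hM⟩ : ∃ M, M = memory (kernelQuot g h) P t := ⟨_, rfl⟩
  obtain ⟨m, hm⟩ : ∃ m, m = memory (kernelQuot g h) (fun t => ‖P t‖ ^ 2) t := ⟨_, rfl⟩
  obtain ⟨z, hzd⟩ : ∃ z, z = deviation (kernelQuot g h) P t := ⟨_, rfl⟩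
  rw [← hγ, ← hR] at h1
  rw [← hγ, ← ha] at h1'
  rw [← hγ, ← hM, ← hzd] at h2
  rw [← hγ, ← hM, ← hm, ← hzd] at h7
  rw [← hγ, ← hzd] at h3
  rw [← hzd] at hz
  rw [← hR, ← ha, ← hM, ← hm, ← hzd]
  -- Once R and a are replaced by γ P(t) and γ ‖P(t)‖², the exact terms add up to -z/2 by the
  -- expansion of the deviation. What remains are errors of averaging.
  have e1 : inner ℝ (R - M) P' = inner ℝ (R - γ • P t) P' + inner ℝ (γ • P t - M) (P' - P t)
      + γ * ‖P t‖ ^ 2 - inner ℝ (P t) M := by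
    simp only [inner_sub_left, inner_sub_right, inner_smul_left, conj_trivial,
      real_inner_self_eq_norm_sq, real_inner_comm (P t) M]
    ring
  have b1 : -inner ℝ (R - γ • P t) P' ≤ g 0 * (ε * B) := by
    have := neg_le_of_abs_le ((abs_real_inner_le_norm (R - γ • P t) P').trans
      (mul_le_mul h1 hB (norm_nonneg _) ((norm_nonneg _).trans h1)))
    linarith
  have b2 : -inner ℝ (γ • P t - M) (P' - P t) ≤ z / 4 + g 0 * ε ^ 2 := by
    have i1 := (abs_real_inner_le_norm (γ • P t - M) (P' - P t))
    have i2 := neg_le_of_abs_le i1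
    have i3 : ‖γ • P t - M‖ * ‖P' - P t‖ ≤ ‖γ • P t - M‖ * ε := by gcongr
    -- Since ‖γ P(t) - M‖² ≤ g(0) z, the error of replacing P' by P(t) can be paid for with half of
    -- the available z/2. Hence the factor 1/4 in the result.
    have i4 : ‖γ • P t - M‖ * ε ≤ z / 4 + g 0 * ε ^ 2 := by
      have i5 : ‖γ • P t - M‖ ^ 2 ≤ g 0 * z := h2.trans h3
      have i6 : 0 ≤ (‖γ • P t - M‖ - 2 * g 0 * ε) ^ 2 := sq_nonneg _
      have i7 : g 0 * (‖γ • P t - M‖ * ε) ≤ g 0 * (z / 4 + g 0 * ε ^ 2) := by linarith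
      exact le_of_mul_le_mul_left i7 hg0
    linarith
  have b3 : a - γ * ‖P t‖ ^ 2 ≤ g 0 * ε := (le_abs_self _).trans h1'
  rw [e1]
  linarith

end Quot

/-- The energy of an abstract solution. -/
def abstractEnergy {X : Type*} [NormedAddCommGroup X] (g : ℝ → ℝ) (ρ₁ ρ₂ b κ : ℝ)
    (P φt ψx ψt : ℝ → X) (t : ℝ) : ℝ :=
  ρ₁ / 2 * ‖φt t‖ ^ 2 + ρ₂ / 2 * ‖ψt t‖ ^ 2 + b / 2 * ‖ψx t‖ ^ 2
    + κ / 2 * (1 - ∫ s in Ioi (0 : ℝ), g s) * ‖P t‖ ^ 2 + κ / 2 * deviation g P t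

/-! ### Removing the averages: integrated energy and multiplier inequalities -/

section Limits

variable {X : Type*} [NormedAddCommGroup X] [InnerProductSpace ℝ X] [CompleteSpace X]
  {J : X →L[ℝ] X} {V : Submodule ℝ X} {g k : ℝ → ℝ} {ρ₁ ρ₂ b κ C : ℝ} {P φt ψ ψx ψt : ℝ → X}

theorem exists_norm_le_of_continuousOn {Y : Type*} [NormedAddCommGroup Y] {f : ℝ → Y}
    (hf : ContinuousOn f (Ici 0)) (T : ℝ) : ∃ B, 0 ≤ B ∧ ∀ s ∈ Icc 0 T, ‖f s‖ ≤ B := by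
  obtain ⟨B, hB⟩ := isCompact_Icc.exists_bound_of_continuousOn
    (hf.mono (fun x (hx : x ∈ Icc 0 T) => hx.1))
  exact ⟨max B 0, le_max_right _ _, fun s hs => (hB s hs).trans (le_max_left _ _)⟩

/-- In this form the memory enters only through g∗P and g∗‖P‖², whose averages can be differentiated
in time. -/
theorem AbstractSolution.energy_eq (U : AbstractSolution J V g ρ₁ ρ₂ b κ P φt ψ ψx ψt) {t : ℝ}
    (ht : 0 ≤ t) : abstractEnergy g ρ₁ ρ₂ b κ P φt ψx ψt t
      = elasticEnergy ρ₁ ρ₂ b κ (φt t) (ψt t) (ψx t) (P t) (memory g P t)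
        + κ / 2 * memory g (fun t => ‖P t‖ ^ 2) t := by
  rw [abstractEnergy, elasticEnergy, U.sq.deviation_eq U.kernel U.kernel.subKernel ht,
    real_inner_comm (P t)]
  ring

theorem AbstractSolution.continuousOn_energy (U : AbstractSolution J V g ρ₁ ρ₂ b κ P φt ψ ψx ψt) :
    ContinuousOn (abstractEnergy g ρ₁ ρ₂ b κ P φt ψx ψt) (Ici 0) := by
  have h1 := U.φt_cont
  have h2 := U.ψt_cont
  have h3 := U.ψx_cont
  have h4 := U.sq.cont
  have h5 := U.sq.continuousOn_deviation U.kernel U.kernel.subKernel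
  unfold abstractEnergy
  fun_prop

/-- The estimates for the averaged solution hold up to small errors. -/
theorem AbstractSolution.exists_small_step (U : AbstractSolution J V g ρ₁ ρ₂ b κ P φt ψ ψx ψt)
    (T : ℝ) {ε : ℝ} (hε : 0 < ε) : ∃ δ, 0 < δ ∧ ∀ h, 0 < h → h ≤ δ → ∀ t, 0 < t → t ≤ T →
      -(κ * inner ℝ (diffQuot h (memory g P) t) (steklov h P t))
          + κ / 2 * diffQuot h (memory g (fun t => ‖P t‖ ^ 2)) t
        ≤ -(κ / 4 * deviation (kernelQuot g h) P t) + ε ∧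
      ‖diffQuot h (memory g P) t‖ ^ 2 ≤ ε + 2 * g 0 * deviation (kernelQuot g h) P t := by
  have hκ := U.κ_pos
  have hg0 := U.kernel.pos 0 le_rfl
  obtain ⟨B, hB0, hB⟩ := exists_norm_le_of_continuousOn U.sq.cont (T + 1)
  -- For increments at most η ≤ 1 we have η² ≤ η, so both errors are bounded by D η.
  obtain ⟨D, hD0, hD⟩ : ∃ D, 0 < D ∧ D = κ * g 0 * (1 + B + 1 / 2) + 2 * g 0 ^ 2 :=
    ⟨_, by positivity, rfl⟩
  obtain ⟨η, hη, hη1, hηD⟩ : ∃ η, 0 < η ∧ η ≤ 1 ∧ η * D ≤ ε :=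
    ⟨min 1 (ε / D), by positivity, min_le_left _ _, by
      have := min_le_right 1 (ε / D)
      rwa [le_div_iff₀ hD0] at this⟩
  obtain ⟨δ₁, hδ₁, H₁⟩ := exists_uniform_increment U.sq.cont T hη
  obtain ⟨δ₂, hδ₂, H₂⟩ := exists_uniform_increment (f := fun t => ‖P t‖ ^ 2)
    (U.sq.cont.norm.pow 2) T hη
  refine ⟨min (min δ₁ δ₂) 1, by positivity, fun h hh hhδ t ht htT => ?_⟩
  have hd1 : h ≤ δ₁ := hhδ.trans ((min_le_left _ _).trans (min_le_left _ _))
  have hd2 : h ≤ δ₂ := hhδ.trans ((min_le_left _ _).trans (min_le_right _ _))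
  have hd3 : h ≤ 1 := hhδ.trans (min_le_right _ _)
  have i1 := H₁ h hd1 t ⟨ht.le, htT⟩
  have i2 := H₂ h hd2 t ⟨ht.le, htT⟩
  have k1 := U.sq.memory_power_le U.kernel hh ht.le i1 i2
    (norm_steklov_sub_le U.sq.cont hh ht.le i1) (norm_steklov_le hB hh hd3 ⟨ht.le, htT⟩)
  have k2 := U.sq.norm_sq_diffQuot_memory_le U.kernel hh ht.le i1
  have hηsq : η ^ 2 ≤ η := by rw [pow_two]; exact mul_le_of_le_one_left hη.le hη1
  have s1 : g 0 ^ 2 * η ^ 2 ≤ g 0 ^ 2 * η := by gcongr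
  have s2 : κ * g 0 * η ^ 2 ≤ κ * g 0 * η := by gcongr
  have s3 : 0 ≤ g 0 ^ 2 * η := by positivity
  have s4 : 0 ≤ κ * g 0 * (1 + B + 1 / 2) * η := by positivity
  rw [hD] at hηD
  constructor
  · have := mul_le_mul_of_nonneg_left k1 hκ.le
    linarith
  · rw [mul_pow] at k2
    linarith

/-- This is why k replaces -g': the shifted kernel lies below the difference quotient pointwise, so
no regularity of g' is needed to pass to the limit. -/
theorem DissipationKernel.deviation_shift_le (hg : IsKernel g) (hk : DissipationKernel g k C)
    (hP : HasSqMemory g P) {h t : ℝ} (hh : 0 < h) (ht : 0 ≤ t) :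
    deviation (fun s => k (s + h)) P t ≤ deviation (kernelQuot g h) P t := by
  obtain ⟨C', hk'⟩ := hg.exists_subKernel_quot hh
  refine hP.deviation_mono hg (hk.sub.shift hg hh.le) hk' (fun s hs => ?_) ht
  rw [kernelQuot, ← div_eq_inv_mul, le_div_iff₀ hh, mul_comm]
  exact hk.le s h hs hh

/-- As k is non-increasing, it dominates all of its own forward shifts. -/
theorem DissipationKernel.tendsto_deviation (hg : IsKernel g) (hk : DissipationKernel g k C)
    (hP : HasSqMemory g P) {t : ℝ} (ht : 0 ≤ t) :
    Tendsto (fun h => deviation (fun s => k (s + h)) P t) (𝓝[>] 0) (𝓝 (deviation k P t)) := by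
  refine tendsto_integral_filter_of_dominated_convergence
    (fun s => k s * ‖P t - P (t - s)‖ ^ 2) ?_ ?_ (hP.integrableOn_deviation hg hk.sub ht) ?_
  · filter_upwards [self_mem_nhdsWithin] with h hh
    exact (hP.integrableOn_deviation hg (hk.sub.shift hg (le_of_lt hh)) ht).aestronglyMeasurable
  · filter_upwards [self_mem_nhdsWithin] with h hh
    filter_upwards [ae_restrict_mem measurableSet_Ioi] with s hs
    have hh' : 0 < h := hh
    have hs' : 0 < s := hs
    have hk1 := hk.pos (s + h) (by linarith)
    rw [Real.norm_of_nonneg (by positivity)]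
    exact mul_le_mul_of_nonneg_right (hk.anti (mem_Ici.2 hs'.le) (mem_Ici.2 (by linarith))
      (by linarith)) (by positivity)
  · filter_upwards [ae_restrict_mem measurableSet_Ioi] with s hs
    refine Tendsto.mul_const _ ?_
    have hc : ContinuousAt k s := hk.sub.cont.continuousAt (Ici_mem_nhds hs)
    have : Tendsto (fun h : ℝ => s + h) (𝓝[>] 0) (𝓝 s) := by
      have : Tendsto (fun h : ℝ => s + h) (𝓝 0) (𝓝 (s + 0)) :=
        (continuous_const.add continuous_id).tendsto 0
      rw [add_zero] at this
      exact this.mono_left nhdsWithin_le_nhds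
    exact hc.tendsto.comp this

theorem DissipationKernel.continuousOn_deviation_shift (hg : IsKernel g)
    (hk : DissipationKernel g k C) (hP : HasSqMemory g P) {h : ℝ} (hh : 0 ≤ h) :
    ContinuousOn (deviation (fun s => k (s + h)) P) (Ici 0) :=
  hP.continuousOn_deviation hg (hk.sub.shift hg hh)

theorem DissipationKernel.tendsto_integral_deviation (hg : IsKernel g)
    (hk : DissipationKernel g k C) (hP : HasSqMemory g P) {x y : ℝ} (hx : 0 ≤ x) (hxy : x ≤ y) :
    Tendsto (fun h => ∫ t in x..y, deviation (fun s => k (s + h)) P t) (𝓝[>] 0)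
      (𝓝 (∫ t in x..y, deviation k P t)) := by
  have hk0 := fun s (hs : 0 ≤ s) => (hk.pos s hs).le
  refine intervalIntegral.tendsto_integral_filter_of_dominated_convergence (deviation k P) ?_ ?_
    ((hP.continuousOn_deviation hg hk.sub).intervalIntegrable_Ici hx (hx.trans hxy)) ?_
  · filter_upwards [self_mem_nhdsWithin] with h hh
    exact (intervalIntegrable_iff.1 ((hk.continuousOn_deviation_shift hg hP
      (le_of_lt hh)).intervalIntegrable_Ici hx (hx.trans hxy))).aestronglyMeasurable
  · filter_upwards [self_mem_nhdsWithin] with h hh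
    refine Eventually.of_forall fun t ht => ?_
    rw [uIoc_of_le hxy] at ht
    have hh' : 0 < h := hh
    rw [Real.norm_of_nonneg (deviation_nonneg fun s hs => (hk.pos _ (by linarith)).le)]
    exact hP.deviation_mono hg (hk.sub.shift hg hh'.le) hk.sub (fun s hs =>
      hk.anti (mem_Ici.2 hs) (mem_Ici.2 (by linarith)) (by linarith)) (hx.trans ht.1.le)
  · refine Eventually.of_forall fun t ht => ?_
    rw [uIoc_of_le hxy] at ht
    exact hk.tendsto_deviation hg hP (hx.trans ht.1.le)

/-- The energy of the averaged solution. -/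
def averagedEnergy (g : ℝ → ℝ) (ρ₁ ρ₂ b κ : ℝ) (P φt ψx ψt : ℝ → X) (h t : ℝ) : ℝ :=
  elasticEnergy ρ₁ ρ₂ b κ (steklov h φt t) (steklov h ψt t) (steklov h ψx t) (steklov h P t)
    (steklov h (memory g P) t) + κ / 2 * steklov h (memory g (fun t => ‖P t‖ ^ 2)) t

theorem AbstractSolution.continuousOn_memory_sq
    (U : AbstractSolution J V g ρ₁ ρ₂ b κ P φt ψ ψx ψt) :
    ContinuousOn (memory g (fun t => ‖P t‖ ^ 2)) (Ici 0) :=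
  U.sq.hasMemory_sq.continuousOn_memory U.kernel U.kernel.subKernel

theorem AbstractSolution.hasDerivAt_averagedEnergy
    (U : AbstractSolution J V g ρ₁ ρ₂ b κ P φt ψ ψx ψt) {h t : ℝ} (hh : 0 < h) (ht : 0 < t) :
    HasDerivAt (averagedEnergy g ρ₁ ρ₂ b κ P φt ψx ψt h)
      (-(κ * inner ℝ (diffQuot h (memory g P) t) (steklov h P t))
        + κ / 2 * diffQuot h (memory g (fun t => ‖P t‖ ^ 2)) t) t :=
  (U.hasDerivAt_elasticEnergy hh ht).add
    ((hasDerivAt_steklov U.continuousOn_memory_sq hh.le ht).const_mul (κ / 2))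

theorem AbstractSolution.continuousOn_averagedEnergy
    (U : AbstractSolution J V g ρ₁ ρ₂ b κ P φt ψ ψx ψt) {h : ℝ} (hh : 0 < h) :
    ContinuousOn (averagedEnergy g ρ₁ ρ₂ b κ P φt ψx ψt h) (Ici 0) := by
  have h1 := continuousOn_steklov U.φt_cont hh.le
  have h2 := continuousOn_steklov U.ψt_cont hh.le
  have h3 := continuousOn_steklov U.ψx_cont hh.le
  have h4 := continuousOn_steklov U.sq.cont hh.le
  have h5 := continuousOn_steklov U.continuousOn_memory hh.le
  have h6 := continuousOn_steklov U.continuousOn_memory_sq hh.le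
  unfold averagedEnergy elasticEnergy
  fun_prop

theorem AbstractSolution.tendsto_averagedEnergy
    (U : AbstractSolution J V g ρ₁ ρ₂ b κ P φt ψ ψx ψt) {t : ℝ} (ht : 0 ≤ t) :
    Tendsto (fun h => averagedEnergy g ρ₁ ρ₂ b κ P φt ψx ψt h t) (𝓝[>] 0)
      (𝓝 (abstractEnergy g ρ₁ ρ₂ b κ P φt ψx ψt t)) := by
  rw [U.energy_eq ht]
  have h1 := tendsto_steklov U.φt_cont ht
  have h2 := tendsto_steklov U.ψt_cont ht
  have h3 := tendsto_steklov U.ψx_cont ht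
  have h4 := tendsto_steklov U.sq.cont ht
  have h5 := tendsto_steklov U.continuousOn_memory ht
  have h6 := tendsto_steklov U.continuousOn_memory_sq ht
  unfold averagedEnergy elasticEnergy
  exact (((((((h1.norm.pow 2).const_mul ρ₁).add ((h2.norm.pow 2).const_mul ρ₂)).add
    ((h3.norm.pow 2).const_mul b)).add ((h4.norm.pow 2).const_mul κ)).const_mul (1 / 2)).sub
    ((h5.inner h4).const_mul κ)).add (h6.const_mul (κ / 2))

/-- The energy inequality. -/
theorem AbstractSolution.energy_le (U : AbstractSolution J V g ρ₁ ρ₂ b κ P φt ψ ψx ψt)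
    (hk : DissipationKernel g k C) {x y : ℝ} (hx : 0 ≤ x) (hxy : x ≤ y) :
    abstractEnergy g ρ₁ ρ₂ b κ P φt ψx ψt y + κ / 4 * ∫ t in x..y, deviation k P t
      ≤ abstractEnergy g ρ₁ ρ₂ b κ P φt ψx ψt x := by
  have hy : 0 ≤ y := hx.trans hxy
  have hκ := U.κ_pos
  refine le_of_forall_pos_le_add fun ε hε => ?_
  obtain ⟨η, hη, hηε⟩ : ∃ η, 0 < η ∧ η * (y - x) ≤ ε := by
    refine ⟨ε / (y - x + 1), by have : 0 ≤ y - x := by linarith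
                                positivity, ?_⟩
    have : 0 < y - x + 1 := by linarith
    rw [div_mul_eq_mul_div, div_le_iff₀ this]
    nlinarith
  obtain ⟨δ, hδ, H⟩ := U.exists_small_step y hη
  have h1 : ∀ᶠ h in 𝓝[>] (0 : ℝ), averagedEnergy g ρ₁ ρ₂ b κ P φt ψx ψt h y
      + κ / 4 * ∫ t in x..y, deviation (fun s => k (s + h)) P t
      ≤ averagedEnergy g ρ₁ ρ₂ b κ P φt ψx ψt h x + ε := by
    filter_upwards [Ioc_mem_nhdsGT hδ] with h hh
    have hc := hk.continuousOn_deviation_shift U.kernel U.sq hh.1.le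
    have hci : IntervalIntegrable (fun t => κ / 4 * deviation (fun s => k (s + h)) P t) volume x y :=
      (continuousOn_const.mul hc).intervalIntegrable_Ici hx hy
    have hint := intervalIntegral.sub_le_integral_of_hasDeriv_right_of_le hxy
      ((U.continuousOn_averagedEnergy hh.1).mono (fun z hz => hx.trans hz.1))
      (fun t ht => (U.hasDerivAt_averagedEnergy hh.1 (hx.trans_lt ht.1)).hasDerivWithinAt)
      (φ := fun t => -(κ / 4 * deviation (fun s => k (s + h)) P t) + η)
      (((((continuousOn_const.mul hc).neg.add continuousOn_const).mono
        (fun z (hz : z ∈ Icc x y) => hx.trans hz.1)).integrableOn_compact isCompact_Icc))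
      (fun t ht => by
        have ht0 : 0 < t := hx.trans_lt ht.1
        refine (H h hh.1 hh.2 t ht0 ht.2.le).1.trans ?_
        have := mul_le_mul_of_nonneg_left (hk.deviation_shift_le U.kernel U.sq hh.1 ht0.le)
          (show 0 ≤ κ / 4 by positivity)
        linarith)
    have hci' : IntervalIntegrable (fun t => -(κ / 4 * deviation (fun s => k (s + h)) P t))
      volume x y := hci.neg
    rw [intervalIntegral.integral_add hci' intervalIntegrable_const,
      intervalIntegral.integral_neg, intervalIntegral.integral_const_mul,
      intervalIntegral.integral_const, smul_eq_mul] at hint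
    linarith
  exact le_of_tendsto_of_tendsto ((U.tendsto_averagedEnergy hy).add
    ((hk.tendsto_integral_deviation U.kernel U.sq hx hxy).const_mul (κ / 4)))
    ((U.tendsto_averagedEnergy hx).add_const ε) h1

/-- The multiplier functional evaluated along a solution. -/
def multiplierAlong (J : X →L[ℝ] X) (g : ℝ → ℝ) (ρ₁ ρ₂ g₀ n₁ n₃ : ℝ) (P φt ψ ψx ψt : ℝ → X)
    (t : ℝ) : ℝ :=
  multiplier J ρ₁ ρ₂ g₀ n₁ n₃ (φt t) (ψt t) (ψ t) (ψx t) (P t) (memory g P t)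

theorem AbstractSolution.continuousOn_multiplierAlong
    (U : AbstractSolution J V g ρ₁ ρ₂ b κ P φt ψ ψx ψt) (g₀ n₁ n₃ : ℝ) :
    ContinuousOn (multiplierAlong J g ρ₁ ρ₂ g₀ n₁ n₃ P φt ψ ψx ψt) (Ici 0) := by
  have h1 := U.φt_cont
  have h2 := U.ψt_cont
  have h3 := U.ψx_cont
  have h4 := U.sq.cont
  have h5 := U.continuousOn_memory
  have h6 := U.ψ_cont
  unfold multiplierAlong multiplier
  fun_prop

/-- The density in the multiplier estimate. -/
def multiplierDensity (m C g₀ : ℝ) (A B Wx P G : X) : ℝ :=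
  -(m * (‖A‖ ^ 2 + ‖B‖ ^ 2 + ‖Wx‖ ^ 2 + ‖P‖ ^ 2)) + C * ‖g₀ • P - G‖ ^ 2

theorem AbstractSolution.tendsto_integral_density
    (U : AbstractSolution J V g ρ₁ ρ₂ b κ P φt ψ ψx ψt) (m C g₀ : ℝ) {x y : ℝ} (hx : 0 ≤ x)
    (hxy : x ≤ y) :
    Tendsto (fun h => ∫ t in x..y, multiplierDensity m C g₀ (steklov h φt t) (steklov h ψt t)
        (steklov h ψx t) (steklov h P t) (steklov h (memory g P) t)) (𝓝[>] 0)
      (𝓝 (∫ t in x..y, multiplierDensity m C g₀ (φt t) (ψt t) (ψx t) (P t) (memory g P t))) := by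
  obtain ⟨B₁, h1n, h1⟩ := exists_norm_le_of_continuousOn U.φt_cont (y + 1)
  obtain ⟨B₂, h2n, h2⟩ := exists_norm_le_of_continuousOn U.ψt_cont (y + 1)
  obtain ⟨B₃, h3n, h3⟩ := exists_norm_le_of_continuousOn U.ψx_cont (y + 1)
  obtain ⟨B₄, h4n, h4⟩ := exists_norm_le_of_continuousOn U.sq.cont (y + 1)
  obtain ⟨B₅, h5n, h5⟩ := exists_norm_le_of_continuousOn U.continuousOn_memory (y + 1)
  refine intervalIntegral.tendsto_integral_filter_of_dominated_convergence
    (fun _ => |m| * (B₁ ^ 2 + B₂ ^ 2 + B₃ ^ 2 + B₄ ^ 2) + |C| * (|g₀| * B₄ + B₅) ^ 2) ?_ ?_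
    intervalIntegrable_const ?_
  · filter_upwards [self_mem_nhdsWithin] with h hh
    have hh' : 0 < h := hh
    have c1 := continuousOn_steklov U.φt_cont hh'.le
    have c2 := continuousOn_steklov U.ψt_cont hh'.le
    have c3 := continuousOn_steklov U.ψx_cont hh'.le
    have c4 := continuousOn_steklov U.sq.cont hh'.le
    have c5 := continuousOn_steklov U.continuousOn_memory hh'.le
    refine (intervalIntegrable_iff.1 (ContinuousOn.intervalIntegrable_Ici ?_ hx
      (hx.trans hxy))).aestronglyMeasurable
    unfold multiplierDensity
    fun_prop
  · filter_upwards [Ioc_mem_nhdsGT (zero_lt_one' ℝ)] with h hh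
    refine Eventually.of_forall fun t ht => ?_
    rw [uIoc_of_le hxy] at ht
    have htm : t ∈ Icc 0 y := ⟨hx.trans ht.1.le, ht.2⟩
    have e1 := norm_steklov_le h1 hh.1 hh.2 htm
    have e2 := norm_steklov_le h2 hh.1 hh.2 htm
    have e3 := norm_steklov_le h3 hh.1 hh.2 htm
    have e4 := norm_steklov_le h4 hh.1 hh.2 htm
    have e5 := norm_steklov_le h5 hh.1 hh.2 htm
    have e6 : ‖g₀ • steklov h P t - steklov h (memory g P) t‖ ≤ |g₀| * B₄ + B₅ := by
      refine (norm_sub_le _ _).trans (add_le_add ?_ e5)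
      rw [norm_smul, Real.norm_eq_abs]
      gcongr
    unfold multiplierDensity
    refine (abs_add_le _ _).trans ?_
    rw [abs_neg, abs_mul, abs_mul, abs_of_nonneg (a := _ + _ + _ + _) (by positivity),
      abs_of_nonneg (a := ‖_‖ ^ 2) (by positivity)]
    gcongr
  · refine Eventually.of_forall fun t ht => ?_
    rw [uIoc_of_le hxy] at ht
    have ht0 : 0 ≤ t := hx.trans ht.1.le
    have h1 := tendsto_steklov U.φt_cont ht0
    have h2 := tendsto_steklov U.ψt_cont ht0
    have h3 := tendsto_steklov U.ψx_cont ht0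
    have h4 := tendsto_steklov U.sq.cont ht0
    have h5 := tendsto_steklov U.continuousOn_memory ht0
    exact (((((h1.norm.pow 2).add (h2.norm.pow 2)).add (h3.norm.pow 2)).add
      (h4.norm.pow 2)).const_mul m).neg.add ((((h4.const_smul g₀).sub h5).norm.pow 2).const_mul C)

theorem AbstractSolution.g₀_pos (U : AbstractSolution J V g ρ₁ ρ₂ b κ P φt ψ ψx ψt) :
    0 < ∫ s in Ioi (0 : ℝ), g s := by
  rw [setIntegral_pos_iff_support_of_nonneg_ae]
  · have : Function.support g ∩ Ioi 0 = Ioi 0 :=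
      inter_eq_right.2 fun s hs => (U.kernel.pos s (le_of_lt hs)).ne'
    rw [this]
    simp
  · filter_upwards [ae_restrict_mem measurableSet_Ioi] with s hs
    exact (U.kernel.pos s (le_of_lt hs)).le
  · exact U.kernel.int

/-- The integrated multiplier estimate. -/
theorem AbstractSolution.exists_multiplier_le
    (U : AbstractSolution J V g ρ₁ ρ₂ b κ P φt ψ ψx ψt) :
    ∃ n₁ n₃ m C N : ℝ, 0 < n₁ ∧ 0 < n₃ ∧ 0 < m ∧ 0 < C ∧ 0 < N ∧ ∀ x y : ℝ, 0 ≤ x → x ≤ y →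
      multiplierAlong J g ρ₁ ρ₂ (∫ s in Ioi (0 : ℝ), g s) n₁ n₃ P φt ψ ψx ψt y
          + N * abstractEnergy g ρ₁ ρ₂ b κ P φt ψx ψt y
        ≤ multiplierAlong J g ρ₁ ρ₂ (∫ s in Ioi (0 : ℝ), g s) n₁ n₃ P φt ψ ψx ψt x
          + N * abstractEnergy g ρ₁ ρ₂ b κ P φt ψx ψt x
          + ∫ t in x..y, multiplierDensity m C (∫ s in Ioi (0 : ℝ), g s) (φt t) (ψt t) (ψx t)
              (P t) (memory g P t) := by
  have hκ := U.κ_pos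
  have hg0 := U.kernel.pos 0 le_rfl
  set g₀ := ∫ s in Ioi (0 : ℝ), g s with hg₀
  obtain ⟨n₁, n₃, m, C, hn₁, hn₃, hm, hC, key⟩ := exists_multiplier_bound J U.closed U.ρ₁_pos
    U.ρ₂_pos U.b_pos U.κ_pos U.speed U.g₀_pos U.int_lt
  -- Chosen so that the dissipation of N times the energy absorbs C ‖(g∗P)'‖², which is at most 2 C
  -- g(0) times the deviation of the quotient kernel, up to small errors.
  obtain ⟨N, hN, hNe⟩ : ∃ N, 0 < N ∧ N * (κ / 4) = C * (2 * g 0) :=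
    ⟨8 * C * g 0 / κ, by positivity, by field_simp; norm_num⟩
  refine ⟨n₁, n₃, m, C, N, hn₁, hn₃, hm, hC, hN, fun x y hx hxy => ?_⟩
  have hy : 0 ≤ y := hx.trans hxy
  refine le_of_forall_pos_le_add fun ε hε => ?_
  obtain ⟨η, hη, hηε⟩ : ∃ η, 0 < η ∧ (N + C) * η * (y - x) ≤ ε := by
    have h0 : 0 ≤ y - x := by linarith
    have h1 : 0 < (N + C) * (y - x) + 1 := by positivity
    refine ⟨ε / ((N + C) * (y - x) + 1), by positivity, ?_⟩
    rw [mul_div_assoc', div_mul_eq_mul_div, div_le_iff₀ h1]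
    nlinarith
  obtain ⟨δ, hδ, H⟩ := U.exists_small_step y hη
  let F : ℝ → ℝ → ℝ := fun h t => multiplier J ρ₁ ρ₂ g₀ n₁ n₃ (steklov h φt t) (steklov h ψt t)
        (steklov h ψ t) (steklov h ψx t) (steklov h P t) (steklov h (memory g P) t)
  let D : ℝ → ℝ → ℝ := fun h t => multiplierDensity m C g₀ (steklov h φt t) (steklov h ψt t)
        (steklov h ψx t) (steklov h P t) (steklov h (memory g P) t)
  have hF : ∀ t, 0 ≤ t → Tendsto (fun h => F h t) (𝓝[>] 0)
      (𝓝 (multiplierAlong J g ρ₁ ρ₂ g₀ n₁ n₃ P φt ψ ψx ψt t)) := by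
    intro t ht
    have h1 := tendsto_steklov U.φt_cont ht
    have h2 := tendsto_steklov U.ψt_cont ht
    have h3 := tendsto_steklov U.ψx_cont ht
    have h4 := tendsto_steklov U.sq.cont ht
    have h5 := tendsto_steklov U.continuousOn_memory ht
    have h6 := tendsto_steklov U.ψ_cont ht
    have hJ : ∀ {u : ℝ → X} {v : X}, Tendsto u (𝓝[>] 0) (𝓝 v) →
        Tendsto (fun h => J (u h)) (𝓝[>] 0) (𝓝 (J v)) :=
      fun h => (J.continuous.tendsto _).comp h
    exact ((((h1.inner (hJ h5)).const_mul ρ₁).const_mul n₁).sub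
      ((h1.inner (hJ ((h4.const_smul g₀).sub h5))).const_mul ρ₁)).sub
      ((((h2.inner (h4.sub h5)).const_mul ρ₂).add ((h3.inner h1).const_mul ρ₂)).const_mul n₃)
      |>.add ((h2.inner h6).const_mul ρ₂)
  have h1 : ∀ᶠ h in 𝓝[>] (0 : ℝ), F h y + N * averagedEnergy g ρ₁ ρ₂ b κ P φt ψx ψt h y
      ≤ F h x + N * averagedEnergy g ρ₁ ρ₂ b κ P φt ψx ψt h x + (∫ t in x..y, D h t) + ε := by
    filter_upwards [Ioc_mem_nhdsGT hδ] with h hh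
    have c1 := continuousOn_steklov U.φt_cont hh.1.le
    have c2 := continuousOn_steklov U.ψt_cont hh.1.le
    have c3 := continuousOn_steklov U.ψx_cont hh.1.le
    have c4 := continuousOn_steklov U.sq.cont hh.1.le
    have c5 := continuousOn_steklov U.continuousOn_memory hh.1.le
    have c6 := continuousOn_steklov U.ψ_cont hh.1.le
    have cF : ContinuousOn (F h) (Ici 0) := by
      simp only [F]
      unfold multiplier
      fun_prop
    have cD : ContinuousOn (D h) (Ici 0) := by
      simp only [D]
      unfold multiplierDensity
      fun_prop
    have hint := intervalIntegral.sub_le_integral_of_hasDeriv_right_of_le hxy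
      ((cF.add (continuousOn_const.mul (U.continuousOn_averagedEnergy hh.1))).mono
        (fun z hz => hx.trans hz.1))
      (fun t ht => ((U.hasDerivAt_multiplier hh.1 (hx.trans_lt ht.1) g₀ n₁ n₃).add
        ((U.hasDerivAt_averagedEnergy hh.1 (hx.trans_lt ht.1)).const_mul N)).hasDerivWithinAt)
      (φ := fun t => D h t + (N + C) * η)
      (((cD.add continuousOn_const).mono
        (fun z (hz : z ∈ Icc x y) => hx.trans hz.1)).integrableOn_compact isCompact_Icc)
      (fun t ht => by
        have ht0 : 0 < t := hx.trans_lt ht.1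
        obtain ⟨H1, H2⟩ := H h hh.1 hh.2 t ht0 ht.2.le
        have k1 := key _ _ _ _ _ _ _ _ _ _ (diffQuot h (memory g P) t) (U.smoothState hh.1 ht0)
        have k2 := mul_le_mul_of_nonneg_left H1 hN.le
        have k3 := mul_le_mul_of_nonneg_left H2 hC.le
        have k4 : N * (κ / 4 * deviation (kernelQuot g h) P t)
            = C * (2 * g 0 * deviation (kernelQuot g h) P t) := by
          rw [← mul_assoc, hNe]; ring
        simp only [D, multiplierDensity]
        linarith)
    rw [intervalIntegral.integral_add (cD.intervalIntegrable_Ici hx hy) intervalIntegrable_const,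
      intervalIntegral.integral_const, smul_eq_mul] at hint
    simp only [Pi.add_apply, Pi.mul_apply] at hint
    linarith
  exact le_of_tendsto_of_tendsto ((hF y hy).add ((U.tendsto_averagedEnergy hy).const_mul N))
    ((((hF x hx).add ((U.tendsto_averagedEnergy hx).const_mul N)).add
      (U.tendsto_integral_density m C g₀ hx hxy)).add_const ε) h1

end Limits

/-! ### Separating the history from positive times -/

/-- The part of the memory energy that comes from positive times. -/
def headDeviation {X : Type*} [NormedAddCommGroup X] (g : ℝ → ℝ) (P : ℝ → X) (t : ℝ) : ℝ :=
  ∫ s in (0 : ℝ)..t, g s * ‖P t - P (t - s)‖ ^ 2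

/-- The weight of the history at time `t`. -/
def historyWeight {X : Type*} [NormedAddCommGroup X] (g : ℝ → ℝ) (P : ℝ → X) (t : ℝ) : ℝ :=
  ∫ s in Ioi (0 : ℝ), g (t + s) * (1 + ‖P (-s)‖ ^ 2)

/-- Young's inequality for the convolution of a kernel with a nonnegative function. -/
theorem IsKernel.integral_convolution_le {g a : ℝ → ℝ} (hg : IsKernel g)
    (ha : ContinuousOn a (Ici 0)) (ha0 : ∀ t, 0 ≤ t → 0 ≤ a t) {T : ℝ} (hT : 0 ≤ T) :
    ∫ t in (0 : ℝ)..T, ∫ s in (0 : ℝ)..t, g s * a (t - s)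
      ≤ (∫ s in Ioi (0 : ℝ), g s) * ∫ t in (0 : ℝ)..T, a t := by
  -- Extension by zero turns the double integral into part of a convolution on ℝ, whose total
  -- integral factors; the discarded part is nonnegative.
  set G : ℝ → ℝ := (Ioi (0 : ℝ)).indicator g with hG
  set A : ℝ → ℝ := (Icc (0 : ℝ) T).indicator a with hA
  have hGi : Integrable G := hg.int.integrable_indicator measurableSet_Ioi
  have hAi : Integrable A :=
    ((ha.mono fun x (hx : x ∈ Icc 0 T) => hx.1).integrableOn_compact isCompact_Icc
      ).integrable_indicator measurableSet_Icc
  have hG0 : ∀ s, 0 ≤ G s := fun s => indicator_nonneg (fun x hx => (hg.pos x (le_of_lt hx)).le) s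
  have hA0 : ∀ s, 0 ≤ A s := fun s => indicator_nonneg (fun x hx => ha0 x hx.1) s
  have hconv := integral_convolution (ContinuousLinearMap.mul ℝ ℝ) hGi hAi
    (μ := volume) (ν := volume)
  have hci := hGi.integrable_convolution (ContinuousLinearMap.mul ℝ ℝ) hAi (μ := volume)
  have e1 : ∫ s, G s = ∫ s in Ioi (0 : ℝ), g s := integral_indicator measurableSet_Ioi
  have e2 : ∫ s, A s = ∫ t in (0 : ℝ)..T, a t := by
    rw [intervalIntegral.integral_of_le hT, ← integral_Icc_eq_integral_Ioc]
    exact integral_indicator measurableSet_Icc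
  rw [e1, e2, ContinuousLinearMap.mul_apply'] at hconv
  rw [← hconv, intervalIntegral.integral_of_le hT]
  have e3 : ∫ t in Ioc 0 T, ∫ s in (0 : ℝ)..t, g s * a (t - s)
      = ∫ t in Ioc 0 T, (convolution G A (ContinuousLinearMap.mul ℝ ℝ) volume) t := by
    refine setIntegral_congr_fun measurableSet_Ioc (fun t ht => ?_)
    change ∫ s in (0 : ℝ)..t, g s * a (t - s) = ∫ s, G s * A (t - s)
    rw [intervalIntegral.integral_of_le ht.1.le, ← integral_indicator measurableSet_Ioc]
    refine integral_congr_ae (Eventually.of_forall fun s => ?_)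
    by_cases hs : s ∈ Ioc 0 t
    · have h1 : t - s ∈ Icc 0 T := ⟨by linarith [hs.2], by linarith [hs.1, ht.2]⟩
      have h2 : s ∈ Ioi (0 : ℝ) := hs.1
      simp only [hG, hA, indicator_of_mem hs, indicator_of_mem h1, indicator_of_mem h2]
    · rw [indicator_of_notMem hs]
      by_cases h2 : 0 < s
      · have h3 : t - s ∉ Icc 0 T := fun h => hs ⟨h2, by linarith [h.1]⟩
        simp only [hA, indicator_of_notMem h3, mul_zero]
      · have h3 : s ∉ Ioi (0 : ℝ) := h2
        simp only [hG, indicator_of_notMem h3, zero_mul]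
  rw [e3]
  refine setIntegral_le_integral hci (Eventually.of_forall fun t => ?_)
  exact integral_nonneg fun s => mul_nonneg (hG0 s) (hA0 _)

theorem IsKernel.exists_tail_le {g : ℝ → ℝ} (hg : IsKernel g) {η : ℝ} (hη : 0 < η) :
    ∃ T, 0 ≤ T ∧ ∫ s in Ioi T, g s ≤ η := by
  have h1 := intervalIntegral_tendsto_integral_Ioi 0 hg.int tendsto_id
  have h2 := (h1.eventually (lt_mem_nhds (show (∫ s in Ioi (0 : ℝ), g s) - η
    < ∫ s in Ioi (0 : ℝ), g s by linarith))).and (eventually_ge_atTop (0 : ℝ))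
  obtain ⟨T, hT, hT0⟩ := h2.exists
  refine ⟨T, hT0, ?_⟩
  have := intervalIntegral.integral_interval_add_Ioi hg.int
    (hg.int.mono_set (Ioi_subset_Ioi hT0))
  simp only [id] at hT
  linarith

/-! ### Estimates for the memory remainder -/

section Lyapunov

variable {X : Type*} [NormedAddCommGroup X] [InnerProductSpace ℝ X] [CompleteSpace X]
  {J : X →L[ℝ] X} {V : Submodule ℝ X} {g k : ℝ → ℝ} {ρ₁ ρ₂ b κ C : ℝ} {P φt ψ ψx ψt : ℝ → X}

/-- Cut the delay at T. On (0, T] monotonicity gives g ≤ (g(0)/k(T)) k, so this part is paid for by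
the dissipation; beyond T the kernel has small mass and the term can be absorbed. A bound of g by a
multiple of k on the whole half-line is not available. -/
theorem HasSqMemory.memory_remainder_le (hg : IsKernel g) (hk : DissipationKernel g k C)
    (hP : HasSqMemory g P) {T t : ℝ} (hT : 0 ≤ T) (ht : 0 ≤ t) :
    ‖(∫ s in Ioi (0 : ℝ), g s) • P t - memory g P t‖ ^ 2
      ≤ 2 * ((∫ s in Ioi (0 : ℝ), g s) * (g 0 / k T)) * deviation k P t
        + 2 * (∫ s in Ioi T, g s) * deviation g P t := by
  have hg0 : ∀ s ∈ Ioi (0 : ℝ), 0 ≤ g s := fun s hs => (hg.pos s (le_of_lt hs)).le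
  have hkT := hk.pos T hT
  have hdi := hP.integrableOn_deviation hg hg.subKernel ht
  have hki := hP.integrableOn_deviation hg hk.sub ht
  have hvi : IntegrableOn (fun s => g s • (P t - P (t - s))) (Ioi 0) := by
    simp only [smul_sub]
    exact (hg.int.smul_const _).sub ((hP.hasMemory hg).integrableOn hg hg.subKernel ht)
  have h1 : (∫ s in Ioi (0 : ℝ), g s) • P t - memory g P t
      = (∫ s in Ioc 0 T, g s • (P t - P (t - s))) + ∫ s in Ioi T, g s • (P t - P (t - s)) := by
    rw [← setIntegral_union Ioc_disjoint_Ioi_same measurableSet_Ioi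
      (hvi.mono_set Ioc_subset_Ioi_self) (hvi.mono_set (Ioi_subset_Ioi hT)),
      Ioc_union_Ioi_eq_Ioi hT]
    simp only [smul_sub]
    rw [integral_sub (hg.int.smul_const _) ((hP.hasMemory hg).integrableOn hg hg.subKernel ht),
      integral_smul_const, memory]
  have a1 : ‖∫ s in Ioc 0 T, g s • (P t - P (t - s))‖ ^ 2
      ≤ (∫ s in Ioi (0 : ℝ), g s) * (g 0 / k T) * deviation k P t := by
    refine (norm_sq_setIntegral_smul_le measurableSet_Ioc (fun s hs => hg0 s hs.1)
      (hg.int.mono_set Ioc_subset_Ioi_self) (hdi.mono_set Ioc_subset_Ioi_self)).trans ?_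
    rw [mul_assoc]
    refine mul_le_mul ?_ ?_ (setIntegral_nonneg measurableSet_Ioc fun s hs =>
      mul_nonneg (hg0 s hs.1) (by positivity)) (setIntegral_nonneg measurableSet_Ioi hg0)
    · exact setIntegral_mono_set hg.int ((ae_restrict_mem measurableSet_Ioi).mono hg0)
        Ioc_subset_Ioi_self.eventuallyLE
    · have i1 : ∫ s in Ioc 0 T, g s * ‖P t - P (t - s)‖ ^ 2
          ≤ ∫ s in Ioc 0 T, g 0 / k T * (k s * ‖P t - P (t - s)‖ ^ 2) := by
        refine setIntegral_mono_on (hdi.mono_set Ioc_subset_Ioi_self)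
          ((hki.mono_set Ioc_subset_Ioi_self).const_mul _) measurableSet_Ioc (fun s hs => ?_)
        rw [← mul_assoc]
        refine mul_le_mul_of_nonneg_right ?_ (by positivity)
        have e1 := hg.le_zero hs.1.le
        have e2 := hk.anti (mem_Ici.2 hs.1.le) (mem_Ici.2 hT) hs.2
        have e3 := hg.pos 0 le_rfl
        rw [div_mul_eq_mul_div, le_div_iff₀ hkT]
        exact mul_le_mul e1 e2 hkT.le e3.le
      refine i1.trans ?_
      rw [integral_const_mul]
      refine mul_le_mul_of_nonneg_left ?_ (div_nonneg (hg.pos 0 le_rfl).le hkT.le)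
      exact setIntegral_mono_set hki ((ae_restrict_mem measurableSet_Ioi).mono fun s hs =>
        mul_nonneg (hk.pos s (le_of_lt hs)).le (by positivity)) Ioc_subset_Ioi_self.eventuallyLE
  have a2 : ‖∫ s in Ioi T, g s • (P t - P (t - s))‖ ^ 2
      ≤ (∫ s in Ioi T, g s) * deviation g P t := by
    have hg0' : ∀ s ∈ Ioi T, 0 ≤ g s := fun s hs => hg0 s (hT.trans_lt hs)
    refine (norm_sq_setIntegral_smul_le measurableSet_Ioi hg0'
      (hg.int.mono_set (Ioi_subset_Ioi hT)) (hdi.mono_set (Ioi_subset_Ioi hT))).trans ?_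
    refine mul_le_mul_of_nonneg_left ?_ (setIntegral_nonneg measurableSet_Ioi hg0')
    exact setIntegral_mono_set hdi ((ae_restrict_mem measurableSet_Ioi).mono fun s hs =>
      mul_nonneg (hg0 s hs) (by positivity)) (Ioi_subset_Ioi hT).eventuallyLE
  rw [h1]
  set u := ∫ s in Ioc 0 T, g s • (P t - P (t - s)) with hu
  set v := ∫ s in Ioi T, g s • (P t - P (t - s)) with hv
  have a3 : ‖u + v‖ ^ 2 ≤ (‖u‖ + ‖v‖) ^ 2 := by gcongr; exact norm_add_le _ _
  linarith [sq_nonneg (‖u‖ - ‖v‖), sub_sq ‖u‖ ‖v‖, add_sq ‖u‖ ‖v‖]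

theorem HasSqMemory.memory_remainder_le_deviation (hg : IsKernel g) (hP : HasSqMemory g P) {t : ℝ}
    (ht : 0 ≤ t) : ‖(∫ s in Ioi (0 : ℝ), g s) • P t - memory g P t‖ ^ 2
      ≤ (∫ s in Ioi (0 : ℝ), g s) * deviation g P t :=
  hP.norm_sq_sub_memory_le hg hg.subKernel (fun s hs => (hg.pos s hs).le) ht

theorem norm_sub_sq_le_two (u v : X) : ‖u - v‖ ^ 2 ≤ 2 * ‖u‖ ^ 2 + 2 * ‖v‖ ^ 2 := by
  have h : ‖u - v‖ ^ 2 ≤ (‖u‖ + ‖v‖) ^ 2 := by gcongr; exact norm_sub_le _ _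
  linarith [sq_nonneg (‖u‖ - ‖v‖), sub_sq ‖u‖ ‖v‖, add_sq ‖u‖ ‖v‖]

theorem HasSqMemory.hasMemory_one_add (hg : IsKernel g) (hP : HasSqMemory g P) :
    HasMemory g (fun t => 1 + ‖P t‖ ^ 2) := by
  refine ⟨continuousOn_const.add (hP.cont.norm.pow 2),
    aestronglyMeasurable_const.add (hP.meas.norm.pow 2), ?_⟩
  refine (hg.int.add hP.int).congr (Eventually.of_forall fun s => ?_)
  simp only [Pi.add_apply]
  rw [Real.norm_of_nonneg (by positivity)]
  ring

theorem HasSqMemory.integrableOn_historyWeight (hg : IsKernel g) (hP : HasSqMemory g P) {t : ℝ}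
    (ht : 0 ≤ t) : IntegrableOn (fun s => g (t + s) * (1 + ‖P (-s)‖ ^ 2)) (Ioi 0) := by
  have := (hP.hasMemory_one_add hg).integrableOn_tail hg hg.subKernel ht
  simpa only [smul_eq_mul, add_comm] using this

theorem HasSqMemory.continuousOn_historyWeight (hg : IsKernel g) (hP : HasSqMemory g P) :
    ContinuousOn (historyWeight g P) (Ici 0) := by
  have := continuousOn_tail hg hg.subKernel (hP.hasMemory_one_add hg)
  refine this.congr fun t _ => ?_
  simp only [historyWeight, smul_eq_mul, add_comm]

theorem historyWeight_nonneg (hg : IsKernel g) {t : ℝ} (ht : 0 ≤ t) : 0 ≤ historyWeight g P t :=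
  setIntegral_nonneg measurableSet_Ioi fun s hs =>
    mul_nonneg (hg.pos _ (add_nonneg ht (le_of_lt hs))).le (by positivity)

/-- Delays beyond t reach into the history. After the shift s ↦ s + t the integrand is at most twice
‖P(t)‖² + ‖P(-s)‖², hence at most 2B(1 + ‖P(-s)‖²). -/
theorem HasSqMemory.deviation_le_head_add (hg : IsKernel g) (hP : HasSqMemory g P) {t B : ℝ}
    (ht : 0 ≤ t) (hB : ‖P t‖ ^ 2 ≤ B) (hB1 : 1 ≤ B) :
    deviation g P t ≤ headDeviation g P t + 2 * B * historyWeight g P t := by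
  have hdi := hP.integrableOn_deviation hg hg.subKernel ht
  rw [deviation, setIntegral_Ioi_shift hdi ht, headDeviation, historyWeight, ← integral_const_mul]
  refine add_le_add le_rfl ?_
  refine setIntegral_mono_on ?_ ((hP.integrableOn_historyWeight hg ht).const_mul _)
    measurableSet_Ioi (fun s hs => ?_)
  · rw [integrableOn_Ioi_add_iff (F := fun s => g s * ‖P t - P (t - s)‖ ^ 2)]
    exact hdi.mono_set (Ioi_subset_Ioi ht)
  · have h1 := norm_sub_sq_le_two (P t) (P (-s))
    have e : t - (s + t) = -s := by ring
    rw [e, add_comm s t, mul_left_comm]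
    refine mul_le_mul_of_nonneg_left ?_ (hg.pos _ (add_nonneg ht (le_of_lt hs))).le
    nlinarith [sq_nonneg ‖P (-s)‖]

theorem HasSqMemory.continuousOn_headDeviation (hg : IsKernel g) (hP : HasSqMemory g P) :
    ContinuousOn (headDeviation g P) (Ici 0) := by
  have h1 := continuousOn_head hg.cont hP.cont
  have h2 := continuousOn_head (f := fun t => ‖P t‖ ^ 2) hg.cont (hP.cont.norm.pow 2)
  have h3 : ContinuousOn (fun t => ∫ s in (0 : ℝ)..t, g s) (Ici 0) := by
    have := continuousOn_head (f := fun _ => (1 : ℝ)) hg.cont continuousOn_const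
    simpa using this
  refine ((((h3.mul (hP.cont.norm.pow 2)).sub (continuousOn_const (c := (2 : ℝ)).mul
    (hP.cont.inner h1))).add h2)).congr (fun t ht => ?_)
  have ht' : 0 ≤ t := ht
  have i1 : IntervalIntegrable (fun s => g s * ‖P t‖ ^ 2) volume 0 t :=
    (hg.cont.intervalIntegrable_Ici le_rfl ht').mul_const _
  have i2 := (hP.hasMemory hg).intervalIntegrable hg.subKernel le_rfl ht' le_rfl
  have i3 := hP.hasMemory_sq.intervalIntegrable hg.subKernel le_rfl ht' le_rfl
  have i4 : IntervalIntegrable (fun s => 2 * inner ℝ (P t) (g s • P (t - s))) volume 0 t :=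
    ⟨(i2.1.const_inner (P t)).const_mul 2, (i2.2.const_inner (P t)).const_mul 2⟩
  simp only [headDeviation, deviation_integrand_eq]
  have e1 : ∫ s in (0 : ℝ)..t, inner ℝ (P t) (g s • P (t - s))
      = inner ℝ (P t) (∫ s in (0 : ℝ)..t, g s • P (t - s)) := by
    rw [intervalIntegral.integral_of_le ht', intervalIntegral.integral_of_le ht',
      integral_inner i2.1]
  rw [intervalIntegral.integral_add (i1.sub i4) i3, intervalIntegral.integral_sub i1 i4,
    intervalIntegral.integral_mul_const, intervalIntegral.integral_const_mul, e1]
  rfl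

theorem headDeviation_nonneg (hg : IsKernel g) {t : ℝ} (ht : 0 ≤ t) : 0 ≤ headDeviation g P t :=
  intervalIntegral.integral_nonneg ht fun s hs => mul_nonneg (hg.pos s hs.1).le (by positivity)

/-- Bound the square of the difference by twice the sum of squares; the P(t) part and, by Young's
inequality for convolutions, the P(t-s) part contribute 2g₀ each. -/
theorem HasSqMemory.integral_headDeviation_le (hg : IsKernel g) (hP : HasSqMemory g P) {T : ℝ}
    (hT : 0 ≤ T) : ∫ t in (0 : ℝ)..T, headDeviation g P t
      ≤ 4 * (∫ s in Ioi (0 : ℝ), g s) * ∫ t in (0 : ℝ)..T, ‖P t‖ ^ 2 := by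
  have hPs : ContinuousOn (fun t => ‖P t‖ ^ 2) (Ici 0) := hP.cont.norm.pow 2
  have hh : ContinuousOn (fun t => ∫ s in (0 : ℝ)..t, g s * ‖P (t - s)‖ ^ 2) (Ici 0) :=
    continuousOn_head (f := fun t => ‖P t‖ ^ 2) hg.cont hPs
  have h1 := hg.integral_convolution_le hPs (fun t _ => by positivity) hT
  set g₀ := ∫ s in Ioi (0 : ℝ), g s with hg₀
  have i1 : IntervalIntegrable (fun t => 2 * g₀ * ‖P t‖ ^ 2) volume 0 T :=
    (hPs.intervalIntegrable_Ici le_rfl hT).const_mul _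
  have i2 : IntervalIntegrable (fun t => 2 * ∫ s in (0 : ℝ)..t, g s * ‖P (t - s)‖ ^ 2)
    volume 0 T := (hh.intervalIntegrable_Ici le_rfl hT).const_mul _
  have h2 : ∫ t in (0 : ℝ)..T, headDeviation g P t ≤ ∫ t in (0 : ℝ)..T,
      (2 * g₀ * ‖P t‖ ^ 2 + 2 * ∫ s in (0 : ℝ)..t, g s * ‖P (t - s)‖ ^ 2) := by
    refine intervalIntegral.integral_mono_on hT
      ((hP.continuousOn_headDeviation hg).intervalIntegrable_Ici le_rfl hT) (i1.add i2)
      (fun t ht => ?_)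
    have j1 : IntervalIntegrable (fun s => g s * (2 * ‖P t‖ ^ 2)) volume 0 t :=
      (hg.cont.intervalIntegrable_Ici le_rfl ht.1).mul_const _
    have j2 : IntervalIntegrable (fun s => 2 * (g s * ‖P (t - s)‖ ^ 2)) volume 0 t :=
      (hP.hasMemory_sq.intervalIntegrable hg.subKernel le_rfl ht.1 le_rfl).const_mul 2
    have h3 : headDeviation g P t
        ≤ ∫ s in (0 : ℝ)..t, (g s * (2 * ‖P t‖ ^ 2) + 2 * (g s * ‖P (t - s)‖ ^ 2)) := by
      refine intervalIntegral.integral_mono_on ht.1 ?_ (j1.add j2) (fun s hs => ?_)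
      · have := (hP.integrableOn_deviation hg hg.subKernel ht.1).mono_set
          (show Ioc 0 t ⊆ Ioi 0 from Ioc_subset_Ioi_self)
        exact (intervalIntegrable_iff_integrableOn_Ioc_of_le ht.1).2 this
      · have := mul_le_mul_of_nonneg_left (norm_sub_sq_le_two (P t) (P (t - s)))
          (hg.pos s hs.1).le
        linarith
    rw [intervalIntegral.integral_add j1 j2, intervalIntegral.integral_mul_const,
      intervalIntegral.integral_const_mul] at h3
    have h4 : ∫ s in (0 : ℝ)..t, g s ≤ g₀ := by
      rw [intervalIntegral.integral_of_le ht.1]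
      exact setIntegral_mono_set hg.int ((ae_restrict_mem measurableSet_Ioi).mono fun s hs =>
        (hg.pos s (le_of_lt hs)).le) Ioc_subset_Ioi_self.eventuallyLE
    have h5 := mul_le_mul_of_nonneg_right h4 (show 0 ≤ 2 * ‖P t‖ ^ 2 by positivity)
    linarith
  rw [intervalIntegral.integral_add i1 i2, intervalIntegral.integral_const_mul,
    intervalIntegral.integral_const_mul] at h2
  linarith

end Lyapunov

/-! ### The Lyapunov functional -/

section Lyapunov

variable {X : Type*} [NormedAddCommGroup X] [InnerProductSpace ℝ X] [CompleteSpace X]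
  {J : X →L[ℝ] X} {V : Submodule ℝ X} {g k : ℝ → ℝ} {ρ₁ ρ₂ b κ C : ℝ} {P φt ψ ψx ψt : ℝ → X}

theorem AbstractSolution.deviation_nonneg (U : AbstractSolution J V g ρ₁ ρ₂ b κ P φt ψ ψx ψt)
    (t : ℝ) : 0 ≤ deviation g P t :=
  Timoshenko.deviation_nonneg fun s hs => (U.kernel.pos s hs).le

/-- The energy controls all its parts. -/
theorem AbstractSolution.exists_energy_bounds
    (U : AbstractSolution J V g ρ₁ ρ₂ b κ P φt ψ ψx ψt) :
    ∃ c, 0 < c ∧ ∀ t,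
      ‖φt t‖ ^ 2 ≤ c * abstractEnergy g ρ₁ ρ₂ b κ P φt ψx ψt t ∧
      ‖ψt t‖ ^ 2 ≤ c * abstractEnergy g ρ₁ ρ₂ b κ P φt ψx ψt t ∧
      ‖ψx t‖ ^ 2 ≤ c * abstractEnergy g ρ₁ ρ₂ b κ P φt ψx ψt t ∧
      ‖P t‖ ^ 2 ≤ c * abstractEnergy g ρ₁ ρ₂ b κ P φt ψx ψt t ∧
      deviation g P t ≤ c * abstractEnergy g ρ₁ ρ₂ b κ P φt ψx ψt t := by
  have h1 := U.ρ₁_pos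
  have h2 := U.ρ₂_pos
  have h3 := U.b_pos
  have h4 := U.κ_pos
  have h5 : 0 < 1 - ∫ s in Ioi (0 : ℝ), g s := by linarith [U.int_lt]
  set l := 1 - ∫ s in Ioi (0 : ℝ), g s with hl
  refine ⟨2 / ρ₁ + 2 / ρ₂ + 2 / b + 2 / (κ * l) + 2 / κ, by positivity, fun t => ?_⟩
  have h6 := U.deviation_nonneg t
  set e := abstractEnergy g ρ₁ ρ₂ b κ P φt ψx ψt t with he
  have hed : e = ρ₁ / 2 * ‖φt t‖ ^ 2 + ρ₂ / 2 * ‖ψt t‖ ^ 2 + b / 2 * ‖ψx t‖ ^ 2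
    + κ / 2 * l * ‖P t‖ ^ 2 + κ / 2 * deviation g P t := rfl
  have p1 : 0 ≤ ρ₁ / 2 * ‖φt t‖ ^ 2 := by positivity
  have p2 : 0 ≤ ρ₂ / 2 * ‖ψt t‖ ^ 2 := by positivity
  have p3 : 0 ≤ b / 2 * ‖ψx t‖ ^ 2 := by positivity
  have p4 : 0 ≤ κ / 2 * l * ‖P t‖ ^ 2 := by positivity
  have p5 : 0 ≤ κ / 2 * deviation g P t := by positivity
  have e0 : 0 ≤ e := by linarith
  have key : ∀ (a x r : ℝ), 0 < a → a / 2 * x ≤ e → 0 ≤ r → x ≤ (2 / a + r) * e := by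
    intro a x r ha hx hr
    have : x ≤ 2 / a * e := by
      rw [div_mul_eq_mul_div, le_div_iff₀ ha]
      linarith
    nlinarith [mul_nonneg hr e0]
  have i1 : 0 ≤ 2 / ρ₁ := by positivity
  have i2 : 0 ≤ 2 / ρ₂ := by positivity
  have i3 : 0 ≤ 2 / b := by positivity
  have i4 : 0 ≤ 2 / (κ * l) := by positivity
  have i5 : 0 ≤ 2 / κ := by positivity
  refine ⟨?_, ?_, ?_, ?_, ?_⟩
  · exact (key ρ₁ _ (2 / ρ₂ + 2 / b + 2 / (κ * l) + 2 / κ) h1 (by linarith)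
      (by positivity)).trans_eq (by ring)
  · exact (key ρ₂ _ (2 / ρ₁ + 2 / b + 2 / (κ * l) + 2 / κ) h2 (by linarith)
      (by positivity)).trans_eq (by ring)
  · exact (key b _ (2 / ρ₁ + 2 / ρ₂ + 2 / (κ * l) + 2 / κ) h3 (by linarith)
      (by positivity)).trans_eq (by ring)
  · exact (key (κ * l) _ (2 / ρ₁ + 2 / ρ₂ + 2 / b + 2 / κ) (by positivity)
      (by linarith) (by positivity)).trans_eq (by ring)
  · exact (key κ _ (2 / ρ₁ + 2 / ρ₂ + 2 / b + 2 / (κ * l)) h4 (by linarith)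
      (by positivity)).trans_eq (by ring)

theorem AbstractSolution.energy_nonneg (U : AbstractSolution J V g ρ₁ ρ₂ b κ P φt ψ ψx ψt)
    (t : ℝ) : 0 ≤ abstractEnergy g ρ₁ ρ₂ b κ P φt ψx ψt t := by
  obtain ⟨c, hc, h⟩ := U.exists_energy_bounds
  exact nonneg_of_mul_nonneg_right ((sq_nonneg _).trans (h t).1) hc

/-- All vectors in the multiplier have norm at most a constant times √E, including ψ by Poincaré's
inequality and g₀P - g∗P by Cauchy-Schwarz. -/
theorem AbstractSolution.exists_multiplierAlong_le
    (U : AbstractSolution J V g ρ₁ ρ₂ b κ P φt ψ ψx ψt) {n₁ n₃ : ℝ} (hn₁ : 0 < n₁)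
    (hn₃ : 0 < n₃) : ∃ c, 0 < c ∧ ∀ t, 0 ≤ t →
      |multiplierAlong J g ρ₁ ρ₂ (∫ s in Ioi (0 : ℝ), g s) n₁ n₃ P φt ψ ψx ψt t|
        ≤ c * abstractEnergy g ρ₁ ρ₂ b κ P φt ψx ψt t := by
  obtain ⟨c, hc, hb⟩ := U.exists_energy_bounds
  have h1 := U.ρ₁_pos
  have h2 := U.ρ₂_pos
  have hg₀ := U.g₀_pos
  have hg₁ := U.int_lt
  refine ⟨(n₁ * (ρ₁ * (2 * ‖J‖)) + ρ₁ * ‖J‖ + n₃ * (ρ₂ * 2 + ρ₂) + ρ₂ * ‖J‖) * c, by positivity,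
    fun t ht => ?_⟩
  obtain ⟨b1, b2, b3, b4, b5⟩ := hb t
  have hM := U.sq.memory_remainder_le_deviation U.kernel ht
  set g₀ := ∫ s in Ioi (0 : ℝ), g s with hg₀d
  have hM' : ‖g₀ • P t - memory g P t‖ ^ 2 ≤ c * abstractEnergy g ρ₁ ρ₂ b κ P φt ψx ψt t :=
    hM.trans ((mul_le_of_le_one_left (U.deviation_nonneg t) hg₁.le).trans b5)
  set e := c * abstractEnergy g ρ₁ ρ₂ b κ P φt ψx ψt t with he
  have he0 : 0 ≤ e := (sq_nonneg _).trans b1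
  obtain ⟨s, hs0, hs⟩ : ∃ s, 0 ≤ s ∧ s ^ 2 = e := ⟨√e, Real.sqrt_nonneg _, Real.sq_sqrt he0⟩
  rw [← hs] at b1 b2 b3 b4 hM'
  have n1 := (sq_le_sq₀ (norm_nonneg _) hs0).1 b1
  have n2 := (sq_le_sq₀ (norm_nonneg _) hs0).1 b2
  have n3 := (sq_le_sq₀ (norm_nonneg _) hs0).1 b3
  have n4 := (sq_le_sq₀ (norm_nonneg _) hs0).1 b4
  have n5 := (sq_le_sq₀ (norm_nonneg _) hs0).1 hM'
  have n6 : ‖ψ t‖ ≤ ‖J‖ * s := (norm_le_of_weak (U.ψ_mem t ht) (U.weak t ht)).trans (by gcongr)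
  obtain ⟨M, hMd⟩ : ∃ M, M = g₀ • P t - memory g P t := ⟨_, rfl⟩
  obtain ⟨G, hGd⟩ : ∃ G, G = memory g P t := ⟨_, rfl⟩
  have hG : G = g₀ • P t - M := by rw [hMd, hGd]; abel
  have hS : P t - G = (1 - g₀) • P t + M := by rw [hMd, hGd, sub_smul, one_smul]; abel
  rw [← hMd] at n5
  have n7 : ‖G‖ ≤ 2 * s := by
    rw [hG]
    refine (norm_sub_le _ _).trans ?_
    rw [norm_smul, Real.norm_of_nonneg hg₀.le]
    have := mul_le_of_le_one_left (norm_nonneg (P t)) hg₁.le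
    linarith
  have n8 : ‖P t - G‖ ≤ 2 * s := by
    rw [hS]
    refine (norm_add_le _ _).trans ?_
    rw [norm_smul, Real.norm_of_nonneg (by linarith)]
    have := mul_le_of_le_one_left (norm_nonneg (P t)) (show 1 - g₀ ≤ 1 by linarith)
    linarith
  have hin : ∀ {u v : X} {p q : ℝ}, ‖u‖ ≤ p → ‖v‖ ≤ q → |inner ℝ u v| ≤ p * q :=
    fun hu hv => (abs_real_inner_le_norm _ _).trans
      (mul_le_mul hu hv (norm_nonneg _) ((norm_nonneg _).trans hu))
  have hJ : ∀ {v : X} {q : ℝ}, ‖v‖ ≤ q → ‖J v‖ ≤ ‖J‖ * q :=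
    fun hv => (J.le_opNorm _).trans (by gcongr)
  have t1 := abs_le.1 (hin n1 (hJ n7))
  have t2 := abs_le.1 (hin n1 (hJ n5))
  have t3 := abs_le.1 (hin n2 n8)
  have t4 := abs_le.1 (hin n3 n1)
  have t5 := abs_le.1 (hin n2 n6)
  have key : ∀ (a x p : ℝ), 0 < a → -p ≤ x ∧ x ≤ p → -(a * p) ≤ a * x ∧ a * x ≤ a * p := by
    intro a x p ha hx
    constructor
    · have := mul_le_mul_of_nonneg_left hx.1 ha.le; linarith
    · exact mul_le_mul_of_nonneg_left hx.2 ha.le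
  have u1 := key n₁ _ _ hn₁ (key ρ₁ _ _ h1 t1)
  have u2 := key ρ₁ _ _ h1 t2
  have u3 := key ρ₂ _ _ h2 t3
  have u4 := key ρ₂ _ _ h2 t4
  have u34 := key n₃ (ρ₂ * inner ℝ (ψt t) (P t - G) + ρ₂ * inner ℝ (ψx t) (φt t)) _ hn₃
    ⟨by linarith [u3.1, u4.1], add_le_add u3.2 u4.2⟩
  have u5 := key ρ₂ _ _ h2 t5
  have hfin : (n₁ * (ρ₁ * (2 * ‖J‖)) + ρ₁ * ‖J‖ + n₃ * (ρ₂ * 2 + ρ₂) + ρ₂ * ‖J‖) * c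
      * abstractEnergy g ρ₁ ρ₂ b κ P φt ψx ψt t
      = (n₁ * (ρ₁ * (2 * ‖J‖)) + ρ₁ * ‖J‖ + n₃ * (ρ₂ * 2 + ρ₂) + ρ₂ * ‖J‖) * s ^ 2 := by
    rw [hs, he]; ring
  rw [hfin, multiplierAlong, multiplier, ← hGd, abs_le]
  rw [← hGd] at hMd
  rw [← hMd]
  constructor
  · linarith [u1.1, u2.2, u34.2, u5.1]
  · linarith [u1.2, u2.1, u34.1, u5.2]

/-- The Lyapunov functional of the system. -/
theorem AbstractSolution.exists_lyapunov (U : AbstractSolution J V g ρ₁ ρ₂ b κ P φt ψ ψx ψt)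
    (hk : DissipationKernel g k C) :
    ∃ (L : ℝ → ℝ) (m K : ℝ), 0 < m ∧ 0 < K ∧ ContinuousOn L (Ici 0) ∧
      (∀ t, 0 ≤ t → abstractEnergy g ρ₁ ρ₂ b κ P φt ψx ψt t ≤ L t ∧
        L t ≤ K * abstractEnergy g ρ₁ ρ₂ b κ P φt ψx ψt t) ∧
      (∀ x y, 0 ≤ x → x ≤ y → L y ≤ L x + ∫ t in x..y,
        (-(m * abstractEnergy g ρ₁ ρ₂ b κ P φt ψx ψt t)
          + K * (headDeviation g P t + historyWeight g P t))) ∧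
      (∀ y, 0 ≤ y → ∫ t in (0 : ℝ)..y, abstractEnergy g ρ₁ ρ₂ b κ P φt ψx ψt t
        ≤ K * (1 + ∫ t in (0 : ℝ)..y, historyWeight g P t)) := by
  obtain ⟨n₁, n₃, m, D, N, hn₁, hn₃, hm, hD, hN, hmul⟩ := U.exists_multiplier_le
  obtain ⟨cF, hcF, hF⟩ := U.exists_multiplierAlong_le hn₁ hn₃
  obtain ⟨c, hc, hbd⟩ := U.exists_energy_bounds
  have h1 := U.ρ₁_pos
  have h2 := U.ρ₂_pos
  have h3 := U.b_pos
  have h4 := U.κ_pos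
  have hg₀ := U.g₀_pos
  have hg₁ := U.int_lt
  have hrem := fun T t hT ht => U.sq.memory_remainder_le U.kernel hk (T := T) (t := t) hT ht
  have hrem' := fun t ht => U.sq.memory_remainder_le_deviation U.kernel (t := t) ht
  have hhead := fun T hT => U.sq.integral_headDeviation_le U.kernel (T := T) hT
  have hen := U.energy_nonneg
  have hcon := U.continuousOn_energy
  have hcF' := U.continuousOn_multiplierAlong (∫ s in Ioi (0 : ℝ), g s) n₁ n₃
  have hle := fun x y (hx : 0 ≤ x) (hxy : x ≤ y) => U.energy_le hk hx hxy
  have hdk0 : ∀ t, 0 ≤ deviation k P t :=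
    fun t => Timoshenko.deviation_nonneg fun s hs => (hk.pos s hs).le
  have hed : ∀ t, abstractEnergy g ρ₁ ρ₂ b κ P φt ψx ψt t
      ≤ (ρ₁ + ρ₂ + b + κ) * ((‖φt t‖ ^ 2 + ‖ψt t‖ ^ 2 + ‖ψx t‖ ^ 2 + ‖P t‖ ^ 2)
        + deviation g P t) := by
    intro t
    have hd := U.deviation_nonneg t
    have q4 : (1 - ∫ s in Ioi (0 : ℝ), g s) * (κ / 2 * ‖P t‖ ^ 2) ≤ κ / 2 * ‖P t‖ ^ 2 :=
      mul_le_of_le_one_left (by positivity) (by linarith)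
    have q1 : 0 ≤ (ρ₁ / 2 + ρ₂ + b + κ) * ‖φt t‖ ^ 2 := by positivity
    have q2 : 0 ≤ (ρ₁ + ρ₂ / 2 + b + κ) * ‖ψt t‖ ^ 2 := by positivity
    have q3 : 0 ≤ (ρ₁ + ρ₂ + b / 2 + κ) * ‖ψx t‖ ^ 2 := by positivity
    have q5 : 0 ≤ (ρ₁ + ρ₂ + b + κ / 2) * ‖P t‖ ^ 2 := by positivity
    have q6 : 0 ≤ (ρ₁ + ρ₂ + b + κ / 2) * deviation g P t := by positivity
    unfold abstractEnergy
    linarith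
  set g₀ := ∫ s in Ioi (0 : ℝ), g s with hg₀d
  set e := abstractEnergy g ρ₁ ρ₂ b κ P φt ψx ψt with he
  set F := multiplierAlong J g ρ₁ ρ₂ g₀ n₁ n₃ P φt ψ ψx ψt with hFd
  set S : ℝ → ℝ := fun t => ‖φt t‖ ^ 2 + ‖ψt t‖ ^ 2 + ‖ψx t‖ ^ 2 + ‖P t‖ ^ 2 with hS
  obtain ⟨c', hc', hc'd⟩ : ∃ c', 0 < c' ∧ c' = ρ₁ + ρ₂ + b + κ := ⟨_, by positivity, rfl⟩
  rw [← hc'd] at hed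
  have hanti : ∀ x y, 0 ≤ x → x ≤ y → e y ≤ e x := by
    intro x y hx hxy
    have := hle x y hx hxy
    have h0 : 0 ≤ ∫ t in x..y, deviation k P t :=
      intervalIntegral.integral_nonneg hxy fun t _ => hdk0 t
    have : 0 ≤ κ / 4 * ∫ t in x..y, deviation k P t := by positivity
    linarith
  -- The energy is non-increasing, so ‖P(t)‖² stays bounded for t ≥ 0.
  obtain ⟨B, hB1, hB⟩ : ∃ B, 1 ≤ B ∧ ∀ t, 0 ≤ t → ‖P t‖ ^ 2 ≤ B :=
    ⟨max 1 (c * e 0), le_max_left _ _, fun t ht => (hbd t).2.2.2.1.trans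
      ((mul_le_mul_of_nonneg_left (hanti 0 t le_rfl ht) hc.le).trans (le_max_right _ _))⟩
  have hdev : ∀ t, 0 ≤ t → deviation g P t ≤ headDeviation g P t + 2 * B * historyWeight g P t :=
    fun t ht => U.sq.deviation_le_head_add U.kernel ht (hB t ht) hB1
  have hhist0 : ∀ t, 0 ≤ t → 0 ≤ historyWeight g P t :=
    fun t ht => historyWeight_nonneg U.kernel ht
  have hhead0 : ∀ t, 0 ≤ t → 0 ≤ headDeviation g P t :=
    fun t ht => headDeviation_nonneg U.kernel ht
  have hS0 : ∀ t, 0 ≤ S t := fun t => by simp only [hS]; positivity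
  have cS : ContinuousOn S (Ici 0) := by
    have a1 := U.φt_cont
    have a2 := U.ψt_cont
    have a3 := U.ψx_cont
    have a4 := U.sq.cont
    simp only [hS]
    fun_prop
  have chead := U.sq.continuousOn_headDeviation U.kernel
  have chist := U.sq.continuousOn_historyWeight U.kernel
  have cdk := U.sq.continuousOn_deviation U.kernel hk.sub
  have cdg := U.sq.continuousOn_deviation U.kernel U.kernel.subKernel
  have cM : ContinuousOn (fun t => ‖g₀ • P t - memory g P t‖ ^ 2) (Ici 0) :=
    ((U.sq.cont.const_smul g₀).sub U.continuousOn_memory).norm.pow 2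
  have cdens : ContinuousOn (fun t => multiplierDensity m D g₀ (φt t) (ψt t) (ψx t) (P t)
      (memory g P t)) (Ici 0) := (continuousOn_const.mul cS).neg.add (continuousOn_const.mul cM)
  have hS_int : ∃ K₁, 0 < K₁ ∧ ∀ y, 0 ≤ y → ∫ t in (0 : ℝ)..y, S t
      ≤ K₁ * (1 + ∫ t in (0 : ℝ)..y, historyWeight g P t) := by
    -- With tail mass at most η and the factor 4 of `HasSqMemory.integral_headDeviation_le`, the
    -- tail of the memory costs at most half of m ∫ S.
    obtain ⟨η, hη, hηd⟩ : ∃ η, 0 < η ∧ D * (2 * η) * 4 = m / 2 :=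
      ⟨m / (16 * D), by positivity, by field_simp; norm_num⟩
    obtain ⟨T, hT0, hT⟩ := U.kernel.exists_tail_le hη
    obtain ⟨Q, hQ, hQd⟩ : ∃ Q, 0 < Q ∧ Q = 2 * (g₀ * (g 0 / k T)) :=
      ⟨_, by have := U.kernel.pos 0 le_rfl
             have := hk.pos T hT0
             positivity, rfl⟩
    have e0 := hen 0
    -- In order: boundary values of F + N e, total dissipation (at most 4 e(0)/κ), history, and 1
    -- for positivity. The denominator is the damping left after absorption.
    refine ⟨(2 * (cF + N) * e 0 + D * Q * (4 / κ * e 0) + D * (2 * η) * (2 * B) + 1) / (m / 2),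
      by positivity, fun y hy => ?_⟩
    have k1 := hmul 0 y le_rfl hy
    have k2 := abs_le.1 (hF 0 le_rfl)
    have k3 := abs_le.1 (hF y hy)
    have k4 := hanti 0 y le_rfl hy
    have k5 := hle 0 y le_rfl hy
    have iS := cS.intervalIntegrable_Ici le_rfl hy
    have idk := cdk.intervalIntegrable_Ici le_rfl hy
    have ihead := chead.intervalIntegrable_Ici le_rfl hy
    have ihist := chist.intervalIntegrable_Ici le_rfl hy
    have k6 : ∫ t in (0 : ℝ)..y, multiplierDensity m D g₀ (φt t) (ψt t) (ψx t) (P t)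
        (memory g P t) ≤ ∫ t in (0 : ℝ)..y, (-m * S t + (D * Q * deviation k P t
          + D * (2 * η) * (headDeviation g P t + 2 * B * historyWeight g P t))) := by
      refine intervalIntegral.integral_mono_on hy (cdens.intervalIntegrable_Ici le_rfl hy)
        ((iS.const_mul _).add ((idk.const_mul _).add ((ihead.add (ihist.const_mul _)).const_mul _)))
        (fun t ht => ?_)
      have r1 := hrem T t hT0 ht.1
      rw [← hQd] at r1
      have r2 : 2 * (∫ s in Ioi T, g s) * deviation g P t
          ≤ 2 * η * (headDeviation g P t + 2 * B * historyWeight g P t) :=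
        mul_le_mul (by linarith) (hdev t ht.1) (U.deviation_nonneg t) (by positivity)
      have r3 := mul_le_mul_of_nonneg_left (r1.trans (add_le_add le_rfl r2)) hD.le
      simp only [multiplierDensity, hS]
      linarith
    rw [intervalIntegral.integral_add (iS.const_mul _)
      ((idk.const_mul _).add ((ihead.add (ihist.const_mul _)).const_mul _)),
      intervalIntegral.integral_add (idk.const_mul _) ((ihead.add (ihist.const_mul _)).const_mul _),
      intervalIntegral.integral_const_mul, intervalIntegral.integral_const_mul,
      intervalIntegral.integral_const_mul, intervalIntegral.integral_add ihead (ihist.const_mul _),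
      intervalIntegral.integral_const_mul] at k6
    have k7 : ∫ t in (0 : ℝ)..y, ‖P t‖ ^ 2 ≤ ∫ t in (0 : ℝ)..y, S t := by
      refine intervalIntegral.integral_mono_on hy ((U.sq.cont.norm.pow 2).intervalIntegrable_Ici
        le_rfl hy) iS (fun t _ => ?_)
      simp only [hS]
      linarith [sq_nonneg ‖φt t‖, sq_nonneg ‖ψt t‖, sq_nonneg ‖ψx t‖]
    have k8 : ∫ t in (0 : ℝ)..y, headDeviation g P t ≤ 4 * ∫ t in (0 : ℝ)..y, S t := by
      refine (hhead y hy).trans ?_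
      have z0 : 0 ≤ ∫ t in (0 : ℝ)..y, ‖P t‖ ^ 2 :=
        intervalIntegral.integral_nonneg hy fun t _ => by positivity
      have z1 := mul_le_of_le_one_left z0 hg₁.le
      linarith
    have k9 : ∫ t in (0 : ℝ)..y, deviation k P t ≤ 4 / κ * e 0 := by
      rw [div_mul_eq_mul_div, le_div_iff₀ h4]
      linarith [hen y]
    have k10 := mul_le_mul_of_nonneg_left k9 (show 0 ≤ D * Q by positivity)
    have k11 := mul_le_mul_of_nonneg_left k8 (show 0 ≤ D * (2 * η) by positivity)
    have k12 : 0 ≤ ∫ t in (0 : ℝ)..y, historyWeight g P t :=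
      intervalIntegral.integral_nonneg hy fun t ht => hhist0 t ht.1
    have k13 : D * (2 * η) * (4 * ∫ t in (0 : ℝ)..y, S t) = m / 2 * ∫ t in (0 : ℝ)..y, S t := by
      rw [← hηd]; ring
    have k14 := mul_le_mul_of_nonneg_left k4 (show 0 ≤ cF + N by positivity)
    have k15 : 0 ≤ (2 * (cF + N) * e 0 + D * Q * (4 / κ * e 0) + 1)
      * ∫ t in (0 : ℝ)..y, historyWeight g P t := by positivity
    have k16 : 0 ≤ D * (2 * η) * (2 * B) := by positivity
    have k17 := mul_nonneg hN.le (hen y)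
    rw [div_mul_eq_mul_div, le_div_iff₀ (by positivity)]
    linarith
  obtain ⟨K₁, hK₁, hSi⟩ := hS_int
  -- One constant for three purposes: the upper bound of the functional, the perturbation in its
  -- decay, and the time integral of the energy.
  obtain ⟨K, hK, hKa, hKb, hKc⟩ : ∃ K, 0 < K ∧ N + 2 * cF + 1 ≤ K ∧
      (m + D) * (2 * B + 1) ≤ K ∧ c' * (5 * K₁ + 2 * B) ≤ K :=
    ⟨N + 2 * cF + 1 + (m + D) * (2 * B + 1) + c' * (5 * K₁ + 2 * B), by positivity,
      by linarith [show 0 ≤ (m + D) * (2 * B + 1) + c' * (5 * K₁ + 2 * B) by positivity],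
      by linarith [show 0 ≤ N + 2 * cF + 1 + c' * (5 * K₁ + 2 * B) by positivity],
      by linarith [show 0 ≤ N + 2 * cF + 1 + (m + D) * (2 * B + 1) by positivity]⟩
  -- N e comes with the integrated multiplier estimate, cF e outweighs |F|, and the last e gives the
  -- lower bound.
  refine ⟨fun t => F t + (N + cF + 1) * e t, m / c', K, by positivity, hK,
    hcF'.add (continuousOn_const.mul hcon), fun t ht => ?_, fun x y hx hxy => ?_, fun y hy => ?_⟩
  · have k3 := abs_le.1 (hF t ht)
    have k4 := hen t
    have k5 := mul_nonneg hN.le k4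
    have k6 := mul_le_mul_of_nonneg_right hKa k4
    constructor
    · linarith [k3.1]
    · linarith [k3.2]
  · have hy := hx.trans hxy
    have k1 := hmul x y hx hxy
    have k2 := mul_le_mul_of_nonneg_left (hanti x y hx hxy) (show 0 ≤ cF + 1 by positivity)
    have k3 : ∫ t in x..y, multiplierDensity m D g₀ (φt t) (ψt t) (ψx t) (P t) (memory g P t)
        ≤ ∫ t in x..y, (-(m / c' * e t) + K * (headDeviation g P t + historyWeight g P t)) := by
      refine intervalIntegral.integral_mono_on hxy (cdens.intervalIntegrable_Ici hx hy)
        (((continuousOn_const.mul hcon).neg.add (continuousOn_const.mul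
          (chead.add chist))).intervalIntegrable_Ici hx hy) (fun t ht => ?_)
      have ht0 : 0 ≤ t := hx.trans ht.1
      have r1 := hrem' t ht0
      have r2 := mul_le_of_le_one_left (U.deviation_nonneg t) hg₁.le
      have r3 := mul_le_mul_of_nonneg_left (r1.trans r2) hD.le
      have r4 : m / c' * e t ≤ m * (S t + deviation g P t) := by
        have := mul_le_mul_of_nonneg_left (hed t) (show 0 ≤ m / c' by positivity)
        refine this.trans_eq ?_
        simp only [hS]
        field_simp
      have r5 := mul_le_mul_of_nonneg_left (hdev t ht0) (show 0 ≤ m + D by positivity)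
      have r6 := mul_nonneg (show 0 ≤ (m + D) * (2 * B) by positivity) (hhead0 t ht0)
      have r7 := mul_nonneg (show 0 ≤ m + D by positivity) (hhist0 t ht0)
      have r8 := mul_le_mul_of_nonneg_right hKb (add_nonneg (hhead0 t ht0) (hhist0 t ht0))
      simp only [multiplierDensity]
      simp only [hS] at r4
      linarith
    linarith
  · have iS := cS.intervalIntegrable_Ici le_rfl hy
    have ihead := chead.intervalIntegrable_Ici le_rfl hy
    have ihist := chist.intervalIntegrable_Ici le_rfl hy
    have k1 : ∫ t in (0 : ℝ)..y, e t ≤ ∫ t in (0 : ℝ)..y,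
        c' * (S t + (headDeviation g P t + 2 * B * historyWeight g P t)) := by
      refine intervalIntegral.integral_mono_on hy (hcon.intervalIntegrable_Ici le_rfl hy)
        ((iS.add (ihead.add (ihist.const_mul _))).const_mul _) (fun t ht => ?_)
      exact (hed t).trans (mul_le_mul_of_nonneg_left (add_le_add le_rfl (hdev t ht.1)) hc'.le)
    rw [intervalIntegral.integral_const_mul, intervalIntegral.integral_add iS
      (ihead.add (ihist.const_mul _)), intervalIntegral.integral_add ihead (ihist.const_mul _),
      intervalIntegral.integral_const_mul] at k1
    have k7 : ∫ t in (0 : ℝ)..y, ‖P t‖ ^ 2 ≤ ∫ t in (0 : ℝ)..y, S t := by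
      refine intervalIntegral.integral_mono_on hy ((U.sq.cont.norm.pow 2).intervalIntegrable_Ici
        le_rfl hy) iS (fun t _ => ?_)
      simp only [hS]
      linarith [sq_nonneg ‖φt t‖, sq_nonneg ‖ψt t‖, sq_nonneg ‖ψx t‖]
    have k8 : ∫ t in (0 : ℝ)..y, headDeviation g P t ≤ 4 * ∫ t in (0 : ℝ)..y, S t := by
      refine (hhead y hy).trans ?_
      have z0 : 0 ≤ ∫ t in (0 : ℝ)..y, ‖P t‖ ^ 2 :=
        intervalIntegral.integral_nonneg hy fun t _ => by positivity
      have z1 := mul_le_of_le_one_left z0 hg₁.le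
      linarith
    have k9 := hSi y hy
    have k12 : 0 ≤ ∫ t in (0 : ℝ)..y, historyWeight g P t :=
      intervalIntegral.integral_nonneg hy fun t ht => hhist0 t ht.1
    have k13 := mul_le_mul_of_nonneg_right hKc
      (show 0 ≤ 1 + ∫ t in (0 : ℝ)..y, historyWeight g P t by positivity)
    have k14 : (∫ t in (0 : ℝ)..y, S t) + ((∫ t in (0 : ℝ)..y, headDeviation g P t)
        + 2 * B * ∫ t in (0 : ℝ)..y, historyWeight g P t)
        ≤ (5 * K₁ + 2 * B) * (1 + ∫ t in (0 : ℝ)..y, historyWeight g P t) := by linarith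
    have k15 := mul_le_mul_of_nonneg_left k14 hc'.le
    linarith

end Lyapunov

/-! ### Convex profiles and the functions G₁ to G₅ -/

theorem continuousOn_integral_Ici {w : ℝ → ℝ} (hw : ContinuousOn w (Ici 0)) :
    ContinuousOn (fun t => ∫ s in (0 : ℝ)..t, w s) (Ici 0) := by
  intro t ht
  have h1 : IntegrableOn w (uIcc 0 (t + 1)) :=
    (hw.mono fun x hx => by rw [uIcc_of_le (by linarith [mem_Ici.1 ht])] at hx; exact hx.1)
      |>.integrableOn_compact isCompact_uIcc
  have h2 := intervalIntegral.continuousOn_primitive_interval h1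
  rw [uIcc_of_le (by linarith [mem_Ici.1 ht])] at h2
  exact (h2 t ⟨ht, by linarith⟩).mono_of_mem_nhdsWithin
    (mem_nhdsWithin.2 ⟨Iio (t + 1), isOpen_Iio, by simp, fun x hx => ⟨hx.2, le_of_lt hx.1⟩⟩)

theorem monotoneOn_integral_Ici {w : ℝ → ℝ} (hw : ContinuousOn w (Ici 0))
    (hw0 : ∀ t, 0 ≤ t → 0 ≤ w t) : MonotoneOn (fun t => ∫ s in (0 : ℝ)..t, w s) (Ici 0) := by
  intro x hx y hy hxy
  simp only
  rw [← intervalIntegral.integral_add_adjacent_intervals (hw.intervalIntegrable_Ici le_rfl hx)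
    (hw.intervalIntegrable_Ici hx hy)]
  exact le_add_of_nonneg_right
    (intervalIntegral.integral_nonneg hxy fun s hs => hw0 s ((mem_Ici.1 hx).trans hs.1))

/-- A convex `C¹` profile vanishing at `0` and positive on `(0, ∞)`. -/
structure IsProfile (F : ℝ → ℝ) : Prop where
  zero : F 0 = 0
  pos : ∀ s, 0 < s → 0 < F s
  convex : ConvexOn ℝ (Ici 0) F
  c1 : ContDiffOn ℝ 1 F (Ici 0)

section Profile

variable {F : ℝ → ℝ}

theorem IsProfile.hasDerivWithinAt (hF : IsProfile F) {s : ℝ} (hs : 0 ≤ s) :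
    HasDerivWithinAt F (dH F s) (Ici 0) s :=
  ((hF.c1.differentiableOn (by norm_num)) s hs).hasDerivWithinAt

theorem IsProfile.continuousOn_dH (hF : IsProfile F) : ContinuousOn (dH F) (Ici 0) :=
  hF.c1.continuousOn_derivWithin (uniqueDiffOn_Ici 0) le_rfl

theorem IsProfile.monotoneOn_dH (hF : IsProfile F) : MonotoneOn (dH F) (Ici 0) :=
  hF.convex.monotoneOn_derivWithin (hF.c1.differentiableOn (by norm_num))

/-- The graph of a profile lies above its tangents. -/
theorem IsProfile.tangent_le (hF : IsProfile F) {z u : ℝ} (hz : 0 ≤ z) (hu : 0 ≤ u) :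
    F z + (u - z) * dH F z ≤ F u := by
  rcases lt_trichotomy u z with h | h | h
  · have h1 := hF.convex.slope_le_of_hasDerivWithinAt (mem_Ici.2 hu) (mem_Ici.2 hz) h
      (hF.hasDerivWithinAt hz)
    rw [slope_def_field, div_le_iff₀ (sub_pos.2 h)] at h1
    nlinarith
  · subst h; simp
  · have h1 := hF.convex.le_slope_of_hasDerivWithinAt (mem_Ici.2 hz) (mem_Ici.2 hu) h
      (hF.hasDerivWithinAt hz)
    rw [slope_def_field, le_div_iff₀ (sub_pos.2 h)] at h1
    nlinarith

theorem IsProfile.dH_pos (hF : IsProfile F) {s : ℝ} (hs : 0 < s) : 0 < dH F s := by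
  have h1 := hF.tangent_le hs.le le_rfl
  have h2 := hF.pos s hs
  rw [hF.zero] at h1
  by_contra h
  nlinarith

theorem IsProfile.nonneg (hF : IsProfile F) {s : ℝ} (hs : 0 ≤ s) : 0 ≤ F s := by
  rcases hs.eq_or_lt with h | h
  · rw [← h, hF.zero]
  · exact (hF.pos s h).le

theorem IsProfile.dH_nonneg (hF : IsProfile F) {s : ℝ} (hs : 0 ≤ s) : 0 ≤ dH F s := by
  have h : Tendsto (dH F) (𝓝[>] s) (𝓝 (dH F s)) :=
    (hF.continuousOn_dH s hs).mono_left (nhdsWithin_mono _ fun x hx => hs.trans (le_of_lt hx))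
  exact ge_of_tendsto h (eventually_mem_nhdsWithin.mono fun x hx => (hF.dH_pos (hs.trans_lt hx)).le)

theorem IsProfile.monotoneOn (hF : IsProfile F) : MonotoneOn F (Ici 0) := by
  intro x hx y hy hxy
  have h1 := hF.tangent_le hx hy
  have h2 := hF.dH_nonneg hx
  nlinarith [mul_nonneg (sub_nonneg.2 hxy) h2]

/-- Convexity together with F(0) = 0: the graph lies below the chord from the origin. -/
theorem IsProfile.le_mul (hF : IsProfile F) {x y : ℝ} (hx : 0 ≤ x) (hxy : x ≤ y) (hy : 0 < y) :
    F x ≤ F y / y * x := by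
  have h1 : F ((1 - x / y) • 0 + (x / y) • y) ≤ (1 - x / y) • F 0 + (x / y) • F y :=
    hF.convex.2 (mem_Ici.2 le_rfl) (mem_Ici.2 hy.le) (sub_nonneg.2 ((div_le_one hy).2 hxy)) (div_nonneg hx hy.le) (by ring)
  simp only [smul_eq_mul, mul_zero, zero_add, hF.zero] at h1
  rw [div_mul_cancel₀ _ hy.ne'] at h1
  calc F x ≤ x / y * F y := h1
    _ = F y / y * x := by ring

theorem IsProfile.monotoneOn_G₂ (hF : IsProfile F) : MonotoneOn (G₂ F) (Ici 0) := fun _ hx _ hy h =>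
  mul_le_mul h (hF.monotoneOn_dH hx hy h) (hF.dH_nonneg hx) hy

theorem IsProfile.G₂_pos (hF : IsProfile F) {s : ℝ} (hs : 0 < s) : 0 < G₂ F s :=
  mul_pos hs (hF.dH_pos hs)

theorem dHInv_le {t τ : ℝ} (h0 : 0 ≤ τ) (h : t ≤ dH F τ) : dHInv F t ≤ τ :=
  csInf_le ⟨0, fun _ hx => hx.1⟩ ⟨h0, h⟩

theorem IsProfile.le_of_lt_dH (hF : IsProfile F) {t x : ℝ} (hx : 0 ≤ x)
    (hne : ∃ τ, 0 ≤ τ ∧ t ≤ dH F τ) (h : dH F x < t) : x ≤ dHInv F t := by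
  refine le_csInf hne fun τ hτ => ?_
  by_contra hlt
  exact absurd (hF.monotoneOn_dH (mem_Ici.2 hτ.1) (mem_Ici.2 hx) (not_le.1 hlt).le)
    (not_le.2 (h.trans_le hτ.2))

/-- Young's inequality for the pair `G₃`, `G₄`. -/
theorem IsProfile.mul_dH_le (hF : IsProfile F) {x z : ℝ} (hx : 0 ≤ x) (hz : 0 ≤ z) :
    x * dH F z ≤ G₄ F x + G₂ F z := by
  -- The supremum is finite: for t ≤ F'(x) the expression is at most x F'(x), and for larger t the
  -- generalized inverse is at least x, so it is nonpositive.
  have hb : BddAbove ((fun t => x * t - G₃ F t) '' {t | 0 ≤ t ∧ ∃ τ, 0 ≤ τ ∧ t ≤ dH F τ}) := by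
    refine ⟨x * dH F x, ?_⟩
    rintro _ ⟨t, ⟨ht, hne⟩, rfl⟩
    have h0 : 0 ≤ dHInv F t := Real.sInf_nonneg fun _ hx => hx.1
    have h1 := hF.dH_nonneg hx
    simp only [G₃]
    rcases le_or_gt t (dH F x) with h | h
    · nlinarith [mul_le_mul_of_nonneg_left h hx, mul_nonneg ht h0]
    · nlinarith [mul_le_mul_of_nonneg_left (hF.le_of_lt_dH hx hne h) ht, mul_nonneg hx h1]
  have h1 := le_csSup hb ⟨dH F z, ⟨hF.dH_nonneg hz, z, hz, le_rfl⟩, rfl⟩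
  have h2 := mul_le_mul_of_nonneg_left (dHInv_le hz (le_refl (dH F z))) (hF.dH_nonneg hz)
  simp only [G₃] at h1
  change _ ≤ G₄ F x at h1
  simp only [G₂]
  linarith

theorem IsProfile.continuousOn_integrand (hF : IsProfile F) :
    ContinuousOn (fun s => 1 / (s * dH F s)) (Ioi 0) :=
  continuousOn_const.div (continuousOn_id.mul (hF.continuousOn_dH.mono Ioi_subset_Ici_self))
    fun _ hs => (mul_pos hs (hF.dH_pos hs)).ne'

theorem IsProfile.intervalIntegrable (hF : IsProfile F) {x y : ℝ} (hx : 0 < x) (hy : 0 < y) :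
    IntervalIntegrable (fun s => 1 / (s * dH F s)) volume x y :=
  (hF.continuousOn_integrand.mono fun _ hs => (lt_min hx hy).trans_le hs.1).intervalIntegrable

theorem IsProfile.G₁_sub (hF : IsProfile F) {x y : ℝ} (hx : 0 < x) (hy : 0 < y) :
    G₁ F x - G₁ F y = ∫ s in x..y, 1 / (s * dH F s) := by
  rw [G₁, G₁, sub_eq_iff_eq_add, intervalIntegral.integral_add_adjacent_intervals
    (hF.intervalIntegrable hx hy) (hF.intervalIntegrable hy one_pos)]

theorem IsProfile.hasDerivAt_G₁ (hF : IsProfile F) {x : ℝ} (hx : 0 < x) :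
    HasDerivAt (G₁ F) (-(1 / (x * dH F x))) x :=
  intervalIntegral.integral_hasDerivAt_left (hF.intervalIntegrable hx one_pos)
    (hF.continuousOn_integrand.stronglyMeasurableAtFilter isOpen_Ioi x hx)
    (hF.continuousOn_integrand.continuousAt (Ioi_mem_nhds hx))

/-- On (0, 1] the integrand is at least 1/F'(1). This bound from below on the slope makes the
inverse of G₁ single-valued and Lipschitz. -/
theorem IsProfile.sub_le_G₁ (hF : IsProfile F) {x y : ℝ} (hx : 0 < x) (hxy : x ≤ y) (hy : y ≤ 1) :
    (y - x) * (1 / dH F 1) ≤ G₁ F x - G₁ F y := by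
  rw [hF.G₁_sub hx (hx.trans_le hxy), ← smul_eq_mul, ← intervalIntegral.integral_const]
  refine intervalIntegral.integral_mono_on hxy intervalIntegrable_const
    (hF.intervalIntegrable hx (hx.trans_le hxy)) fun s hs => ?_
  have hs0 : 0 < s := hx.trans_le hs.1
  refine one_div_le_one_div_of_le (mul_pos hs0 (hF.dH_pos hs0)) ?_
  calc s * dH F s ≤ 1 * dH F 1 := mul_le_mul (hs.2.trans hy)
        (hF.monotoneOn_dH hs0.le (mem_Ici.2 zero_le_one) (hs.2.trans hy)) (hF.dH_pos hs0).le
        zero_le_one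
    _ = dH F 1 := one_mul _

/-- Since s F'(s) ≤ s F'(1) on (0, 1], G₁(x) is at least -log x / F'(1). The point x is where this
lower bound equals u, and the intermediate value theorem does the rest. -/
theorem IsProfile.surjOn_G₁ (hF : IsProfile F) : SurjOn (G₁ F) (Ioc 0 1) (Ici 0) := by
  intro u hu
  have hd := hF.dH_pos one_pos
  set x := Real.exp (-(dH F 1 * u))
  have hx : 0 < x := Real.exp_pos _
  have hx1 : x ≤ 1 := Real.exp_le_one_iff.2 (neg_nonpos.2 (mul_nonneg hd.le hu))
  have h1 : u ≤ G₁ F x := by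
    have h2 : ∫ s in x..1, (1 / dH F 1) * (1 / s) ≤ G₁ F x := by
      refine intervalIntegral.integral_mono_on hx1 ?_ (hF.intervalIntegrable hx one_pos)
        fun s hs => ?_
      · refine ContinuousOn.intervalIntegrable ?_
        refine continuousOn_const.mul (continuousOn_const.div continuousOn_id fun s hs => ?_)
        rw [uIcc_of_le hx1] at hs
        exact (hx.trans_le hs.1).ne'
      · have hs0 : 0 < s := hx.trans_le hs.1
        rw [one_div_mul_one_div, mul_comm]
        refine one_div_le_one_div_of_le (mul_pos hs0 (hF.dH_pos hs0)) ?_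
        exact mul_le_mul_of_nonneg_left (hF.monotoneOn_dH hs0.le (mem_Ici.2 zero_le_one) hs.2) hs0.le
    rw [intervalIntegral.integral_const_mul, integral_one_div_of_pos hx one_pos, Real.log_div
      one_ne_zero hx.ne', Real.log_one, Real.log_exp] at h2
    refine le_trans (le_of_eq ?_) h2
    field_simp
    ring
  have h3 : G₁ F 1 = 0 := intervalIntegral.integral_same
  have hc : ContinuousOn (G₁ F) (Icc x 1) := fun s hs =>
    (hF.hasDerivAt_G₁ (hx.trans_le hs.1)).continuousAt.continuousWithinAt
  obtain ⟨y, hy, rfl⟩ := intermediate_value_Icc' hx1 hc ⟨h3.trans_le hu, h1⟩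
  exact ⟨y, ⟨hx.trans_le hy.1, hy.2⟩, rfl⟩

/-- The inverse of `G₁ : (0, 1] → [0, ∞)`. -/
def G₁Inv (F : ℝ → ℝ) (u : ℝ) : ℝ := Function.invFunOn (G₁ F) (Ioc 0 1) u

theorem IsProfile.G₁Inv_mem (hF : IsProfile F) {u : ℝ} (hu : 0 ≤ u) : G₁Inv F u ∈ Ioc (0 : ℝ) 1 :=
  Function.invFunOn_mem (hF.surjOn_G₁ hu)

theorem IsProfile.G₁_G₁Inv (hF : IsProfile F) {u : ℝ} (hu : 0 ≤ u) : G₁ F (G₁Inv F u) = u :=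
  Function.invFunOn_eq (hF.surjOn_G₁ hu)

theorem IsProfile.abs_G₁Inv_sub_le (hF : IsProfile F) {u v : ℝ} (hu : 0 ≤ u) (hv : 0 ≤ v) :
    |G₁Inv F u - G₁Inv F v| ≤ dH F 1 * |u - v| := by
  have hd := hF.dH_pos one_pos
  wlog h : G₁Inv F u ≤ G₁Inv F v generalizing u v
  · rw [abs_sub_comm, abs_sub_comm u]
    exact this hv hu (not_le.1 h).le
  have h1 := hF.sub_le_G₁ (hF.G₁Inv_mem hu).1 h (hF.G₁Inv_mem hv).2
  rw [hF.G₁_G₁Inv hu, hF.G₁_G₁Inv hv, mul_one_div, div_le_iff₀ hd] at h1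
  rw [abs_sub_comm, abs_of_nonneg (sub_nonneg.2 h)]
  calc _ ≤ (u - v) * dH F 1 := h1
    _ ≤ |u - v| * dH F 1 := by gcongr; exact le_abs_self _
    _ = _ := mul_comm _ _

theorem IsProfile.continuousOn_G₁Inv (hF : IsProfile F) : ContinuousOn (G₁Inv F) (Ici 0) := by
  refine (LipschitzOnWith.of_dist_le_mul (K := ⟨dH F 1, (hF.dH_pos one_pos).le⟩)
    fun x hx y hy => ?_).continuousOn
  exact hF.abs_G₁Inv_sub_le hx hy

theorem IsProfile.G₁Inv_zero (hF : IsProfile F) : G₁Inv F 0 = 1 := by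
  have h1 := hF.G₁Inv_mem le_rfl
  have h2 := hF.sub_le_G₁ h1.1 h1.2 le_rfl
  have h3 : G₁ F 1 = 0 := intervalIntegral.integral_same
  rw [hF.G₁_G₁Inv le_rfl, h3, sub_zero] at h2
  have h4 : 0 < 1 / dH F 1 := one_div_pos.2 (hF.dH_pos one_pos)
  refine le_antisymm h1.2 (not_lt.1 fun h => ?_)
  nlinarith [mul_pos (sub_pos.2 h) h4]

/-- The inverse of G₁ solves y' = -G₂(y), the equation against which the energy is compared. -/
theorem IsProfile.hasDerivAt_G₁Inv (hF : IsProfile F) {u : ℝ} (hu : 0 < u) :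
    HasDerivAt (G₁Inv F) (-G₂ F (G₁Inv F u)) u := by
  have hx := (hF.G₁Inv_mem hu.le).1
  have hp := mul_pos hx (hF.dH_pos hx)
  have h := HasDerivAt.of_local_left_inverse
    (hF.continuousOn_G₁Inv.continuousAt (Ici_mem_nhds hu)) (hF.hasDerivAt_G₁ hx)
    (neg_ne_zero.2 (one_div_pos.2 hp).ne')
    (Filter.mem_of_superset (Ici_mem_nhds hu) fun y hy => hF.G₁_G₁Inv hy)
  refine h.congr_deriv ?_
  rw [inv_neg, one_div, inv_inv]
  rfl

variable {ξ : ℝ → ℝ} {c₁ : ℝ}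

theorem integral_nonneg_of_pos (hξ0 : ∀ t, 0 ≤ t → 0 < ξ t) {t : ℝ} (ht : 0 ≤ t) :
    0 ≤ ∫ s in (0 : ℝ)..t, ξ s :=
  intervalIntegral.integral_nonneg ht fun s hs => (hξ0 s hs.1).le

theorem IsProfile.G₅_mem (hF : IsProfile F) (hξ0 : ∀ t, 0 ≤ t → 0 < ξ t) (hc : 0 < c₁) {t : ℝ}
    (ht : 0 ≤ t) : G₅ F ξ c₁ t ∈ Ioc (0 : ℝ) 1 :=
  hF.G₁Inv_mem (mul_nonneg hc.le (integral_nonneg_of_pos hξ0 ht))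

theorem IsProfile.G₅_zero (hF : IsProfile F) : G₅ F ξ c₁ 0 = 1 := by
  simp only [G₅, intervalIntegral.integral_same, mul_zero]
  exact hF.G₁Inv_zero

theorem IsProfile.continuousOn_G₅ (hF : IsProfile F) (hξ0 : ∀ t, 0 ≤ t → 0 < ξ t)
    (hξ : ContinuousOn ξ (Ici 0)) (hc : 0 < c₁) : ContinuousOn (G₅ F ξ c₁) (Ici 0) := by
  have h := (continuousOn_integral_Ici hξ).const_mul c₁
  exact hF.continuousOn_G₁Inv.comp h fun t ht => mul_nonneg hc.le (integral_nonneg_of_pos hξ0 ht)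

theorem IsProfile.hasDerivAt_G₅ (hF : IsProfile F) (hξ0 : ∀ t, 0 ≤ t → 0 < ξ t)
    (hξ : ContinuousOn ξ (Ici 0)) (hc : 0 < c₁) {t : ℝ} (ht : 0 < t) :
    HasDerivAt (G₅ F ξ c₁) (-(c₁ * ξ t * G₂ F (G₅ F ξ c₁ t))) t := by
  have h1 : HasDerivAt (fun t => c₁ * ∫ s in (0 : ℝ)..t, ξ s) (c₁ * ξ t) t :=
    (intervalIntegral.integral_hasDerivAt_right (hξ.intervalIntegrable_Ici le_rfl ht.le)
      ((hξ.mono Ioi_subset_Ici_self).stronglyMeasurableAtFilter isOpen_Ioi t ht)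
      (hξ.continuousAt (Ici_mem_nhds ht))).const_mul c₁
  have h2 : 0 < ∫ s in (0 : ℝ)..t, ξ s :=
    intervalIntegral.intervalIntegral_pos_of_pos_on (hξ.intervalIntegrable_Ici le_rfl ht.le)
      (fun s hs => hξ0 s hs.1.le) ht
  have h3 := (hF.hasDerivAt_G₁Inv (mul_pos hc h2)).comp t h1
  refine h3.congr_deriv ?_
  change -G₂ F (G₅ F ξ c₁ t) * (c₁ * ξ t) = _
  ring

/-- The comparison starts at t = 0, where only a right derivative makes sense. It is obtained as the
limit of the derivatives at later times. -/
theorem IsProfile.hasDerivWithinAt_G₅ (hF : IsProfile F) (hξ0 : ∀ t, 0 ≤ t → 0 < ξ t)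
    (hξ : ContinuousOn ξ (Ici 0)) (hc : 0 < c₁) {t : ℝ} (ht : 0 ≤ t) :
    HasDerivWithinAt (G₅ F ξ c₁) (-(c₁ * ξ t * G₂ F (G₅ F ξ c₁ t))) (Ici t) t := by
  have hd : ∀ s ∈ Ioi t, HasDerivAt (G₅ F ξ c₁) (-(c₁ * ξ s * G₂ F (G₅ F ξ c₁ s))) s :=
    fun s hs => hF.hasDerivAt_G₅ hξ0 hξ hc (ht.trans_lt hs)
  have hG := hF.continuousOn_G₅ hξ0 hξ hc
  refine hasDerivWithinAt_Ici_of_tendsto_deriv (s := Ioi t)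
    (fun s hs => (hd s hs).differentiableAt.differentiableWithinAt)
    ((hG t ht).mono fun s hs => ht.trans (le_of_lt hs)) self_mem_nhdsWithin ?_
  have h1 : ContinuousOn (fun s => -(c₁ * ξ s * G₂ F (G₅ F ξ c₁ s))) (Ici 0) :=
    ((continuousOn_const.mul hξ).mul (hG.mul (hF.continuousOn_dH.comp hG fun s hs =>
      (hF.G₅_mem hξ0 hc hs).1.le))).neg
  refine (((h1 t ht).mono fun s hs => ht.trans (le_of_lt hs)).tendsto).congr' ?_
  exact eventually_mem_nhdsWithin.mono fun s hs => (hd s hs).deriv.symm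

end Profile

/-! ### From the beam and its kernel to the abstract setting -/

section Concrete

variable {B : Beam} {g ξ H Hbar : ℝ → ℝ} {r : ℝ}

theorem AssumptionA1.isKernel (h : AssumptionA1 B g) : IsKernel g :=
  ⟨h.pos, h.anti, h.diff.continuousOn, h.int⟩

theorem AssumptionA2.eqOn (h : AssumptionA2 g ξ H r) (hb : IsExtendedProfile H r Hbar) :
    EqOn Hbar H (Icc 0 r) := by
  rcases h.shape with h1 | h1
  · exact (hb.1 h1).mono fun x hx => hx.1
  · exact (hb.2 h1).eqOn

theorem AssumptionA2.isProfile (h : AssumptionA2 g ξ H r) (hb : IsExtendedProfile H r Hbar) :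
    IsProfile Hbar := by
  have h0 : Hbar 0 = H 0 := h.eqOn hb ⟨le_rfl, h.r_pos.le⟩
  rcases h.shape with h1 | h1
  · have he := hb.1 h1
    obtain ⟨a, ha, hH⟩ := h1
    refine ⟨by rw [h0, hH 0 le_rfl, mul_zero], fun s hs => ?_, ?_, h.H_c1.congr he⟩
    · rw [he hs.le]
      exact h.H_pos s hs
    · refine ⟨convex_Ici 0, fun x hx y hy p q hp hq _ => le_of_eq ?_⟩
      have hxy : 0 ≤ p • x + q • y := add_nonneg (mul_nonneg hp hx) (mul_nonneg hq hy)
      rw [he hxy, he hx, he hy, hH _ hxy, hH _ hx, hH _ hy]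
      simp only [smul_eq_mul]
      ring
  · have he := hb.2 h1
    have hz : Hbar 0 = 0 := h0.trans h1.zero
    refine ⟨hz, fun s hs => ?_, he.strictConvex.convexOn, he.c1⟩
    have := he.strictMono (mem_Ici.2 le_rfl) (mem_Ici.2 hs.le) hs
    rwa [hz] at this

/-- H and its extension agree only up to r, while g may start above r. On a compact interval beyond
r, the positive minimum of H is compared with the largest value of the extension. -/
theorem AssumptionA2.exists_mul_le (h : AssumptionA2 g ξ H r) (hb : IsExtendedProfile H r Hbar)
    (M : ℝ) : ∃ c, 0 < c ∧ ∀ x, 0 < x → x ≤ M → c * Hbar x ≤ H x := by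
  have hF := h.isProfile hb
  have hr := h.r_pos
  set R := max r M
  have hR : 0 < R := hr.trans_le (le_max_left _ _)
  have hc : ContinuousOn H (Icc r R) := h.H_c1.continuousOn.mono fun x hx => hr.le.trans hx.1
  obtain ⟨x₀, hx₀, hmin⟩ := isCompact_Icc.exists_isMinOn (nonempty_Icc.2 (le_max_left r M)) hc
  have hm : 0 < H x₀ := h.H_pos x₀ (hr.trans_le hx₀.1)
  have hB : 0 < Hbar R := hF.pos R hR
  refine ⟨min 1 (H x₀ / Hbar R), lt_min one_pos (div_pos hm hB), fun x hx hxM => ?_⟩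
  have hx1 := hF.nonneg hx.le
  rcases le_total x r with hxr | hxr
  · calc _ ≤ 1 * Hbar x := by gcongr; exact min_le_left _ _
      _ = H x := by rw [one_mul, h.eqOn hb ⟨hx.le, hxr⟩]
  · have hxR : x ≤ R := hxM.trans (le_max_right _ _)
    calc _ ≤ H x₀ / Hbar R * Hbar R := mul_le_mul (min_le_right _ _)
          (hF.monotoneOn hx.le hR.le hxR) hx1 (div_pos hm hB).le
      _ = H x₀ := div_mul_cancel₀ _ hB.ne'
      _ ≤ H x := hmin ⟨hxr, hxR⟩

/-- The kernel inequality makes a multiple of `ξ(s) H(g(s))` a dissipation kernel. -/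
theorem AssumptionA2.exists_dissipationKernel (h : AssumptionA2 g ξ H r) (hA1 : AssumptionA1 B g)
    (hb : IsExtendedProfile H r Hbar) :
    ∃ c C, 0 < c ∧ DissipationKernel g (fun s => c * (ξ s * Hbar (g s))) C := by
  have hF := h.isProfile hb
  have hg := hA1.isKernel
  obtain ⟨c, hc, hle⟩ := h.exists_mul_le hb (g 0)
  have hg0 := hg.pos 0 le_rfl
  have hpos : ∀ s, 0 ≤ s → 0 < c * (ξ s * Hbar (g s)) := fun s hs =>
    mul_pos hc (mul_pos (h.ξ_pos s hs) (hF.pos _ (hg.pos s hs)))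
  have hanti : AntitoneOn (fun s => c * (ξ s * Hbar (g s))) (Ici 0) := fun x hx y hy hxy =>
    mul_le_mul_of_nonneg_left (mul_le_mul (h.ξ_anti hx hy hxy)
      (hF.monotoneOn (hg.pos y hy).le (hg.pos x hx).le (hg.anti hx hy hxy))
      (hF.pos _ (hg.pos y hy)).le (h.ξ_pos x hx).le) hc.le
  refine ⟨c, c * (ξ 0 * (Hbar (g 0) / g 0)), hc, ⟨?_, fun s hs => ?_⟩, hpos, hanti,
    fun s t hs ht => ?_⟩
  · exact continuousOn_const.mul (h.ξ_diff.continuousOn.mul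
      (hF.c1.continuousOn.comp hg.cont fun s hs => (hg.pos s hs).le))
  · rw [abs_of_pos (hpos s hs)]
    have h1 := hF.le_mul (hg.pos s hs).le (hg.le_zero hs) hg0
    calc _ ≤ c * (ξ 0 * (Hbar (g 0) / g 0 * g s)) :=
          mul_le_mul_of_nonneg_left (mul_le_mul (h.ξ_anti (mem_Ici.2 le_rfl) hs hs) h1
            (hF.pos _ (hg.pos s hs)).le (h.ξ_pos 0 le_rfl).le) hc.le
      _ = _ := by ring
  · have hst : s ≤ s + t := by linarith
    have hsub : Icc s (s + t) ⊆ Ici (0 : ℝ) := fun x hx => hs.trans hx.1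
    -- Mean value inequality: on (s, s+t) the derivative of g is at most minus the kernel at the
    -- same point, hence at most minus its value at s + t.
    have h1 := (convex_Icc s (s + t)).image_sub_le_mul_sub_of_deriv_le
      (C := -(c * (ξ (s + t) * Hbar (g (s + t))))) (hg.cont.mono hsub)
      (hA1.diff.mono (interior_subset.trans hsub)) (fun x hx => ?_) s ⟨le_rfl, hst⟩ (s + t)
      ⟨hst, le_rfl⟩ hst
    · linarith
    · rw [interior_Icc] at hx
      have hx0 : 0 < x := hs.trans_lt hx.1
      rw [← derivWithin_of_mem_nhds (Ici_mem_nhds hx0)]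
      have h2 := hanti (mem_Ici.2 hx0.le) (mem_Ici.2 (hx0.le.trans hx.2.le)) hx.2.le
      have h3 := mul_le_mul_of_nonneg_left (hle (g x) (hg.pos x hx0.le) (hg.le_zero hx0.le))
        (h.ξ_pos x hx0.le).le
      have h4 := h.decay x hx0.le
      simp only at h2
      linarith [mul_left_comm c (ξ x) (Hbar (g x))]

variable {D : InitialData B.L} {U : Trajectory B.L}

theorem IsWeakSolution.px_neg (hU : IsWeakSolution B g D U) {s : ℝ} (hs : 0 ≤ s) :
    U.px (-s) = D.shear s := by
  rw [Trajectory.px, hU.φx_hist s hs, hU.ψ_hist s hs, InitialData.shear]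

theorem IsWeakSolution.hasSqMemory (hU : IsWeakSolution B g D U) (hD : D.Admissible g) :
    HasSqMemory g U.px := by
  refine ⟨hU.φx_cont.add hU.ψ_cont, ?_, ?_⟩
  · refine hD.shear_meas.congr ?_
    filter_upwards [ae_restrict_mem measurableSet_Ioi] with s hs
    exact (hU.px_neg (le_of_lt hs)).symm
  · refine hD.shear_int.congr_fun (fun s hs => ?_) measurableSet_Ioi
    simp only [hU.px_neg (le_of_lt hs)]

theorem IsWeakSolution.px_mem (hU : IsWeakSolution B g D U) (hD : D.Admissible g) (t : ℝ) :
    U.px t ∈ meanZeroSubmodule B.L := by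
  rcases le_total 0 t with ht | ht
  · exact add_mem (MemH10.spec B.L_pos (hU.φ_mem t ht)).1 (hU.ψ_mem t ht).2
  · have hs := neg_nonneg.2 ht
    have := hU.px_neg hs
    rw [neg_neg] at this
    rw [this]
    exact add_mem (MemH10.spec B.L_pos (hD.φ₀_mem _ hs)).1 (hD.ψ₀_mem _ hs).2

/-- The Timoshenko system in terms of the shear and the primitive operator. -/
theorem IsWeakSolution.abstractSolution (hU : IsWeakSolution B g D U) (hA1 : AssumptionA1 B g)
    (hspeed : B.κ / B.ρ₁ = B.b / B.ρ₂) (hD : D.Admissible g) :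
    AbstractSolution (primitive B.L) (meanZeroSubmodule B.L) g B.ρ₁ B.ρ₂ B.b B.κ U.px U.φt U.ψ U.ψx
      U.ψt := by
  have hφ : ∀ t, 0 ≤ t → primitive B.L (U.px t - U.ψ t) = U.φ t := fun t ht => by
    rw [Trajectory.px, add_sub_cancel_right]
    exact (MemH10.spec B.L_pos (hU.φ_mem t ht)).2.symm
  exact {
    ρ₁_pos := B.ρ₁_pos
    ρ₂_pos := B.ρ₂_pos
    b_pos := B.b_pos
    κ_pos := B.κ_pos
    speed := by
      rw [div_eq_div_iff B.ρ₁_pos.ne' B.ρ₂_pos.ne'] at hspeed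
      exact hspeed.symm
    kernel := hA1.isKernel
    int_lt := sub_pos.1 hA1.int_lt
    closed := isClosed_meanZeroSubmodule B.L
    sq := hU.hasSqMemory hD
    P_mem := hU.px_mem hD
    ψ_mem := fun t ht => (hU.ψ_mem t ht).2
    ψt_mem := hU.ψt_mem
    weak := fun t ht f hf => (hU.ψ_mem t ht).1.inner_eq B.L_pos hf
    φt_cont := hU.φt_cont
    ψ_cont := hU.ψ_cont
    ψx_cont := hU.ψx_cont
    ψt_cont := hU.ψt_cont
    φ_deriv := fun t ht => (hU.φ_deriv t ht).congr hφ (hφ t ht)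
    ψ_deriv := hU.ψ_deriv
    eq_φ := fun f hf t ht => hU.eq_φ _ f (memH10_primitive B.L_pos.le hf) t ht
    eq_ψ := fun v hv w hw t ht => hU.eq_ψ v w ⟨hasWeakDeriv_of_inner hw, hv⟩ t ht }

theorem IsWeakSolution.h₀_eq (hU : IsWeakSolution B g D U) (t : ℝ) :
    h₀ g D t = historyWeight g U.px t :=
  setIntegral_congr_fun measurableSet_Ioi fun s hs => by
    simp only [hU.px_neg (le_of_lt hs)]

theorem energy_eq_abstractEnergy (B : Beam) (g : ℝ → ℝ) (U : Trajectory B.L) (t : ℝ) :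
    energy B g U t = abstractEnergy g B.ρ₁ B.ρ₂ B.b B.κ U.px U.φt U.ψx U.ψt t := rfl

end Concrete

/-! ### The comparison argument -/

/-- A function whose forward increments are dominated by the integral of a continuous function
has its forward slopes eventually below any bound for the integrand. -/
theorem eventually_slope_lt {f Φ : ℝ → ℝ} {t r : ℝ} (ht : 0 ≤ t) (hΦ : ContinuousOn Φ (Ici 0))
    (h : ∀ y, t < y → f y - f t ≤ ∫ τ in t..y, Φ τ) (hr : Φ t < r) :
    ∀ᶠ y in 𝓝[>] t, slope f t y < r := by
  have hm : Ici (0 : ℝ) ∈ 𝓝[>] t := Filter.mem_of_superset self_mem_nhdsWithin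
    fun x hx => ht.trans (le_of_lt hx)
  have h1 : HasDerivWithinAt (fun y => ∫ τ in t..y, Φ τ) (Φ t) (Ici t) t :=
    intervalIntegral.integral_hasDerivWithinAt_right (by simp)
      ⟨Ioi t, self_mem_nhdsWithin, (hΦ.mono fun x hx => ht.trans (le_of_lt hx)).aestronglyMeasurable
        measurableSet_Ioi⟩
      ((hΦ t ht).mono fun x hx => ht.trans (le_of_lt hx))
  have h2 := (hasDerivWithinAt_iff_tendsto_slope' self_notMem_Ioi).1 h1.Ioi_of_Ici
  filter_upwards [h2.eventually (gt_mem_nhds hr), self_mem_nhdsWithin] with y hy hty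
  refine lt_of_le_of_lt ?_ hy
  rw [slope_def_field, slope_def_field, intervalIntegral.integral_same, sub_zero]
  exact div_le_div_of_nonneg_right (h y hty) (sub_pos.2 hty).le

section Decay

variable {F ξ e Λ D w z q χ : ℝ → ℝ} {m K ρ σ : ℝ}

/-- The energy estimates from which the decay rate follows: `Λ` is a Lyapunov functional equivalent
to `e`, whose decay is spoiled by `D` and `w`; the dissipation `z` of `e` controls `D` up to the
convexity defect of the profile `F`. -/
structure DecayEstimates (F ξ e Λ D w z q : ℝ → ℝ) (m K ρ σ : ℝ) : Prop where
  m_pos : 0 < m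
  K_pos : 0 < K
  ρ_pos : 0 < ρ
  σ_pos : 0 < σ
  ξ_pos : ∀ t, 0 ≤ t → 0 < ξ t
  ξ_anti : AntitoneOn ξ (Ici 0)
  ξ_cont : ContinuousOn ξ (Ici 0)
  q_pos : ∀ t, 0 ≤ t → 0 < q t
  q_anti : AntitoneOn q (Ici 0)
  q_cont : ContinuousOn q (Ici 0)
  q_zero : q 0 ≤ 1
  e_cont : ContinuousOn e (Ici 0)
  Λ_cont : ContinuousOn Λ (Ici 0)
  D_cont : ContinuousOn D (Ici 0)
  w_cont : ContinuousOn w (Ici 0)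
  z_cont : ContinuousOn z (Ici 0)
  e_nonneg : ∀ t, 0 ≤ t → 0 ≤ e t
  e_anti : AntitoneOn e (Ici 0)
  w_nonneg : ∀ t, 0 ≤ t → 0 ≤ w t
  equiv : ∀ t, 0 ≤ t → e t ≤ Λ t ∧ Λ t ≤ K * e t
  lyapunov : ∀ x y, 0 ≤ x → x ≤ y → Λ y ≤ Λ x + ∫ t in x..y, (-(m * e t) + K * (D t + w t))
  dissipation : ∀ x y, 0 ≤ x → x ≤ y → e y + ρ * ∫ t in x..y, z t ≤ e x
  control : ∀ t, 0 ≤ t → ∀ x, 0 ≤ x →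
    ξ t * (dH F x * (q t * D t)) ≤ σ * (q t * z t) + ξ t * (x * dH F x)

/-- The functional to which the comparison principle is applied. -/
def weightedFunctional (F ξ e Λ q : ℝ → ℝ) (ε γ t : ℝ) : ℝ :=
  ξ t * dH F (ε * (q t * e t)) * q t * Λ t + γ * (q t * e t)

/-- A bound for the forward derivative at `t` of the weighted functional, as a function of the
time `τ` after `t`. -/
def weightedRate (F ξ e D w z q : ℝ → ℝ) (m K ρ ε γ t τ : ℝ) : ℝ :=
  ξ t * dH F (ε * (q t * e t)) * q t * (-(m * e τ) + K * (D τ + w τ)) - γ * ρ * q t * z τ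

theorem DecayEstimates.qe_anti (h : DecayEstimates F ξ e Λ D w z q m K ρ σ) :
    AntitoneOn (fun t => q t * e t) (Ici 0) := fun x hx y hy hxy =>
  mul_le_mul (h.q_anti hx hy hxy) (h.e_anti hx hy hxy) (h.e_nonneg y hy) (h.q_pos x hx).le

theorem DecayEstimates.qe_nonneg (h : DecayEstimates F ξ e Λ D w z q m K ρ σ) {t : ℝ} (ht : 0 ≤ t) :
    0 ≤ q t * e t := mul_nonneg (h.q_pos t ht).le (h.e_nonneg t ht)

theorem DecayEstimates.dH_nonneg (h : DecayEstimates F ξ e Λ D w z q m K ρ σ) (hF : IsProfile F)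
    {ε : ℝ} (hε : 0 < ε) {t : ℝ} (ht : 0 ≤ t) : 0 ≤ dH F (ε * (q t * e t)) :=
  hF.dH_nonneg (mul_nonneg hε.le (h.qe_nonneg ht))

theorem DecayEstimates.dH_anti (h : DecayEstimates F ξ e Λ D w z q m K ρ σ) (hF : IsProfile F)
    {ε : ℝ} (hε : 0 < ε) : AntitoneOn (fun t => dH F (ε * (q t * e t))) (Ici 0) :=
  fun _ hx _ hy hxy => hF.monotoneOn_dH (mul_nonneg hε.le (h.qe_nonneg hy))
    (mul_nonneg hε.le (h.qe_nonneg hx)) (mul_le_mul_of_nonneg_left (h.qe_anti hx hy hxy) hε.le)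

theorem DecayEstimates.continuousOn_weightedFunctional
    (h : DecayEstimates F ξ e Λ D w z q m K ρ σ) (hF : IsProfile F) {ε : ℝ} (hε : 0 < ε) (γ : ℝ) :
    ContinuousOn (weightedFunctional F ξ e Λ q ε γ) (Ici 0) := by
  have h1 := h.q_cont.mul h.e_cont
  exact (((h.ξ_cont.mul (hF.continuousOn_dH.comp (continuousOn_const.mul h1)
    fun t ht => mul_nonneg hε.le (h.qe_nonneg ht))).mul h.q_cont).mul h.Λ_cont).add
    (continuousOn_const.mul h1)

theorem DecayEstimates.continuousOn_weightedRate (h : DecayEstimates F ξ e Λ D w z q m K ρ σ)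
    (ε γ t : ℝ) : ContinuousOn (weightedRate F ξ e D w z q m K ρ ε γ t) (Ici 0) :=
  (continuousOn_const.mul ((continuousOn_const.mul h.e_cont).neg.add
    (continuousOn_const.mul (h.D_cont.add h.w_cont)))).sub (continuousOn_const.mul h.z_cont)

theorem DecayEstimates.weightedFunctional_le (h : DecayEstimates F ξ e Λ D w z q m K ρ σ)
    (hF : IsProfile F) {ε γ : ℝ} (hε : 0 < ε) {t : ℝ} (ht : 0 ≤ t) :
    weightedFunctional F ξ e Λ q ε γ t
      ≤ (ξ 0 * dH F (ε * (q 0 * e 0)) * K + γ) * (q t * e t) := by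
  have h0 : (0 : ℝ) ∈ Ici (0 : ℝ) := le_refl (0 : ℝ)
  have h1 : ξ t * dH F (ε * (q t * e t)) ≤ ξ 0 * dH F (ε * (q 0 * e 0)) :=
    mul_le_mul (h.ξ_anti h0 ht ht) (h.dH_anti hF hε h0 ht ht) (h.dH_nonneg hF hε ht)
      (h.ξ_pos 0 le_rfl).le
  have h2 := h.dH_nonneg hF hε le_rfl
  have h3 := (h.ξ_pos 0 le_rfl).le
  have h4 := (h.q_pos t ht).le
  have h5 := (h.equiv t ht).2
  have h6 := (h.e_nonneg t ht).trans (h.equiv t ht).1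
  calc weightedFunctional F ξ e Λ q ε γ t
      ≤ ξ 0 * dH F (ε * (q 0 * e 0)) * q t * (K * e t) + γ * (q t * e t) := by
        unfold weightedFunctional
        gcongr
    _ = _ := by ring

theorem DecayEstimates.weightedFunctional_nonneg (h : DecayEstimates F ξ e Λ D w z q m K ρ σ)
    (hF : IsProfile F) {ε γ : ℝ} (hε : 0 < ε) {t : ℝ} (ht : 0 ≤ t) :
    γ * (q t * e t) ≤ weightedFunctional F ξ e Λ q ε γ t := by
  have h6 := (h.e_nonneg t ht).trans (h.equiv t ht).1
  exact le_add_of_nonneg_left (mul_nonneg (mul_nonneg (mul_nonneg (h.ξ_pos t ht).le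
    (h.dH_nonneg hF hε ht)) (h.q_pos t ht).le) h6)

/-- The coefficients of Λ and e are products of nonnegative non-increasing functions, because F' is
monotone and q e decreases. As Λ and e are nonnegative, freezing the coefficients at t only
increases the value at y, so they need not be differentiated. -/
theorem DecayEstimates.weightedFunctional_sub_le (h : DecayEstimates F ξ e Λ D w z q m K ρ σ)
    (hF : IsProfile F) {ε γ : ℝ} (hε : 0 < ε) (hγ : 0 < γ) {t y : ℝ} (ht : 0 ≤ t) (hy : t ≤ y) :
    weightedFunctional F ξ e Λ q ε γ y - weightedFunctional F ξ e Λ q ε γ t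
      ≤ ∫ τ in t..y, weightedRate F ξ e D w z q m K ρ ε γ t τ := by
  have hy0 : 0 ≤ y := ht.trans hy
  have h6 := (h.e_nonneg y hy0).trans (h.equiv y hy0).1
  set A := ξ t * dH F (ε * (q t * e t)) * q t with hA
  have hA0 : 0 ≤ A :=
    mul_nonneg (mul_nonneg (h.ξ_pos t ht).le (h.dH_nonneg hF hε ht)) (h.q_pos t ht).le
  have h1 : ξ y * dH F (ε * (q y * e y)) * q y ≤ A :=
    mul_le_mul (mul_le_mul (h.ξ_anti ht hy0 hy) (h.dH_anti hF hε ht hy0 hy)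
      (h.dH_nonneg hF hε hy0) (h.ξ_pos t ht).le) (h.q_anti ht hy0 hy) (h.q_pos y hy0).le
      (mul_nonneg (h.ξ_pos t ht).le (h.dH_nonneg hF hε ht))
  have h2 : weightedFunctional F ξ e Λ q ε γ y ≤ A * Λ y + γ * (q t * e y) := by
    refine add_le_add (mul_le_mul_of_nonneg_right h1 h6) (mul_le_mul_of_nonneg_left ?_ hγ.le)
    exact mul_le_mul_of_nonneg_right (h.q_anti ht hy0 hy) (h.e_nonneg y hy0)
  have h3 := mul_le_mul_of_nonneg_left (h.lyapunov t y ht hy) hA0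
  have h4 := mul_le_mul_of_nonneg_left (h.dissipation t y ht hy) (mul_pos hγ (h.q_pos t ht)).le
  have h5 : ∫ τ in t..y, weightedRate F ξ e D w z q m K ρ ε γ t τ
      = A * (∫ τ in t..y, (-(m * e τ) + K * (D τ + w τ))) - γ * ρ * q t * ∫ τ in t..y, z τ := by
    rw [← intervalIntegral.integral_const_mul, ← intervalIntegral.integral_const_mul,
      ← intervalIntegral.integral_sub]
    · rfl
    · exact (continuousOn_const.mul ((continuousOn_const.mul h.e_cont).neg.add
        (continuousOn_const.mul (h.D_cont.add h.w_cont)))).intervalIntegrable_Ici ht hy0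
    · exact (continuousOn_const.mul h.z_cont).intervalIntegrable_Ici ht hy0
  have h7 : weightedFunctional F ξ e Λ q ε γ t = A * Λ t + γ * (q t * e t) := rfl
  rw [h5, h7]
  nlinarith

/-- Apply `control` with x = ε q e. The choice of γ lets the dissipation absorb the z term, and 2Kε
≤ m absorbs x F'(x) into half of the damping, which leaves -2μ ξ G₂(x). Young's inequality for the
history term costs one μ ξ G₂(x) and produces G₄. -/
theorem DecayEstimates.weightedRate_le (h : DecayEstimates F ξ e Λ D w z q m K ρ σ)
    (hF : IsProfile F) {ε γ μ : ℝ} (hε : 0 < ε) (hεm : 2 * (K * ε) ≤ m) (hγ : K * σ ≤ γ * ρ)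
    (hμ : μ = m / (4 * ε)) {t : ℝ} (ht : 0 ≤ t) (hz : 0 ≤ z t) :
    weightedRate F ξ e D w z q m K ρ ε γ t t
      ≤ μ * (ξ t * (G₄ F (K / μ * (q t * w t)) - G₂ F (ε * (q t * e t)))) := by
  have hm := h.m_pos
  have hK := h.K_pos
  have hμ0 : 0 < μ := by rw [hμ]; positivity
  have hqe := h.qe_nonneg ht
  have hx : 0 ≤ ε * (q t * e t) := mul_nonneg hε.le hqe
  have hq := h.q_pos t ht
  have hξ := h.ξ_pos t ht
  have h1 := mul_le_mul_of_nonneg_left (h.control t ht _ hx) hK.le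
  have h2 : 0 ≤ K / μ * (q t * w t) :=
    mul_nonneg (div_pos hK hμ0).le (mul_nonneg hq.le (h.w_nonneg t ht))
  have h3 := mul_le_mul_of_nonneg_left (hF.mul_dH_le h2 hx) (mul_pos hμ0 hξ).le
  have h4 := mul_nonneg (mul_nonneg (sub_nonneg.2 hγ) hq.le) hz
  have h5 := h.dH_nonneg hF hε ht
  have h6 := mul_nonneg (mul_nonneg (sub_nonneg.2 hεm) hξ.le) (mul_nonneg hqe h5)
  have h7 : μ * ε = m / 4 := by rw [hμ]; field_simp
  have h8 : μ * (K / μ) = K := mul_div_cancel₀ _ hμ0.ne'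
  set a := dH F (ε * (q t * e t)) with ha
  have h9 : G₂ F (ε * (q t * e t)) = ε * (q t * e t) * a := rfl
  rw [h9] at h3 ⊢
  have h10 : weightedRate F ξ e D w z q m K ρ ε γ t t
    = ξ t * a * q t * (-(m * e t) + K * (D t + w t)) - γ * ρ * q t * z t := rfl
  rw [h10]
  have h11 : μ * ξ t * (K / μ * (q t * w t) * a) = K * (ξ t * (q t * w t) * a) := by
    rw [← h8]; field_simp
  have h12 : μ * ξ t * (ε * (q t * e t) * a) = m / 4 * (ξ t * (q t * e t) * a) := by
    rw [← h7]; ring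
  rw [h11] at h3
  nlinarith

/-- Comparison of the weighted functional with `G₅`. -/
theorem DecayEstimates.exists_decay (h : DecayEstimates F ξ e Λ D w z q m K ρ σ)
    (hF : IsProfile F) (hz : ∀ t, 0 ≤ t → 0 ≤ z t) :
    ∃ c₁ c C, 0 < c₁ ∧ 0 < c ∧ 0 < C ∧ ∀ χ : ℝ → ℝ, ContinuousOn χ (Ici 0) →
      AntitoneOn χ (Ici 0) → (∀ t, 0 ≤ t → 0 < χ t) → (∀ t, 0 ≤ t → χ t ≤ 1) →
      (∀ t, 0 ≤ t → G₄ F (c * (q t * w t))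
        ≤ G₂ F (G₅ F ξ c₁ t / χ t) - G₂ F (G₅ F ξ c₁ t) / χ t) →
      ∀ t, 0 ≤ t → e t ≤ C * G₅ F ξ c₁ t / (χ t * q t) := by
  have hm := h.m_pos
  have hK := h.K_pos
  have hρ := h.ρ_pos
  have hσ := h.σ_pos
  have he0 := h.e_nonneg 0 le_rfl
  -- The first entry is for the absorption in the rate; the second makes ε q(0) e(0) ≤ 1, which is
  -- the value of G₅ at time 0.
  set ε := min (m / (2 * K)) (1 / (1 + e 0)) with hεd
  have hε : 0 < ε := lt_min (by positivity) (by positivity)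
  have hε1 : 2 * (K * ε) ≤ m := by
    calc 2 * (K * ε) = 2 * K * ε := by ring
      _ ≤ 2 * K * (m / (2 * K)) := by gcongr; exact min_le_left _ _
      _ = m := mul_div_cancel₀ _ (by positivity)
  have hε2 : ε * (q 0 * e 0) ≤ 1 := by
    calc ε * (q 0 * e 0) ≤ 1 / (1 + e 0) * (1 * (1 + e 0)) := by
          have := h.q_zero
          have := (h.q_pos 0 le_rfl).le
          gcongr
          · exact min_le_right _ _
          · linarith
      _ = 1 := by field_simp
  set γ := K * σ / ρ with hγd
  have hγ : 0 < γ := by positivity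
  have hγ1 : K * σ ≤ γ * ρ := (div_mul_cancel₀ _ hρ.ne').ge
  set μ := m / (4 * ε) with hμd
  have hμ : 0 < μ := by positivity
  set N := ξ 0 * dH F (ε * (q 0 * e 0)) * K + γ with hNd
  have hN : 0 < N := by
    have := h.dH_nonneg hF hε le_rfl
    have := (h.ξ_pos 0 le_rfl).le
    positivity
  -- The functional is at most N q e, so δ times it lies below the argument ε q e of F'.
  set δ := ε / N with hδd
  have hδ : 0 < δ := by positivity
  have hc₁ : 0 < δ * μ / 2 := by positivity
  -- The functional decays at rate δμ; the factor 1/2 in c₁ provides the strict inequality required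
  -- at a contact point.
  refine ⟨δ * μ / 2, K / μ, 1 / (δ * γ), hc₁, by positivity, by positivity, ?_⟩
  intro χ hχc hχa hχ0 hχ1 hχ t ht
  set G := weightedFunctional F ξ e Λ q ε γ with hGd
  have hGc := h.continuousOn_weightedFunctional hF hε γ
  have hGz : ∀ s, 0 ≤ s → δ * G s ≤ ε * (q s * e s) := fun s hs => by
    calc δ * G s ≤ δ * (N * (q s * e s)) := by
          gcongr
          exact h.weightedFunctional_le hF hε hs
      _ = ε * (q s * e s) := by rw [hδd]; field_simp
  have hGn : ∀ s, 0 ≤ s → γ * (q s * e s) ≤ G s := fun s hs => h.weightedFunctional_nonneg hF hε hs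
  have hG0 : ∀ s, 0 ≤ s → 0 ≤ G s := fun s hs =>
    (mul_nonneg hγ.le (h.qe_nonneg hs)).trans (hGn s hs)
  have hG5 : ContinuousOn (G₅ F ξ (δ * μ / 2)) (Ici 0) := hF.continuousOn_G₅ h.ξ_pos h.ξ_cont hc₁
  have hsub : Icc 0 t ⊆ Ici (0 : ℝ) := fun x hx => hx.1
  -- A continuous function starting below G₅ stays below it if, whenever the two touch, its forward
  -- slope is less than the derivative of G₅.
  have main : δ * (χ t * G t) ≤ G₅ F ξ (δ * μ / 2) t := by
    refine image_le_of_liminf_slope_right_lt_deriv_boundary' (a := 0) (b := t)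
      (f := fun s => δ * (χ s * G s))
      (f' := fun s => δ * (χ s * weightedRate F ξ e D w z q m K ρ ε γ s s))
      (B := G₅ F ξ (δ * μ / 2))
      (B' := fun s => -(δ * μ / 2 * ξ s * G₂ F (G₅ F ξ (δ * μ / 2) s)))
      ((continuousOn_const.mul (hχc.mul hGc)).mono hsub) (fun s hs r hr => ?_) ?_
      (hG5.mono hsub) (fun s hs => hF.hasDerivWithinAt_G₅ h.ξ_pos h.ξ_cont hc₁ hs.1)
      (fun s hs heq => ?_) ⟨ht, le_rfl⟩
    · have hs0 : 0 ≤ s := hs.1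
      refine (eventually_slope_lt hs0
        (Φ := fun τ => δ * (χ s * weightedRate F ξ e D w z q m K ρ ε γ s τ))
        (continuousOn_const.mul (continuousOn_const.mul (h.continuousOn_weightedRate ε γ s)))
        (fun y hy => ?_) hr).frequently
      rw [intervalIntegral.integral_const_mul, intervalIntegral.integral_const_mul]
      have h1 := h.weightedFunctional_sub_le hF hε hγ hs0 hy.le
      have h2 := mul_le_mul_of_nonneg_right (hχa hs0 (mem_Ici.2 (hs0.trans hy.le)) hy.le)
        (hG0 y (hs0.trans hy.le))
      have h3 := mul_le_mul_of_nonneg_left h1 (hχ0 s hs0).le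
      rw [← mul_sub]
      refine mul_le_mul_of_nonneg_left ?_ hδ.le
      linarith [mul_sub (χ s) (G y) (G s)]
    · rw [hF.G₅_zero]
      calc δ * (χ 0 * G 0) ≤ δ * (1 * G 0) := by
            have := hG0 0 le_rfl
            gcongr
            exact hχ1 0 le_rfl
        _ ≤ 1 := by rw [one_mul]; exact (hGz 0 le_rfl).trans hε2
    · have hs0 : 0 ≤ s := hs.1
      have hχs := hχ0 s hs0
      have h5 := hF.G₅_mem h.ξ_pos hc₁ hs0
      have hξ := h.ξ_pos s hs0
      set v := G₅ F ξ (δ * μ / 2) s with hv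
      -- At a contact point v/χ is δ times the functional. By monotonicity of G₂, the inequality of
      -- the class S then applies with ε q e in place of v/χ.
      have h6 : v / χ s ≤ ε * (q s * e s) := by
        refine le_trans (le_of_eq ?_) (hGz s hs0)
        rw [← heq]
        field_simp
      have h7 := hF.monotoneOn_G₂ (mem_Ici.2 (div_pos h5.1 hχs).le)
        (mem_Ici.2 (mul_nonneg hε.le (h.qe_nonneg hs0))) h6
      have h8 := h.weightedRate_le hF hε hε1 hγ1 hμd hs0 (hz s hs0)
      have h9 := hχ s hs0
      have h10 := hF.G₂_pos h5.1
      have h11 : G₄ F (K / μ * (q s * w s)) - G₂ F (ε * (q s * e s)) ≤ -(G₂ F v / χ s) := by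
        linarith
      have h12 : δ * (χ s * weightedRate F ξ e D w z q m K ρ ε γ s s)
          ≤ δ * (χ s * (μ * (ξ s * -(G₂ F v / χ s)))) := by
        gcongr
        exact h8.trans (by gcongr)
      have h13 : δ * (χ s * (μ * (ξ s * -(G₂ F v / χ s)))) = -(δ * μ * ξ s * G₂ F v) := by
        field_simp
      have h14 : 0 < δ * μ * ξ s * G₂ F v := by positivity
      rw [h13] at h12
      linarith
  have hq := h.q_pos t ht
  have hχt := hχ0 t ht
  rw [le_div_iff₀ (by positivity), one_div, ← div_eq_inv_mul, le_div_iff₀ (by positivity)]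
  calc e t * (χ t * q t) * (δ * γ) = δ * (χ t * (γ * (q t * e t))) := by ring
    _ ≤ δ * (χ t * G t) := by gcongr; exact hGn t ht
    _ ≤ _ := main

end Decay

/-! ### Verification of the decay estimates and choice of q₀ -/

section Final

variable {X : Type*} [NormedAddCommGroup X] [InnerProductSpace ℝ X] [CompleteSpace X]
  {J : X →L[ℝ] X} {V : Submodule ℝ X} {g k F ξ : ℝ → ℝ} {ρ₁ ρ₂ b κ C : ℝ}
  {P φt ψ ψx ψt : ℝ → X}

/-- The total deviation over positive times is controlled by the history. -/
theorem AbstractSolution.exists_integral_sq_le (U : AbstractSolution J V g ρ₁ ρ₂ b κ P φt ψ ψx ψt)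
    {e : ℝ → ℝ} {K : ℝ} (he : e = abstractEnergy g ρ₁ ρ₂ b κ P φt ψx ψt)
    (hanti : AntitoneOn e (Ici 0))
    (hK : ∀ y, 0 ≤ y → ∫ t in (0 : ℝ)..y, e t ≤ K * (1 + ∫ t in (0 : ℝ)..y, historyWeight g P t)) :
    ∃ c, 0 < c ∧ ∀ t, 0 ≤ t → ∫ s in (0 : ℝ)..t, ‖P t - P (t - s)‖ ^ 2
      ≤ c * K * (1 + ∫ s in (0 : ℝ)..t, historyWeight g P s) := by
  obtain ⟨c, hc, hb⟩ := U.exists_energy_bounds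
  refine ⟨4 * c, by positivity, fun t ht => ?_⟩
  have hec : ContinuousOn e (Ici 0) := he ▸ U.continuousOn_energy
  have hsub : ContinuousOn (fun s => t - s) (uIcc 0 t) := by fun_prop
  have hmaps : MapsTo (fun s => t - s) (uIcc 0 t) (Ici 0) := fun s hs => by
    rw [uIcc_of_le ht] at hs
    exact sub_nonneg.2 hs.2
  have h1 : ∫ s in (0 : ℝ)..t, ‖P t - P (t - s)‖ ^ 2 ≤ ∫ s in (0 : ℝ)..t, 4 * c * e (t - s) := by
    refine intervalIntegral.integral_mono_on ht ?_ ?_ fun s hs => ?_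
    · exact ((continuousOn_const.sub (U.sq.cont.comp hsub hmaps)).norm.pow 2).intervalIntegrable
    · exact (continuousOn_const.mul (hec.comp hsub hmaps)).intervalIntegrable
    · have h2 := norm_sub_sq_le_two (P t) (P (t - s))
      have h3 := (hb t).2.2.2.1
      have h4 := (hb (t - s)).2.2.2.1
      rw [← he] at h3 h4
      -- Since e(t) ≤ e(t-s), both squares are controlled by e(t-s), whose integral over s is the
      -- integral of e over (0, t).
      have h5 := hanti (mem_Ici.2 (sub_nonneg.2 hs.2)) (mem_Ici.2 ht) (sub_le_self t hs.1)
      nlinarith [mul_le_mul_of_nonneg_left h5 hc.le]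
  rw [intervalIntegral.integral_const_mul, intervalIntegral.integral_comp_sub_left (fun s => e s),
    sub_self, sub_zero] at h1
  calc _ ≤ _ := h1
    _ ≤ 4 * c * (K * (1 + ∫ s in (0 : ℝ)..t, historyWeight g P s)) := by gcongr; exact hK t ht
    _ = _ := by ring

/-- The convexity of the profile turns the dissipation into a bound for the head deviation. -/
theorem HasSqMemory.headDeviation_control (hP : HasSqMemory g P) (hg : IsKernel g)
    (hF : IsProfile F) (hξ : AntitoneOn ξ (Ici 0)) (hξ0 : ∀ t, 0 ≤ t → 0 < ξ t) {c : ℝ} (hc : 0 < c)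
    (hk : DissipationKernel g (fun s => c * (ξ s * F (g s))) C) {t x Q : ℝ} (ht : 0 ≤ t)
    (hx : 0 ≤ x) (hQ : 0 < Q) (hQt : Q * ∫ s in (0 : ℝ)..t, ‖P t - P (t - s)‖ ^ 2 ≤ 1) :
    ξ t * (dH F x * (Q * headDeviation g P t))
      ≤ c⁻¹ * (Q * deviation (fun s => c * (ξ s * F (g s))) P t) + ξ t * (x * dH F x) := by
  set k := fun s => c * (ξ s * F (g s)) with hkd
  set y := fun s => ‖P t - P (t - s)‖ ^ 2 with hy
  have ha := hF.dH_nonneg hx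
  have hξt := hξ0 t ht
  have hmaps : MapsTo (fun s => t - s) (uIcc 0 t) (Ici 0) := fun s hs => by
    rw [uIcc_of_le ht] at hs
    exact sub_nonneg.2 hs.2
  have hpos : uIcc 0 t ⊆ Ici 0 := fun s hs => by
    rw [uIcc_of_le ht] at hs
    exact hs.1
  have hyc : ContinuousOn y (uIcc 0 t) :=
    (continuousOn_const.sub (hP.cont.comp (by fun_prop) hmaps)).norm.pow 2
  have hkc : ContinuousOn (fun s => k s * y s) (uIcc 0 t) := (hk.sub.cont.mono hpos).mul hyc
  have hgc : ContinuousOn (fun s => g s * y s) (uIcc 0 t) := (hg.cont.mono hpos).mul hyc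
  have h1 : ∫ s in (0 : ℝ)..t, ξ t * dH F x * (g s * y s)
      ≤ ∫ s in (0 : ℝ)..t, (c⁻¹ * (k s * y s) + ξ t * (x * dH F x) * y s) := by
    refine intervalIntegral.integral_mono_on ht (continuousOn_const.mul hgc).intervalIntegrable
      ((continuousOn_const.mul hkc).add (continuousOn_const.mul hyc)).intervalIntegrable
      fun s hs => ?_
    have h2 := hF.tangent_le hx (hg.pos s hs.1).le
    have h3 := hF.nonneg hx
    -- Monotonicity of ξ moves it from time t to the delay s ≤ t, where it is part of the
    -- dissipation kernel.
    have h4 : ξ t * F (g s) ≤ ξ s * F (g s) :=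
      mul_le_mul_of_nonneg_right (hξ hs.1 ht hs.2) (hF.nonneg (hg.pos s hs.1).le)
    have h5 : c⁻¹ * (k s * y s) = ξ s * F (g s) * y s := by
      rw [hkd]
      field_simp
    have hy0 : 0 ≤ y s := by positivity
    -- The tangent of F at x, evaluated at g(s), with F(x) ≥ 0 discarded. After weighting by y and
    -- multiplying by Q, the last term is controlled because Q ∫ y ≤ 1.
    have h6 : ξ t * dH F x * g s ≤ ξ s * F (g s) + ξ t * (x * dH F x) := by
      nlinarith [mul_le_mul_of_nonneg_left (show g s * dH F x ≤ F (g s) + x * dH F x by linarith)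
        hξt.le]
    rw [h5]
    nlinarith [mul_le_mul_of_nonneg_right h6 hy0]
  rw [intervalIntegral.integral_add (hkc.intervalIntegrable.const_mul _)
    (hyc.intervalIntegrable.const_mul _), intervalIntegral.integral_const_mul,
    intervalIntegral.integral_const_mul, intervalIntegral.integral_const_mul] at h1
  have h2 : ∫ s in (0 : ℝ)..t, k s * y s ≤ deviation k P t := by
    rw [intervalIntegral.integral_of_le ht]
    refine setIntegral_mono_set (hP.integrableOn_deviation hg hk.sub ht) ?_
      Ioc_subset_Ioi_self.eventuallyLE
    filter_upwards [ae_restrict_mem measurableSet_Ioi] with s hs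
    exact mul_nonneg (hk.pos s (le_of_lt hs)).le (sq_nonneg _)
  have h3 := mul_le_mul_of_nonneg_left h1 hQ.le
  have h4 := mul_le_mul_of_nonneg_left h2 (mul_pos hQ (inv_pos.2 hc)).le
  have h5 := mul_le_mul_of_nonneg_left hQt (mul_nonneg hξt.le (mul_nonneg hx ha))
  have h6 : headDeviation g P t = ∫ s in (0 : ℝ)..t, g s * y s := rfl
  rw [h6]
  linarith

/-- The decay estimate for an abstract solution. -/
theorem AbstractSolution.exists_decayEstimates
    (U : AbstractSolution J V g ρ₁ ρ₂ b κ P φt ψ ψx ψt) (hF : IsProfile F)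
    (hξ : AntitoneOn ξ (Ici 0)) (hξc : ContinuousOn ξ (Ici 0)) (hξ0 : ∀ t, 0 ≤ t → 0 < ξ t)
    {c : ℝ} (hc : 0 < c) (hk : DissipationKernel g (fun s => c * (ξ s * F (g s))) C) :
    ∃ q₀ Λ m K, 0 < q₀ ∧ q₀ < 1 ∧
      DecayEstimates F ξ (abstractEnergy g ρ₁ ρ₂ b κ P φt ψx ψt) Λ (headDeviation g P)
        (historyWeight g P) (deviation (fun s => c * (ξ s * F (g s))) P)
        (fun t => q₀ / (1 + ∫ s in (0 : ℝ)..t, historyWeight g P s)) m K (κ / 4) c⁻¹ := by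
  have hg := U.kernel
  have hκ := U.κ_pos
  obtain ⟨Λ, m, K, hm, hK, hΛ, hequiv, hlyap, hint⟩ := U.exists_lyapunov hk
  have hz : ∀ t, 0 ≤ deviation (fun s => c * (ξ s * F (g s))) P t := fun t =>
    Timoshenko.deviation_nonneg fun s hs => (hk.pos s hs).le
  have hdiss := fun x y (hx : 0 ≤ x) (hxy : x ≤ y) => U.energy_le hk hx hxy
  have hanti : AntitoneOn (abstractEnergy g ρ₁ ρ₂ b κ P φt ψx ψt) (Ici 0) := fun x hx y hy hxy => by
    have h1 := hdiss x y hx hxy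
    have h2 := intervalIntegral.integral_nonneg (μ := volume) hxy fun t _ => hz t
    nlinarith [mul_nonneg hκ.le h2]
  obtain ⟨c', hc', hsq⟩ := U.exists_integral_sq_le rfl hanti hint
  have hw := U.sq.continuousOn_historyWeight hg
  have hw0 : ∀ t, 0 ≤ t → 0 ≤ historyWeight g P t := fun t ht => historyWeight_nonneg hg ht
  have hI : ∀ t, 0 ≤ t → 0 < 1 + ∫ s in (0 : ℝ)..t, historyWeight g P s := fun t ht =>
    add_pos_of_pos_of_nonneg one_pos (intervalIntegral.integral_nonneg ht fun s hs => hw0 s hs.1)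
  -- The second entry gives q(t) ∫₀ᵗ ‖P(t) - P(t-s)‖² ds ≤ 1; the first keeps q₀ below 1.
  set q₀ := min (1 / 2) (1 / (c' * K)) with hq₀
  have hq₀0 : 0 < q₀ := lt_min (by norm_num) (by positivity)
  have hq₀1 : q₀ < 1 := (min_le_left _ _).trans_lt (by norm_num)
  refine ⟨q₀, Λ, m, K, hq₀0, hq₀1, ?_⟩
  exact {
    m_pos := hm
    K_pos := hK
    ρ_pos := by positivity
    σ_pos := by positivity
    ξ_pos := hξ0
    ξ_anti := hξ
    ξ_cont := hξc
    q_pos := fun t ht => div_pos hq₀0 (hI t ht)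
    q_anti := fun x hx y hy hxy => div_le_div_of_nonneg_left hq₀0.le (hI x hx)
      (add_le_add_right (monotoneOn_integral_Ici hw hw0 hx hy hxy) 1)
    q_cont := continuousOn_const.div (continuousOn_const.add (continuousOn_integral_Ici hw))
      fun t ht => (hI t ht).ne'
    q_zero := by simpa using hq₀1.le
    e_cont := U.continuousOn_energy
    Λ_cont := hΛ
    D_cont := U.sq.continuousOn_headDeviation hg
    w_cont := hw
    z_cont := U.sq.continuousOn_deviation hg hk.sub
    e_nonneg := fun t _ => U.energy_nonneg t
    e_anti := hanti
    w_nonneg := hw0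
    equiv := hequiv
    lyapunov := hlyap
    dissipation := hdiss
    control := fun t ht x hx => by
      refine U.sq.headDeviation_control hg hF hξ hξ0 hc hk ht hx (div_pos hq₀0 (hI t ht)) ?_
      rw [div_mul_eq_mul_div, div_le_one (hI t ht)]
      calc _ ≤ 1 / (c' * K) * (c' * K * (1 + ∫ s in (0 : ℝ)..t, historyWeight g P s)) := by
            refine mul_le_mul (min_le_right _ _) (hsq t ht) ?_ (by positivity)
            exact intervalIntegral.integral_nonneg ht fun s _ => sq_nonneg _
        _ = _ := by field_simp }

end Final

end Timoshenko

end

/-! ### The theorem -/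

open Timoshenko
theorem theorem4p1 (B : Beam) (g ξ H Hbar : ℝ → ℝ) (r : ℝ)
    (hA1 : AssumptionA1 B g) (hA2 : AssumptionA2 g ξ H r)
    (hHbar : IsExtendedProfile H r Hbar)
    (hspeed : B.κ / B.ρ₁ = B.b / B.ρ₂)
    (D : InitialData B.L) (hD : D.Admissible g)
    (U : Trajectory B.L) (hU : IsWeakSolution B g D U) :
    ∃ q₀ c₁ c₂ c d C : ℝ,
      0 < q₀ ∧ q₀ < 1 ∧ 0 < c₁ ∧ 0 < c₂ ∧ 0 < c ∧ 0 < d ∧ 0 < C ∧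
      ∀ χ : ℝ → ℝ, ClassS g ξ Hbar D q₀ c₁ c₂ c d χ →
        ∀ t : ℝ, 0 ≤ t →
          energy B g U t ≤ C * G₅ Hbar ξ c₁ t / (χ t * q g D q₀ t) := by
  have hF := hA2.isProfile hHbar
  have S := hU.abstractSolution hA1 hspeed hD
  have hh : h₀ g D = historyWeight g U.px := funext hU.h₀_eq
  obtain ⟨k, M, hk0, hk⟩ := hA2.exists_dissipationKernel hA1 hHbar
  obtain ⟨q₀, Λ, m, K, hq₀, hq₁, hest⟩ := S.exists_decayEstimates hF hA2.ξ_anti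
    hA2.ξ_diff.continuousOn hA2.ξ_pos hk0 hk
  obtain ⟨c₁, c, C, hc₁, hc, hC, hdecay⟩ := hest.exists_decay hF fun t _ =>
    Timoshenko.deviation_nonneg fun s hs => (hk.pos s hs).le
  -- With c₂ = c₁ the common factor cancels from the inequality defining S, and d = 1 leaves c as
  -- the only constant inside G₄.
  refine ⟨q₀, c₁, c₁, c, 1, C, hq₀, hq₁, hc₁, hc₁, hc, one_pos, hC, fun χ hχ t ht => ?_⟩
  have hdiff := hχ.c1.differentiableOn (by norm_num)
  have hanti : AntitoneOn χ (Ici 0) := by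
    refine antitoneOn_of_deriv_nonpos (convex_Ici 0) hχ.c1.continuousOn
      (hdiff.mono interior_subset) fun x hx => ?_
    rw [interior_Ici] at hx
    rw [← derivWithin_of_mem_nhds (Ici_mem_nhds hx)]
    exact hχ.deriv_nonpos x (le_of_lt hx)
  have hfinal := hdecay χ hχ.c1.continuousOn hanti hχ.pos hχ.le_one (fun s hs => ?_) t ht
  · rw [energy_eq_abstractEnergy, q, hh]
    exact hfinal
  · have h1 := le_of_mul_le_mul_left (hχ.dif s hs) hc₁
    rw [div_one, q, hh] at h1
    exact h1
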